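/- **Problem.** An instance of metric $k$-center consists of integers $1\le k\le n$ and a metric $d$ on an $n$-point set $V$, given explicitly by all pairwise distances. The distances are nonnegative rationals whose numerator and denominator are at most $n^p$ for some constant $p$ (so each distance takes $O(\log n)$ bits). A solution is a nonempty set $S\subseteq V$ with $|S|\le k$; its cost is $\max_{x\in V}\min_{y\in S}d(x,y)$. **Model.** A MapReduce algorithm is a finite sequence of rounds, each given by a mapper and a reducer. These are fixed programs of a random access machine, which do not depend on the instance; every run of them knows $n$ and $k$, and reducers may toss independent fair coins. The input consists of the pairs $\langle (x,y);d(x,y)\rangle$ for $x,y\in V$. In each round the mapper is run separately on every $\langle key;value\rangle$ pair and outputs a sequence of pairs; all pairs with the same key are sent to one machine (in an order that the algorithm does not control); on each such machine the reducer is run on the key and all its values and outputs pairs with the same key, which form the input of the next round or the final output. The memory of a machine is measured in bits and includes its input, its working memory and, for reducers, its output. The algorithm has to run in polynomial time: for every outcome of the coins, each mapper and each reducer halts after a number of steps, and with an amount of memory, that is polynomial in $n$. **Theorem.** There are absolute constants $\alpha$ and $c$ such that for every constant $\delta>0$ there is a polynomial-time randomized MapReduce algorithm with at most $c\lceil 1/\delta\rceil$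 rounds and with the following property. For every constant $p$ there is a constant $M$ (depending only on $\delta$, $p$ and the algorithm) such that, on every instance of metric $k$-center as above, with probability at least $1-M/n$ (that is, with high probability) every machine uses at most $M k^2 n^{\delta}$ bits of memory in every round, and the algorithm outputs a solution whose cost is at most $\alpha$ times the cost of an optimal solution. -/

import Mathlib

/-! A randomized MapReduce model with explicit programs, step counts and memory counts, and the
metric `k`-center problem on explicitly given distance matrices. -/

open MeasureTheory

namespace MR

/-! ### Sequential programs: a randomized RAM with finitely many arrays of natural numbers -/

/-- Arithmetic expressions over `m` registers, each of which holds an array of natural numbers. -/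
inductive Expr (m : ℕ) : Type
  | lit (c : ℕ)
  | get (r : Fin m) (i : Expr m)
  | len (r : Fin m)
  | add (a b : Expr m)
  | sub (a b : Expr m)
  | mul (a b : Expr m)
  | div (a b : Expr m)
  | mod (a b : Expr m)
  | lt (a b : Expr m)
  | eq (a b : Expr m)

/-- Elementary instructions. `flip` tosses a fair coin; `emit` outputs a key-value pair. -/
inductive Instr (m : ℕ) : Type
  | nop
  | push (r : Fin m) (e : Expr m)
  | pop (r : Fin m)
  | set (r : Fin m) (i e : Expr m)
  | clear (r : Fin m)
  | flip (r : Fin m)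
  | emit (key val : List (Expr m))

/-- Programs. A test succeeds when its expression is nonzero. -/
inductive Cmd (m : ℕ) : Type
  | instr (i : Instr m)
  | seq (a b : Cmd m)
  | ite (e : Expr m) (a b : Cmd m)
  | loop (e : Expr m) (a : Cmd m)

/-- A key-value pair; keys and values are finite sequences of natural numbers. -/
abbrev KV : Type := List ℕ × List ℕ

/-- The number of bits needed to store a finite sequence of natural numbers
(binary digits, and one separator for each entry). -/
def bits (l : List ℕ) : ℕ := (l.map fun a => Nat.size a + 1).sum

/-- The state of a machine: the contents of its registers, the number of coins tossed so far, and
the pairs emitted so far. -/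
structure Config (m : ℕ) : Type where
  regs : Fin m → List ℕ
  tossed : ℕ
  out : List KV

/-- The memory in use, in bits: the contents of all registers. (Emitted pairs have left the
machine; for reducers they are charged separately in `Round.Runs`.) -/
def Config.mem {m : ℕ} (s : Config m) : ℕ := ∑ r, bits (s.regs r)

/-- The value of an expression; reading beyond the end of an array gives `0`. -/
def Expr.eval {m : ℕ} (s : Fin m → List ℕ) : Expr m → ℕ
  | .lit c => c
  | .get r i => (s r).getD (i.eval s) 0
  | .len r => (s r).length
  | .add a b => a.eval s + b.eval s
  | .sub a b => a.eval s - b.eval s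
  | .mul a b => a.eval s * b.eval s
  | .div a b => a.eval s / b.eval s
  | .mod a b => a.eval s % b.eval s
  | .lt a b => if a.eval s < b.eval s then 1 else 0
  | .eq a b => if a.eval s = b.eval s then 1 else 0

/-- The effect of an elementary instruction; the `j`-th coin toss shows `coins j`. -/
def Instr.step {m : ℕ} (coins : ℕ → Bool) (s : Config m) : Instr m → Config m
  | .nop => s
  | .push r e => { s with regs := Function.update s.regs r (s.regs r ++ [e.eval s.regs]) }
  | .pop r => { s with regs := Function.update s.regs r (s.regs r).dropLast }
  | .set r i e =>
      { s with regs := Function.update s.regs r ((s.regs r).set (i.eval s.regs) (e.eval s.regs)) }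
  | .clear r => { s with regs := Function.update s.regs r [] }
  | .flip r =>
      { s with
        regs := Function.update s.regs r (s.regs r ++ [(coins s.tossed).toNat])
        tossed := s.tossed + 1 }
  | .emit key val =>
      { s with out := s.out ++ [(key.map (Expr.eval s.regs), val.map (Expr.eval s.regs))] }

/-- `Exec coins a s t q s'`: the program `a`, started in state `s`, halts in state `s'` after
exactly `t` steps (elementary instructions and tests), and the largest memory in use on the way,
including at the start and at the end, is `q` bits. Time is the number of steps; it is meaningful
together with a bound on the memory, which bounds the length of all numbers that a step works on
(an expression has a fixed size, so its intermediate values are longer by a constant factor only). -/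
inductive Exec {m : ℕ} (coins : ℕ → Bool) :
    Cmd m → Config m → ℕ → ℕ → Config m → Prop
  | instr (i : Instr m) (s : Config m) :
      Exec coins (.instr i) s 1 (max s.mem (i.step coins s).mem) (i.step coins s)
  | seq {a b : Cmd m} {s s' s'' : Config m} {t t' q q' : ℕ} :
      Exec coins a s t q s' → Exec coins b s' t' q' s'' →
      Exec coins (.seq a b) s (t + t') (max q q') s''
  | ite_true {e : Expr m} {a b : Cmd m} {s s' : Config m} {t q : ℕ} :
      e.eval s.regs ≠ 0 → Exec coins a s t q s' → Exec coins (.ite e a b) s (t + 1) q s'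
  | ite_false {e : Expr m} {a b : Cmd m} {s s' : Config m} {t q : ℕ} :
      e.eval s.regs = 0 → Exec coins b s t q s' → Exec coins (.ite e a b) s (t + 1) q s'
  | loop_true {e : Expr m} {a : Cmd m} {s s' s'' : Config m} {t t' q q' : ℕ} :
      e.eval s.regs ≠ 0 → Exec coins a s t q s' → Exec coins (.loop e a) s' t' q' s'' →
      Exec coins (.loop e a) s (t + t' + 1) (max q q') s''
  | loop_false {e : Expr m} {a : Cmd m} {s : Config m} :
      e.eval s.regs = 0 → Exec coins (.loop e a) s 1 s.mem s

/-- A program together with the number of its working registers; three more registers hold the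
input. -/
structure Program : Type where
  work : ℕ
  code : Cmd (work + 3)

/-- The initial state: register `0` holds the global parameters, register `1` the key, register `2`
the values, one after the other, each preceded by its length; all other registers are empty. -/
def initConfig (w : ℕ) (params key : List ℕ) (vals : List (List ℕ)) : Config (w + 3) where
  regs := fun r =>
    if r.val = 0 then params
    else if r.val = 1 then key
    else if r.val = 2 then (vals.map fun v => v.length :: v).flatten
    else []
  tossed := 0
  out := []

/-- On the given parameters, key and values, with the given coins, the program halts within `T`
steps, never has more than `Q` bits in memory, and emits the pairs `out`. -/
def Program.Runs (P : Program) (T : ℕ) (Q : ℝ) (coins : ℕ → Bool)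
    (params key : List ℕ) (vals : List (List ℕ)) (out : List KV) : Prop :=
  ∃ (t q : ℕ) (s : Config (P.work + 3)),
    Exec coins P.code (initConfig P.work params key vals) t q s ∧
      t ≤ T ∧ (q : ℝ) ≤ Q ∧ s.out = out

/-! ### MapReduce rounds -/

/-- The outcomes of all coins: one fair coin for each round, each machine (addressed by its key)
and each toss of that machine in that round. -/
abbrev Coins : Type := ℕ × List ℕ × ℕ → Bool

/-- All coins are fair and independent. -/
noncomputable def coinMeasure : Measure Coins :=
  Measure.infinitePi fun _ => (PMF.uniformOfFintype Bool).toMeasure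

/-- The values which are sent to the machine with address `key`, in order of arrival. -/
def valuesAt (l : List KV) (key : List ℕ) : List (List ℕ) :=
  (l.filter fun p => p.1 = key).map Prod.snd

/-- A MapReduce round: a map program and a reduce program. -/
structure Round : Type where
  mapper : Program
  reducer : Program

/-- One execution of a round, transforming the list `input` of pairs into the list `output`, in
which every mapper and every reducer takes at most `T` steps and at most `Q` bits of memory.

* Map: the mapper is run separately on every pair of the input; mappers toss no coins (all their
  coins show `false`).
* Shuffle: all pairs with the same key are sent to the same machine. The pairs arrive in an order
  `shuffle` which the algorithm does not control.
* Reduce: on every machine that received some pair, the reducer is run on the key and on all the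
  values received; the pairs it outputs have the same key. The output of a reducer, too, has to
  fit into `Q` bits. -/
def Round.Runs (R : Round) (T : ℕ) (Q : ℝ) (shuffle : List KV → List KV)
    (coins : List ℕ → ℕ → Bool) (params : List ℕ) (input output : List KV) : Prop :=
  ∃ (mapped reduced : List (List KV)),
    List.Forall₂ (fun p o => R.mapper.Runs T Q (fun _ => false) params p.1 [p.2] o)
      input mapped ∧
    List.Forall₂
      (fun key o => ∃ e : List KV,
        R.reducer.Runs T Q (coins key) params key (valuesAt (shuffle mapped.flatten) key) e ∧
        o = e.map (fun p => (key, p.2)) ∧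
        (((o.map fun p => bits p.1 + bits p.2).sum : ℕ) : ℝ) ≤ Q)
      ((shuffle mapped.flatten).map Prod.fst).dedup reduced ∧
    output = reduced.flatten

/-- A MapReduce algorithm: a finite sequence of rounds. -/
abbrev Algorithm : Type := List Round

/-- An execution of a sequence of rounds, the first of which has number `r`, within `T` steps and
`Q` bits of memory on every machine in every round. -/
def RunsFrom (T : ℕ) (Q : ℝ) (shuffle : ℕ → List KV → List KV) (ω : Coins) (params : List ℕ) :
    ℕ → Algorithm → List KV → List KV → Prop
  | _, [], input, output => output = input
  | r, R :: A, input, output =>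
      ∃ mid : List KV,
        R.Runs T Q (shuffle r) (fun key j => ω (r, key, j)) params input mid ∧
        RunsFrom T Q shuffle ω params (r + 1) A mid output

/-! ### The metric `k`-center problem -/

/-- A metric on `n` points. -/
structure IsMetric {n : ℕ} (d : Fin n → Fin n → NNRat) : Prop where
  eq_zero_iff : ∀ x y, d x y = 0 ↔ x = y
  symm : ∀ x y, d x y = d y x
  triangle : ∀ x y z, d x z ≤ d x y + d y z

/-- The input pairs: for any two points, a pair whose key consists of the two points and whose value
is their distance (numerator and denominator). -/
def inputPairs {n : ℕ} (d : Fin n → Fin n → NNRat) : List KV :=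
  (List.finRange n).flatMap fun x => (List.finRange n).map fun y =>
    ([x.val, y.val], [(d x y).num, (d x y).den])

/-- The `k`-center objective: the largest distance from a point to its nearest center. -/
def cost {n : ℕ} (d : Fin n → Fin n → NNRat) (S : Finset (Fin n)) (hS : S.Nonempty) : NNRat :=
  Finset.univ.sup fun x => S.inf' hS fun y => d x y

/-- `S` is a solution for `k`-center whose cost is at most `α` times that of any solution. -/
def IsApprox {n : ℕ} (d : Fin n → Fin n → NNRat) (k : ℕ) (α : NNRat) (S : Finset (Fin n)) :
    Prop :=
  ∃ hS : S.Nonempty, S.card ≤ k ∧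
    ∀ (S' : Finset (Fin n)) (hS' : S'.Nonempty), S'.card ≤ k → cost d S hS ≤ α * cost d S' hS'

/-- The values of the output pairs are the points of `S`. -/
def Outputs {n : ℕ} (out : List KV) (S : Finset (Fin n)) : Prop :=
  ∀ v : List ℕ, v ∈ out.map Prod.snd ↔ ∃ x ∈ S, v = [x.val]

end MR

/-!
The algorithm is greedy covering on random samples of growing density. Put `m = 5 ⌈1 / δ⌉` and let
`R` be `n ^ (1 / m)`, rounded up. With its coins, the machine `[x, x]` draws a level in
`0, …, m - 1` for the point `x`, in such a way that a point has level at most `i` with probability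
about `C k R ^ (i + 2) / n`, where `C` depends on `m` only (`level`, `levelOf_le_iff`). In
iteration `i`, the points of level `i` that are not yet covered are sent, with all their distances,
to a single machine. This machine tries all distances as radii, builds a greedy net for each, and
keeps the smallest radius for which the net has at most `k` points (`selectCode`). Since the points
of a greedy net are more than the radius apart, a radius at least twice the optimal cost never
gives more than `k` points. A candidate radius above twice the optimal cost is hence never needed,
and the selected radius is at most twice the optimal cost (`NetBound`, `netBound_two_mul_cost`,
`exists_selected`). All points within the selected radius of one of the selected centers are then
covered. After `m` iterations every point is within twice the optimal cost of one of at most `m k`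
centers, and a last greedy net among these centers costs another twice the optimal cost: the
approximation factor is `4` (`exists_run`).

The machines `[x, y]` keep the distance of `x` and `y` and the status of both points. Three rounds
carry out one iteration: a center `c` becomes known on all machines `[z, c]`, such a machine
compares the distance with the radius and sends a message to `z`, and the message is delivered to
all machines `[z, y]` and `[y, z]` (`IsState.step`). At most `k` messages reach a point in a round,
so these machines need little memory. The machine which selects the centers needs memory quadratic
in the number of points it receives, and it remains to bound this number.

The points still uncovered at the start of iteration `i` form a set `W`: the complement of at most
`m k` balls, each given by a center and two points whose distance is its radius. There are at most
`(n ^ 3 + 1) ^ (m k)` such sets. For one fixed set `W` and one `i`, up to a probability of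
`2 exp (-C k R)`, the following holds (`coinMeasure_badEvent_le`): if `W` has more than
`n / R ^ (i + 1)` points, then one of them has level at most `i`, and if `W` has at most
`n / R ^ i` points, then fewer than `16 C k R ^ 2` of them have level at most `i`. As
`log n ≤ m R`, a union bound over all `W` and `i` loses only a factor `exp (4 m ^ 2 k R)`. The
union bound makes any independence between the levels and the balls chosen by the algorithm
unnecessary: whichever balls are chosen, the uncovered set contains no point of smaller level,
hence has at most `n / R ^ i` points, and hence at most `16 C k R ^ 2` points of level `i`
(`GoodLevels`, `coinMeasure_not_goodLevels_le`). The memory is therefore of order `(k R ^ 2) ^ 2`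
numbers, each of which has `O(log n)` bits. This is at most a constant times `k ^ 2 R ^ 5`, and
`R ^ 5` is at most `32 n ^ δ` (`limits_small`). For unlucky coins, the trivial bound of `n` points
on every sample gives the polynomial bounds (`limits_polynomial`).

The run times and the memory of the programs are obtained from triples `Tr`, a Hoare logic for
deterministic programs in which the final state is explicit.
-/

namespace MR

/-! ### Executing programs within time and memory bounds -/

theorem bits_le {b : ℕ} {l : List ℕ} (h : ∀ v ∈ l, v < 2 ^ b) : bits l ≤ l.length * (b + 1) := by
  unfold bits
  calc (l.map fun a => Nat.size a + 1).sum
      ≤ (l.map fun a => Nat.size a + 1).length • (b + 1) := by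
        apply List.sum_le_card_nsmul
        intro x hx
        obtain ⟨a, ha, rfl⟩ := List.mem_map.1 hx
        exact Nat.succ_le_succ (Nat.size_le.2 (h a ha))
    _ = l.length * (b + 1) := by simp

/-- All registers respect the capacities `cap`, and all numbers stored have at most `b` bits. -/
def Config.Ok {m : ℕ} (b : ℕ) (cap : Fin m → ℕ) (s : Config m) : Prop :=
  ∀ r, (s.regs r).length ≤ cap r ∧ ∀ v ∈ s.regs r, v < 2 ^ b

theorem Config.Ok.mem_le {m b : ℕ} {cap : Fin m → ℕ} {s : Config m} (h : s.Ok b cap) :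
    s.mem ≤ (∑ r, cap r) * (b + 1) := by
  unfold Config.mem
  rw [Finset.sum_mul]
  exact Finset.sum_le_sum fun r _ =>
    (bits_le (h r).2).trans (Nat.mul_le_mul_right _ (h r).1)

/-- Started in `s`, the program halts in `s'` within `T` steps, and all states on the way respect
the limits `b` and `cap`, provided that `s` does. Since programs are deterministic once the coins
are fixed, the final state is given explicitly instead of by a postcondition. -/
def Tr {m : ℕ} (coins : ℕ → Bool) (b : ℕ) (cap : Fin m → ℕ) (c : Cmd m) (s : Config m) (T : ℕ)
    (s' : Config m) : Prop :=
  s.Ok b cap → ∃ t q, Exec coins c s t q s' ∧ t ≤ T ∧ q ≤ (∑ r, cap r) * (b + 1) ∧ s'.Ok b cap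

section Tr

variable {m : ℕ} {coins : ℕ → Bool} {b : ℕ} {cap : Fin m → ℕ}

theorem Tr.instr {i : Instr m} {s : Config m} (h : s.Ok b cap → (i.step coins s).Ok b cap) :
    Tr coins b cap (.instr i) s 1 (i.step coins s) := fun hs =>
  ⟨1, _, .instr i s, le_rfl, max_le hs.mem_le (h hs).mem_le, h hs⟩

theorem Tr.seq {a c : Cmd m} {s s' s'' : Config m} {t t' : ℕ} (h : Tr coins b cap a s t s')
    (h' : Tr coins b cap c s' t' s'') : Tr coins b cap (.seq a c) s (t + t') s'' := fun hs => by
  obtain ⟨t1, q1, e1, ht1, hq1, o1⟩ := h hs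
  obtain ⟨t2, q2, e2, ht2, hq2, o2⟩ := h' o1
  exact ⟨_, _, .seq e1 e2, Nat.add_le_add ht1 ht2, max_le hq1 hq2, o2⟩

theorem Tr.ite_true {e : Expr m} {a c : Cmd m} {s s' : Config m} {t : ℕ} (he : e.eval s.regs ≠ 0)
    (h : Tr coins b cap a s t s') : Tr coins b cap (.ite e a c) s (t + 1) s' := fun hs => by
  obtain ⟨t1, q1, e1, ht1, hq1, o1⟩ := h hs
  exact ⟨_, _, .ite_true he e1, Nat.succ_le_succ ht1, hq1, o1⟩

theorem Tr.ite_false {e : Expr m} {a c : Cmd m} {s s' : Config m} {t : ℕ} (he : e.eval s.regs = 0)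
    (h : Tr coins b cap c s t s') : Tr coins b cap (.ite e a c) s (t + 1) s' := fun hs => by
  obtain ⟨t1, q1, e1, ht1, hq1, o1⟩ := h hs
  exact ⟨_, _, .ite_false he e1, Nat.succ_le_succ ht1, hq1, o1⟩

theorem Tr.mono {a : Cmd m} {s s' : Config m} {t t' : ℕ} (h : Tr coins b cap a s t s')
    (ht : t ≤ t') : Tr coins b cap a s t' s' := fun hs => by
  obtain ⟨t1, q1, e1, ht1, hq1, o1⟩ := h hs
  exact ⟨_, _, e1, ht1.trans ht, hq1, o1⟩

/-- A loop whose successive states are `I 0, I 1, …, I N`. -/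
theorem Tr.loop {e : Expr m} {a : Cmd m} (I : ℕ → Config m) (N t : ℕ)
    (hg : ∀ j < N, e.eval (I j).regs ≠ 0) (hN : e.eval (I N).regs = 0)
    (hb : ∀ j < N, Tr coins b cap a (I j) t (I (j + 1))) :
    Tr coins b cap (.loop e a) (I 0) (N * (t + 1) + 1) (I N) := by
  induction N generalizing I with
  | zero => exact fun hs => ⟨_, _, .loop_false hN, by simp, hs.mem_le, hs⟩
  | succ N ih =>
    intro hs
    obtain ⟨t1, q1, e1, ht1, hq1, o1⟩ := hb 0 (Nat.succ_pos _) hs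
    obtain ⟨t2, q2, e2, ht2, hq2, o2⟩ := ih (fun j => I (j + 1))
      (fun j hj => hg _ (Nat.succ_lt_succ hj)) hN (fun j hj => hb _ (Nat.succ_lt_succ hj)) o1
    refine ⟨_, _, .loop_true (hg 0 (Nat.succ_pos _)) e1 e2, ?_, max_le hq1 hq2, o2⟩
    rw [Nat.succ_mul]
    omega

end Tr

theorem Expr.eval_lt_ne_zero {m : ℕ} {s : Fin m → List ℕ} {a b : Expr m} :
    (Expr.lt a b).eval s ≠ 0 ↔ a.eval s < b.eval s := by simp [Expr.eval]

theorem Expr.eval_lt_eq_zero {m : ℕ} {s : Fin m → List ℕ} {a b : Expr m} :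
    (Expr.lt a b).eval s = 0 ↔ b.eval s ≤ a.eval s := by simp [Expr.eval]

/-- A machine state with two working registers: `S` holds the scalar variables of the program,
`A` is an array; `p`, `κ` and `v` are the parameters, the key and the values. -/
abbrev st (p κ v S A : List ℕ) (t : ℕ) (o : List KV) : Config 5 := ⟨![p, κ, v, S, A], t, o⟩

theorem st_update_three (p κ v S A S' : List ℕ) :
    Function.update (![p, κ, v, S, A] : Fin 5 → List ℕ) 3 S' = ![p, κ, v, S', A] := by
  funext r; fin_cases r <;> rfl

theorem st_update_four (p κ v S A A' : List ℕ) :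
    Function.update (![p, κ, v, S, A] : Fin 5 → List ℕ) 4 A' = ![p, κ, v, S, A'] := by
  funext r; fin_cases r <;> rfl

theorem st_ok_iff {p κ v S A : List ℕ} {t : ℕ} {o : List KV} {b : ℕ} {cap : Fin 5 → ℕ} :
    (st p κ v S A t o).Ok b cap ↔
      (p.length ≤ cap 0 ∧ ∀ a ∈ p, a < 2 ^ b) ∧ (κ.length ≤ cap 1 ∧ ∀ a ∈ κ, a < 2 ^ b) ∧
      (v.length ≤ cap 2 ∧ ∀ a ∈ v, a < 2 ^ b) ∧ (S.length ≤ cap 3 ∧ ∀ a ∈ S, a < 2 ^ b) ∧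
      (A.length ≤ cap 4 ∧ ∀ a ∈ A, a < 2 ^ b) := by
  unfold Config.Ok
  simp [Fin.forall_fin_succ]

section St

variable {coins : ℕ → Bool} {b : ℕ} {cap : Fin 5 → ℕ} {p κ v S A : List ℕ} {t : ℕ} {o : List KV}

theorem Tr.set_scalar {i e : Expr 5} {S' : List ℕ}
    (hS : S.set (i.eval ![p, κ, v, S, A]) (e.eval ![p, κ, v, S, A]) = S')
    (he : e.eval ![p, κ, v, S, A] < 2 ^ b) :
    Tr coins b cap (.instr (.set 3 i e)) (st p κ v S A t o) 1 (st p κ v S' A t o) := by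
  have hst : (Instr.set 3 i e).step coins (st p κ v S A t o) = st p κ v S' A t o := by
    rw [← hS]
    exact congrArg (fun R => (⟨R, t, o⟩ : Config 5)) (st_update_three p κ v S A _)
  rw [← hst]
  refine Tr.instr fun h => ?_
  rw [hst]
  rw [st_ok_iff] at h ⊢
  obtain ⟨h0, h1, h2, h3, h4⟩ := h
  refine ⟨h0, h1, h2, ⟨by rw [← hS, List.length_set]; exact h3.1, fun a ha => ?_⟩, h4⟩
  rw [← hS] at ha
  rcases List.mem_or_eq_of_mem_set ha with ha | rfl
  exacts [h3.2 a ha, he]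

theorem Tr.push_scalar {e : Expr 5} {S' : List ℕ}
    (hS : S ++ [e.eval ![p, κ, v, S, A]] = S')
    (he : e.eval ![p, κ, v, S, A] < 2 ^ b) (hl : S'.length ≤ cap 3) :
    Tr coins b cap (.instr (.push 3 e)) (st p κ v S A t o) 1 (st p κ v S' A t o) := by
  have hst : (Instr.push 3 e).step coins (st p κ v S A t o) = st p κ v S' A t o := by
    rw [← hS]
    exact congrArg (fun R => (⟨R, t, o⟩ : Config 5)) (st_update_three p κ v S A _)
  rw [← hst]
  refine Tr.instr fun h => ?_
  rw [hst]
  rw [st_ok_iff] at h ⊢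
  obtain ⟨h0, h1, h2, h3, h4⟩ := h
  refine ⟨h0, h1, h2, ⟨hl, fun a ha => ?_⟩, h4⟩
  rw [← hS, List.mem_append, List.mem_singleton] at ha
  rcases ha with ha | rfl
  exacts [h3.2 a ha, he]

theorem Tr.push_array {e : Expr 5} {A' : List ℕ}
    (hA : A ++ [e.eval ![p, κ, v, S, A]] = A')
    (he : e.eval ![p, κ, v, S, A] < 2 ^ b) (hl : A'.length ≤ cap 4) :
    Tr coins b cap (.instr (.push 4 e)) (st p κ v S A t o) 1 (st p κ v S A' t o) := by
  have hst : (Instr.push 4 e).step coins (st p κ v S A t o) = st p κ v S A' t o := by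
    rw [← hA]
    exact congrArg (fun R => (⟨R, t, o⟩ : Config 5)) (st_update_four p κ v S A _)
  rw [← hst]
  refine Tr.instr fun h => ?_
  rw [hst]
  rw [st_ok_iff] at h ⊢
  obtain ⟨h0, h1, h2, h3, h4⟩ := h
  refine ⟨h0, h1, h2, h3, ⟨hl, fun a ha => ?_⟩⟩
  rw [← hA, List.mem_append, List.mem_singleton] at ha
  rcases ha with ha | rfl
  exacts [h4.2 a ha, he]

theorem Tr.clear_array :
    Tr coins b cap (.instr (.clear 4)) (st p κ v S A t o) 1 (st p κ v S [] t o) := by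
  have hst : (Instr.clear 4).step coins (st p κ v S A t o) = st p κ v S [] t o :=
    congrArg (fun R => (⟨R, t, o⟩ : Config 5)) (st_update_four p κ v S A _)
  rw [← hst]
  refine Tr.instr fun h => ?_
  rw [hst]
  rw [st_ok_iff] at h ⊢
  exact ⟨h.1, h.2.1, h.2.2.1, h.2.2.2.1, by simp⟩

theorem Tr.flip_array (hl : 1 ≤ cap 4) (hb : 0 < b) :
    Tr coins b cap (.instr (.flip 4)) (st p κ v S [] t o) 1
      (st p κ v S [(coins t).toNat] (t + 1) o) := by
  have hst : (Instr.flip 4).step coins (st p κ v S [] t o)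
      = st p κ v S [(coins t).toNat] (t + 1) o :=
    congrArg (fun R => (⟨R, t + 1, o⟩ : Config 5)) (st_update_four p κ v S [] _)
  rw [← hst]
  refine Tr.instr fun h => ?_
  rw [hst]
  rw [st_ok_iff] at h ⊢
  refine ⟨h.1, h.2.1, h.2.2.1, h.2.2.2.1, by simpa using hl, fun a ha => ?_⟩
  rw [List.mem_singleton] at ha
  have h1 : (coins t).toNat ≤ 1 := Bool.toNat_le _
  have h2 : 1 < 2 ^ b := Nat.one_lt_two_pow hb.ne'
  omega

theorem Tr.emit {key val : List (Expr 5)} {o' : List KV}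
    (ho : o ++ [(key.map (Expr.eval ![p, κ, v, S, A]), val.map (Expr.eval ![p, κ, v, S, A]))]
      = o') :
    Tr coins b cap (.instr (.emit key val)) (st p κ v S A t o) 1 (st p κ v S A t o') := by
  have hst : (Instr.emit key val).step coins (st p κ v S A t o) = st p κ v S A t o' := by
    simp only [Instr.step, ← ho]
  rw [← hst]
  refine Tr.instr fun h => ?_
  rw [hst]
  rw [st_ok_iff] at h ⊢
  exact h

theorem Tr.nop {s : Config 5} : Tr coins b cap (.instr .nop) s 1 s :=
  Tr.instr (i := .nop) fun h => h

end St

/-- A triple from the initial state gives a run of the program. -/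
theorem Program.Runs.of_tr {code : Cmd 5} {coins : ℕ → Bool} {b : ℕ} {cap : Fin 5 → ℕ}
    {p κ : List ℕ} {vals : List (List ℕ)} {T T' : ℕ} {Q : ℝ} {s' : Config 5} {out : List KV}
    (h : Tr coins b cap code
      (st p κ (vals.map fun v => v.length :: v).flatten [] [] 0 []) T' s')
    (hok : (st p κ (vals.map fun v => v.length :: v).flatten [] [] 0 []).Ok b cap)
    (hT : T' ≤ T) (hQ : (((∑ r, cap r) * (b + 1) : ℕ) : ℝ) ≤ Q) (ho : s'.out = out) :
    (Program.mk 2 code).Runs T Q coins p κ vals out := by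
  obtain ⟨t, q, he, ht, hq, -⟩ := h hok
  refine ⟨t, q, s', ?_, ht.trans hT, le_trans (by exact_mod_cast hq) hQ, ho⟩
  have : initConfig 2 p κ vals
      = st p κ (vals.map fun v => v.length :: v).flatten [] [] 0 [] := by
    unfold initConfig
    congr 1
    funext r; fin_cases r <;> rfl
  rw [this]
  exact he

/-! ### Delivering tokens and messages -/

/-- The scalar variable number `i`. -/
abbrev scal (i : ℕ) : Expr 5 := .get 3 (.lit i)

/-- The entry number `i` of the key. -/
abbrev keyAt (i : ℕ) : Expr 5 := .get 1 (.lit i)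

/-- The entry number `i` of the list of values. -/
abbrev valAt (i : ℕ) : Expr 5 := .get 2 (.lit i)

/-- Sequential composition of a list of commands. -/
abbrev seqs : List (Cmd 5) → Cmd 5 → Cmd 5
  | [], c => c
  | a :: l, c => .seq a (seqs l c)

/-- Increments the scalar variable number `i`. -/
abbrev incr (i : ℕ) : Cmd 5 := .instr (.set 3 (.lit i) (.add (scal i) (.lit 1)))

/-- The mapper of all rounds but the first. A token `[] ↦ [c, r, r']` of a new center `c` goes to
all machines `[z, c]`. A message `[z, c] ↦ [a]`, saying that `z` gets the code `a`, goes to all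
machines `[z, y]` and `[y, z]`. A state pair stays at its machine, and if both its points have the
code `i`, their distance is sent to the machine with the empty key. -/
def mapCode (i : ℕ) : Cmd 5 :=
  .ite (.eq (.len 1) (.lit 0))
    (.seq (.instr (.push 3 (.lit 0)))
      (.loop (.lt (scal 0) (.get 0 (.lit 0)))
        (.seq (.instr (.emit [scal 0, valAt 1]
          [.lit 0, .lit 0, .lit 0, .lit 0, .lit 1, valAt 2, valAt 3])) (incr 0))))
    (.ite (.eq (valAt 0) (.lit 1))
      (.seq (.instr (.push 3 (.lit 0)))
        (.loop (.lt (scal 0) (.get 0 (.lit 0)))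
          (seqs [.instr (.emit [keyAt 0, scal 0]
              [.lit 0, .lit 0, valAt 1, .lit 0, .lit 0, .lit 0, .add (keyAt 1) (.lit 1)]),
            .instr (.emit [scal 0, keyAt 0]
              [.lit 0, .lit 0, .lit 0, valAt 1, .lit 0, .lit 0, .add (keyAt 1) (.lit 1)])]
            (incr 0))))
      (.seq
        (.instr (.emit [keyAt 0, keyAt 1]
          [valAt 1, valAt 2, valAt 3, valAt 4, valAt 5, valAt 6, valAt 7]))
        (.ite (.mul (.eq (valAt 3) (.lit i)) (.eq (valAt 4) (.lit i)))
          (.instr (.emit [] [keyAt 0, keyAt 1, valAt 1, valAt 2])) (.instr .nop))))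

/-- The pairs which the mapper produces from the token of a center `c`. -/
def mapToken (n c r r' : ℕ) : List KV :=
  (List.range n).map fun z => ([z, c], [0, 0, 0, 0, 1, r, r'])

/-- The pairs which the mapper produces from a message for `z`. -/
def mapMessage (n z c a : ℕ) : List KV :=
  (List.range n).flatMap fun y =>
    [([z, y], [0, 0, a, 0, 0, 0, c + 1]), ([y, z], [0, 0, 0, a, 0, 0, c + 1])]

/-- The pairs which the mapper produces from the state of a pair of points. -/
def mapState (i x y a a' f f' : ℕ) : List KV :=
  ([x, y], [a, a', f, f', 0, 0, 0]) :: if f = i ∧ f' = i then [([], [x, y, a, a'])] else []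

section

variable {coins : ℕ → Bool} {b : ℕ} {cap : Fin 5 → ℕ}

theorem tr_mapToken {i n k c r r' : ℕ} (hn : n < 2 ^ b) (hcap : 1 ≤ cap 3) :
    Tr coins b cap (mapCode i) (st [n, k] [] [3, c, r, r'] [] [] 0 []) (n * 3 + 3)
      (st [n, k] [] [3, c, r, r'] [n] [] 0 (mapToken n c r r')) := by
  refine Tr.mono (Tr.ite_true (by simp [Expr.eval]) (Tr.seq
    (Tr.push_scalar (S' := [0]) rfl (show 0 < 2 ^ b by positivity) hcap)
    (Tr.loop (fun j => st [n, k] [] [3, c, r, r'] [j] [] 0 (mapToken j c r r')) n 2 ?_ ?_ ?_)))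
    (by omega)
  · intro j hj; simp [Expr.eval, hj]
  · simp [Expr.eval]
  · intro j hj
    exact Tr.seq (Tr.emit (by rw [mapToken, mapToken, List.range_succ, List.map_append]; rfl))
      (Tr.set_scalar rfl (show j + 1 < 2 ^ b by omega))

theorem tr_mapMessage {i n k z c a : ℕ} (hn : n < 2 ^ b) (hcap : 1 ≤ cap 3) :
    Tr coins b cap (mapCode i) (st [n, k] [z, c] [1, a] [] [] 0 []) (n * 4 + 4)
      (st [n, k] [z, c] [1, a] [n] [] 0 (mapMessage n z c a)) := by
  refine Tr.mono (Tr.ite_false (by simp [Expr.eval]) (Tr.ite_true (by simp [Expr.eval]) (Tr.seq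
    (Tr.push_scalar (S' := [0]) rfl (show 0 < 2 ^ b by positivity) hcap)
    (Tr.loop (fun j => st [n, k] [z, c] [1, a] [j] [] 0 (mapMessage j z c a)) n 3 ?_ ?_ ?_))))
    (by omega)
  · intro j hj; simp [Expr.eval, hj]
  · simp [Expr.eval]
  · intro j hj
    refine Tr.mono (Tr.seq (Tr.emit rfl) (Tr.seq (Tr.emit ?_)
      (Tr.set_scalar rfl (show j + 1 < 2 ^ b by omega)))) le_rfl
    rw [mapMessage, mapMessage, List.range_succ, List.flatMap_append, List.append_assoc]; rfl

theorem tr_mapState {i n k x y a a' f f' : ℕ} :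
    Tr coins b cap (mapCode i) (st [n, k] [x, y] [7, a, a', f, f', 0, 0, 0] [] [] 0 []) 5
      (st [n, k] [x, y] [7, a, a', f, f', 0, 0, 0] [] [] 0 (mapState i x y a a' f f')) := by
  refine Tr.mono (Tr.ite_false (by simp [Expr.eval]) (Tr.ite_false (by simp [Expr.eval])
    (Tr.seq (Tr.emit rfl) (t' := 2) ?_))) (by omega)
  by_cases h : f = i ∧ f' = i
  · refine Tr.ite_true (by simp [Expr.eval, h]) (Tr.emit ?_)
    rw [mapState, if_pos h]; rfl
  · have : mapState i x y a a' f f' = [([x, y], [a, a', f, f', 0, 0, 0])] := by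
      rw [mapState, if_neg h]
    rw [this]
    refine Tr.ite_false ?_ Tr.nop
    simp only [not_and] at h
    simp [Expr.eval]
    tauto

end

/-- Replaces the scalar variable number `i + 1` by its maximum with the entry number `i` of the
value number `j`, where `j` is the scalar variable number `0` and all values have length `7`. -/
abbrev maxWith (i : ℕ) : Cmd 5 :=
  .instr (.set 3 (.lit (i + 1)) (.add (scal (i + 1))
    (.sub (.get 2 (.add (.mul (.lit 8) (scal 0)) (.lit (i + 1)))) (scal (i + 1)))))

/-- The reducer on the machine `[x, y]`: it takes the componentwise maximum of all values received,
which updates the state by the messages received. If it received the token of `y`, it sends the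
message `m + 2` to `x = y`, and the message `m + 1` to `x ≠ y` if `x` is covered by `y`. -/
def combineCode (m : ℕ) : Cmd 5 :=
  seqs (List.replicate 8 (.instr (.push 3 (.lit 0))))
    (seqs [.loop (.lt (.mul (.lit 8) (scal 0)) (.len 2))
        (seqs [maxWith 0, maxWith 1, maxWith 2, maxWith 3, maxWith 4, maxWith 5, maxWith 6]
          (incr 0)),
      .instr (.emit [] [scal 1, scal 2, scal 3, scal 4, .lit 0, .lit 0, .lit 0])]
      (.ite (scal 5)
        (.ite (.eq (keyAt 0) (keyAt 1)) (.instr (.emit [] [.lit (m + 2)]))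
          (.ite (.lt (.mul (scal 6) (scal 2)) (.mul (scal 1) (scal 7))) (.instr .nop)
            (.instr (.emit [] [.lit (m + 1)]))))
        (.instr .nop)))

/-- The maximum of the entries number `i` of the first `j` values. -/
def runMax (v : List ℕ) (i : ℕ) : ℕ → ℕ
  | 0 => 0
  | j + 1 => runMax v i j + (v.getD (8 * j + (i + 1)) 0 - runMax v i j)

/-- The values which the reducer emits on the machine `[x, y]` if `a` is the componentwise maximum
of the values received. -/
def combineOut (m x y : ℕ) (a : ℕ → ℕ) : List (List ℕ) :=
  [a 0, a 1, a 2, a 3, 0, 0, 0] ::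
    if a 4 = 0 then [] else if x = y then [[m + 2]] else
      if a 5 * a 1 < a 0 * a 6 then [] else [[m + 1]]

theorem getD_lt {v : List ℕ} {B : ℕ} (h : ∀ a ∈ v, a < B) (hB : 0 < B) (i : ℕ) :
    v.getD i 0 < B := by
  rw [List.getD_eq_getElem?_getD]
  rcases lt_or_ge i v.length with hi | hi
  · rw [List.getElem?_eq_getElem hi]; exact h _ (List.getElem_mem hi)
  · rw [List.getElem?_eq_none hi]; exact hB

theorem runMax_lt {v : List ℕ} {B : ℕ} (h : ∀ a ∈ v, a < B) (hB : 0 < B) (i j : ℕ) :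
    runMax v i j < B := by
  induction j with
  | zero => exact hB
  | succ j ih =>
    have := getD_lt h hB (8 * j + (i + 1))
    rw [runMax]; omega

section

variable {coins : ℕ → Bool} {b : ℕ} {cap : Fin 5 → ℕ}

theorem tr_combine {m x y N : ℕ} {p v : List ℕ} (hv : ∀ a ∈ v, a < 2 ^ b)
    (hN : v.length = 8 * N) (hNb : N < 2 ^ b) (hcap : 8 ≤ cap 3) :
    Tr coins b cap (combineCode m) (st p [x, y] v [] [] 0 []) (N * 9 + 14)
      (st p [x, y] v [N, runMax v 0 N, runMax v 1 N, runMax v 2 N, runMax v 3 N, runMax v 4 N,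
        runMax v 5 N, runMax v 6 N] [] 0
        ((combineOut m x y fun i => runMax v i N).map fun a => ([], a))) := by
  have h0 : 0 < 2 ^ b := by positivity
  have hm := runMax_lt hv h0
  refine Tr.mono (Tr.seq (Tr.push_scalar rfl h0 (le_trans (by simp) hcap))
    (Tr.seq (Tr.push_scalar rfl h0 (le_trans (by simp) hcap))
    (Tr.seq (Tr.push_scalar rfl h0 (le_trans (by simp) hcap))
    (Tr.seq (Tr.push_scalar rfl h0 (le_trans (by simp) hcap))
    (Tr.seq (Tr.push_scalar rfl h0 (le_trans (by simp) hcap))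
    (Tr.seq (Tr.push_scalar rfl h0 (le_trans (by simp) hcap))
    (Tr.seq (Tr.push_scalar rfl h0 (le_trans (by simp) hcap))
    (Tr.seq (Tr.push_scalar rfl h0 (le_trans (by simp) hcap))
    (Tr.seq (Tr.loop (fun j => st p [x, y] v [j, runMax v 0 j, runMax v 1 j, runMax v 2 j,
      runMax v 3 j, runMax v 4 j, runMax v 5 j, runMax v 6 j] [] 0 []) N 8 ?_ ?_ ?_)
    (Tr.seq (Tr.emit rfl) (t' := 4) ?_)))))))))) (by omega)
  · intro j hj
    exact Expr.eval_lt_ne_zero.2 (show 8 * j < v.length by omega)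
  · exact Expr.eval_lt_eq_zero.2 (show v.length ≤ 8 * N by omega)
  · intro j hj
    refine Tr.mono
      (Tr.seq (Tr.set_scalar (S' := [j, runMax v 0 (j + 1), runMax v 1 j, runMax v 2 j,
        runMax v 3 j, runMax v 4 j, runMax v 5 j, runMax v 6 j]) rfl (hm 0 (j + 1)))
      (Tr.seq (Tr.set_scalar (S' := [j, runMax v 0 (j + 1), runMax v 1 (j + 1), runMax v 2 j,
        runMax v 3 j, runMax v 4 j, runMax v 5 j, runMax v 6 j]) rfl (hm 1 (j + 1)))
      (Tr.seq (Tr.set_scalar (S' := [j, runMax v 0 (j + 1), runMax v 1 (j + 1), runMax v 2 (j + 1),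
        runMax v 3 j, runMax v 4 j, runMax v 5 j, runMax v 6 j]) rfl (hm 2 (j + 1)))
      (Tr.seq (Tr.set_scalar (S' := [j, runMax v 0 (j + 1), runMax v 1 (j + 1), runMax v 2 (j + 1),
        runMax v 3 (j + 1), runMax v 4 j, runMax v 5 j, runMax v 6 j]) rfl (hm 3 (j + 1)))
      (Tr.seq (Tr.set_scalar (S' := [j, runMax v 0 (j + 1), runMax v 1 (j + 1), runMax v 2 (j + 1),
        runMax v 3 (j + 1), runMax v 4 (j + 1), runMax v 5 j, runMax v 6 j]) rfl (hm 4 (j + 1)))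
      (Tr.seq (Tr.set_scalar (S' := [j, runMax v 0 (j + 1), runMax v 1 (j + 1), runMax v 2 (j + 1),
        runMax v 3 (j + 1), runMax v 4 (j + 1), runMax v 5 (j + 1), runMax v 6 j]) rfl
        (hm 5 (j + 1)))
      (Tr.seq (Tr.set_scalar (S' := [j, runMax v 0 (j + 1), runMax v 1 (j + 1), runMax v 2 (j + 1),
        runMax v 3 (j + 1), runMax v 4 (j + 1), runMax v 5 (j + 1), runMax v 6 (j + 1)]) rfl
        (hm 6 (j + 1)))
      (Tr.set_scalar rfl (show j + 1 < 2 ^ b by omega))))))))) (by omega)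
  · by_cases h4 : runMax v 4 N = 0
    · have : combineOut m x y (fun i => runMax v i N) =
          [[runMax v 0 N, runMax v 1 N, runMax v 2 N, runMax v 3 N, 0, 0, 0]] := by
        rw [combineOut, if_pos h4]
      rw [this]
      exact Tr.mono (Tr.ite_false h4 Tr.nop) (by omega)
    · by_cases hxy : x = y
      · refine Tr.mono (Tr.ite_true h4 (Tr.ite_true ?_ (Tr.emit ?_))) (by omega)
        · simp [Expr.eval, hxy]
        · rw [combineOut, if_neg h4, if_pos hxy]; rfl
      · by_cases hr : runMax v 5 N * runMax v 1 N < runMax v 0 N * runMax v 6 N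
        · have : combineOut m x y (fun i => runMax v i N) =
              [[runMax v 0 N, runMax v 1 N, runMax v 2 N, runMax v 3 N, 0, 0, 0]] := by
            rw [combineOut, if_neg h4, if_neg hxy, if_pos hr]
          rw [this]
          exact Tr.mono (Tr.ite_true h4 (Tr.ite_false (by simp [Expr.eval, hxy])
            (Tr.ite_true (by simp [Expr.eval, hr]) Tr.nop))) (by omega)
        · refine Tr.mono (Tr.ite_true h4 (Tr.ite_false (by simp [Expr.eval, hxy])
            (Tr.ite_false ?_ (Tr.emit ?_)))) (by omega)
          · simpa [Expr.eval] using hr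
          · rw [combineOut, if_neg h4, if_neg hxy, if_neg hr]; rfl

end

/-! ### Selecting centers -/

/-- The number of distances received by the machine with the empty key. -/
abbrev entries : Expr 5 := .div (.len 2) (.lit 5)

/-- The field number `i` of the entry number `e`; the fields are the length of the entry, which
is `4`, the two points, and the numerator and the denominator of their distance. -/
abbrev field (i : ℕ) (e : Expr 5) : Expr 5 := .get 2 (.add (.mul (.lit 5) e) (.lit i))

/-- The test whether the first point of the entry `e`, where `e` is the scalar variable `4`, is
covered by a center. The scalar variable `5` encodes a pair of an entry `e'` and an entry `h`. The
test succeeds if `e'` became a center and `h` contains the distance of the first points of `e` and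
`e'`, and if this distance is at most the radius. -/
def hitTest : Expr 5 :=
  .mul (.mul (.mul (.get 4 (.div (scal 5) entries))
    (.eq (field 1 (.mod (scal 5) entries)) (field 1 (scal 4))))
    (.eq (field 2 (.mod (scal 5) entries)) (field 1 (.div (scal 5) entries))))
    (.sub (.lit 1) (.lt (.mul (field 3 (scal 0)) (field 4 (.mod (scal 5) entries)))
      (.mul (field 3 (.mod (scal 5) entries)) (field 4 (scal 0)))))

/-- One step of the greedy construction: the first point of the entry `e`, where `e` is the scalar
variable `4`, becomes a center unless it is covered by an earlier one. -/
abbrev greedyStep (emission : Cmd 5) : Cmd 5 :=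
  seqs [.loop (.lt (scal 5) (.mul entries entries))
        (.seq (.instr (.set 3 (.lit 6) (.lt (.lit 0) (.add (scal 6) hitTest)))) (incr 5)),
      .instr (.push 4 (.sub (.lit 1) (scal 6))),
      .instr (.set 3 (.lit 3) (.add (scal 3) (.sub (.lit 1) (scal 6)))),
      .ite (scal 6) (.instr .nop) emission,
      .instr (.set 3 (.lit 6) (.lit 0)),
      .instr (.set 3 (.lit 5) (.lit 0))]
    (incr 4)

/-- Greedy construction of a net among the first points of all entries. The radius is that of the
entry number `g`, where `g` is the scalar variable `0`. The command `emission` is run at each new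
center. The array records which entries became centers, and the scalar variable `3` counts them. -/
def greedyCode (emission : Cmd 5) : Cmd 5 :=
  .loop (.lt (scal 4) entries) (greedyStep emission)

/-- Whether the pair number `t` of entries shows that the entry `e` is covered. -/
def hitAt (v F : List ℕ) (g e t : ℕ) : ℕ :=
  F.getD (t / (v.length / 5)) 0 *
    (if v.getD (5 * (t % (v.length / 5)) + 1) 0 = v.getD (5 * e + 1) 0 then 1 else 0) *
    (if v.getD (5 * (t % (v.length / 5)) + 2) 0 = v.getD (5 * (t / (v.length / 5)) + 1) 0
      then 1 else 0) *
    (1 - if v.getD (5 * g + 3) 0 * v.getD (5 * (t % (v.length / 5)) + 4) 0 <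
      v.getD (5 * (t % (v.length / 5)) + 3) 0 * v.getD (5 * g + 4) 0 then 1 else 0)

/-- Whether one of the first `t` pairs of entries shows that the entry `e` is covered. -/
def hitUpTo (v F : List ℕ) (g e : ℕ) : ℕ → ℕ
  | 0 => 0
  | t + 1 => if 0 < hitUpTo v F g e t + hitAt v F g e t then 1 else 0

/-- The array after `e` steps of the greedy construction, with `1` for each center. -/
def marks (v : List ℕ) (g : ℕ) : ℕ → List ℕ
  | 0 => []
  | e + 1 => marks v g e ++
      [1 - hitUpTo v (marks v g e) g e (v.length / 5 * (v.length / 5))]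

/-- The entry which the step number `e` of the greedy construction appends to the array. -/
def newMark (v : List ℕ) (g e : ℕ) : ℕ :=
  1 - hitUpTo v (marks v g e) g e (v.length / 5 * (v.length / 5))

/-- The number of centers after `e` steps of the greedy construction. -/
def countMarks (v : List ℕ) (g : ℕ) : ℕ → ℕ
  | 0 => 0
  | e + 1 => countMarks v g e + newMark v g e

/-- The pairs emitted in the first `e` steps of the greedy construction, if the step `i` emits
`f i` when it finds a center. -/
def emitMarks (v : List ℕ) (g : ℕ) (f : ℕ → List KV) : ℕ → List KV
  | 0 => []
  | e + 1 => emitMarks v g f e ++ if newMark v g e = 0 then [] else f e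

theorem hitUpTo_le (v F : List ℕ) (g e t : ℕ) : hitUpTo v F g e t ≤ 1 := by
  cases t with
  | zero => exact Nat.zero_le _
  | succ t => rw [hitUpTo]; split_ifs <;> omega

theorem newMark_le (v : List ℕ) (g e : ℕ) : newMark v g e ≤ 1 := Nat.sub_le _ _

theorem countMarks_le (v : List ℕ) (g e : ℕ) : countMarks v g e ≤ e := by
  induction e with
  | zero => exact le_rfl
  | succ e ih => have := newMark_le v g e; rw [countMarks]; omega

theorem length_marks (v : List ℕ) (g e : ℕ) : (marks v g e).length = e := by
  induction e with
  | zero => rfl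
  | succ e ih => rw [marks, List.length_append, ih]; rfl

section

variable {coins : ℕ → Bool} {b : ℕ} {cap : Fin 5 → ℕ}

theorem tr_greedy {emission : Cmd 5} {f : ℕ → List KV} {p v : List ℕ} {g β φ : ℕ} {o : List KV}
    {E : ℕ} (hE : E = v.length / 5) (hb : E * E < 2 ^ b) (hcap : E ≤ cap 4)
    (hem : ∀ cnt e t A o, Tr coins b cap emission (st p [] v [g, β, φ, cnt, e, t, 0] A 0 o) 1
      (st p [] v [g, β, φ, cnt, e, t, 0] A 0 (o ++ f e))) :
    Tr coins b cap (greedyCode emission) (st p [] v [g, β, φ, 0, 0, 0, 0] [] 0 o)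
      (E * (E * E * 3 + 9) + 1)
      (st p [] v [g, β, φ, countMarks v g E, E, 0, 0] (marks v g E) 0
        (o ++ emitMarks v g f E)) := by
  have h0 : 0 < 2 ^ b := by positivity
  have hEE : E ≤ E * E := Nat.le_mul_self E
  have key := Tr.loop (coins := coins) (b := b) (cap := cap) (e := .lt (scal 4) entries)
    (a := greedyStep emission)
    (fun e => st p [] v [g, β, φ, countMarks v g e, e, 0, 0] (marks v g e) 0
      (o ++ emitMarks v g f e)) E (E * E * 3 + 8) ?_ ?_ ?_
  · rw [show emitMarks v g f 0 = [] from rfl, List.append_nil] at key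
    exact key
  · intro e he
    exact Expr.eval_lt_ne_zero.2 (show e < v.length / 5 by omega)
  · exact Expr.eval_lt_eq_zero.2 (show v.length / 5 ≤ E by omega)
  · intro e he
    subst hE
    set E := v.length / 5 with hE
    have hc : countMarks v g (e + 1) ≤ e + 1 := countMarks_le v g (e + 1)
    have hh := hitUpTo_le v (marks v g e) g e
    have hm : 1 - hitUpTo v (marks v g e) g e (E * E) ≤ 1 := Nat.sub_le _ _
    refine Tr.mono (Tr.seq
      (Tr.loop (fun t => st p [] v [g, β, φ, countMarks v g e, e, t,
        hitUpTo v (marks v g e) g e t] (marks v g e) 0 (o ++ emitMarks v g f e)) (E * E) 2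
        ?_ ?_ ?_)
      (Tr.seq (Tr.push_array (A' := marks v g (e + 1)) rfl
          (show 1 - hitUpTo v (marks v g e) g e (E * E) < 2 ^ b by omega)
          (by rw [length_marks]; omega))
      (Tr.seq (Tr.set_scalar (S' := [g, β, φ, countMarks v g (e + 1), e, E * E,
          hitUpTo v (marks v g e) g e (E * E)]) rfl
          (show countMarks v g (e + 1) < 2 ^ b by omega))
      (Tr.seq (t := 2) (s' := st p [] v [g, β, φ, countMarks v g (e + 1), e, E * E,
          hitUpTo v (marks v g e) g e (E * E)] (marks v g (e + 1)) 0
          (o ++ emitMarks v g f (e + 1))) ?_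
      (Tr.seq (Tr.set_scalar (S' := [g, β, φ, countMarks v g (e + 1), e, E * E, 0]) rfl h0)
      (Tr.seq (Tr.set_scalar (S' := [g, β, φ, countMarks v g (e + 1), e, 0, 0]) rfl h0)
      (Tr.set_scalar rfl (show e + 1 < 2 ^ b by omega)))))))) (by omega)
    · intro t ht
      exact Expr.eval_lt_ne_zero.2 (show t < E * E from ht)
    · exact Expr.eval_lt_eq_zero.2 (show E * E ≤ E * E from le_rfl)
    · intro t ht
      have := hh (t + 1)
      refine Tr.seq (Tr.set_scalar (S' := [g, β, φ, countMarks v g e, e, t,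
        hitUpTo v (marks v g e) g e (t + 1)]) rfl
          (show hitUpTo v (marks v g e) g e (t + 1) < 2 ^ b by omega))
        (Tr.set_scalar rfl (show t + 1 < 2 ^ b by omega))
    · rcases Nat.eq_zero_or_pos (hitUpTo v (marks v g e) g e (E * E)) with h | h
      · have h1 : newMark v g e ≠ 0 := by
          show 1 - hitUpTo v (marks v g e) g e (E * E) ≠ 0
          omega
        rw [h, emitMarks, if_neg h1, ← List.append_assoc]
        exact Tr.ite_false rfl (hem _ _ _ _ _)
      · have h1 : newMark v g e = 0 := by
          show 1 - hitUpTo v (marks v g e) g e (E * E) = 0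
          omega
        rw [emitMarks, if_pos h1, List.append_nil]
        exact Tr.ite_true h.ne' Tr.nop

end

/-- The reducer on the machine with the empty key. The scalar variable `0` runs over all entries,
whose distances are the candidate radii. The scalar variable `1` is the entry with the smallest
radius found so far for which the greedy construction gives at most `k` centers; the scalar
variable `2` tells whether there is one. The centers for this radius are emitted. -/
def selectCode (emission : Cmd 5) : Cmd 5 :=
  seqs (List.replicate 7 (.instr (.push 3 (.lit 0))))
    (seqs [.loop (.lt (scal 0) entries)
        (seqs [greedyCode (.instr .nop),
          .ite (.mul (.sub (.lit 1) (.lt (.get 0 (.lit 1)) (scal 3)))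
              (.add (.sub (.lit 1) (scal 2)) (.lt (.mul (field 3 (scal 0)) (field 4 (scal 1)))
                (.mul (field 3 (scal 1)) (field 4 (scal 0))))))
            (.seq (.instr (.set 3 (.lit 1) (scal 0))) (.instr (.set 3 (.lit 2) (.lit 1))))
            (.instr .nop),
          .instr (.set 3 (.lit 3) (.lit 0)),
          .instr (.set 3 (.lit 4) (.lit 0)),
          .instr (.clear 4)]
          (incr 0)),
      .instr (.set 3 (.lit 0) (scal 1))]
      (greedyCode emission))

/-- Whether the candidate `g` replaces the best candidate `β`; `φ` tells whether there is one. -/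
def replaceTest (v : List ℕ) (k β φ g : ℕ) : ℕ :=
  (1 - if k < countMarks v g (v.length / 5) then 1 else 0) *
    ((1 - φ) + if v.getD (5 * g + 3) 0 * v.getD (5 * β + 4) 0 <
      v.getD (5 * β + 3) 0 * v.getD (5 * g + 4) 0 then 1 else 0)

/-- The best of the first `g` candidates, and whether there is one. -/
def bestCand (v : List ℕ) (k : ℕ) : ℕ → ℕ × ℕ
  | 0 => (0, 0)
  | g + 1 => if replaceTest v k (bestCand v k g).1 (bestCand v k g).2 g = 0 then bestCand v k g
      else (g, 1)

theorem bestCand_le (v : List ℕ) (k g : ℕ) : (bestCand v k g).1 ≤ g := by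
  induction g with
  | zero => exact le_rfl
  | succ g ih => rw [bestCand]; split_ifs; exacts [by omega, Nat.le_succ g]

section

variable {coins : ℕ → Bool} {b : ℕ} {cap : Fin 5 → ℕ}

theorem tr_select {emission : Cmd 5} {f : ℕ → ℕ → List KV} {v : List ℕ} {n k : ℕ}
    {E : ℕ} (hE : E = v.length / 5) (hb : E * E + 1 < 2 ^ b) (hcap : E ≤ cap 4)
    (hcap' : 7 ≤ cap 3)
    (hem : ∀ g β φ cnt e t A o,
      Tr coins b cap emission (st [n, k] [] v [g, β, φ, cnt, e, t, 0] A 0 o) 1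
        (st [n, k] [] v [g, β, φ, cnt, e, t, 0] A 0 (o ++ f g e))) :
    ∃ s', Tr coins b cap (selectCode emission) (st [n, k] [] v [] [] 0 [])
      ((E + 1) * (E * (E * E * 3 + 9) + 9) + 9) s' ∧
      s'.out = emitMarks v (bestCand v k E).1 (f (bestCand v k E).1) E := by
  have h0 : 0 < 2 ^ b := by positivity
  have hEE : E ≤ E * E := Nat.le_mul_self E
  have hbest := bestCand_le v k
  have hnop : ∀ g β φ cnt e t A o,
      Tr coins b cap (.instr .nop) (st [n, k] [] v [g, β, φ, cnt, e, t, 0] A 0 o) 1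
        (st [n, k] [] v [g, β, φ, cnt, e, t, 0] A 0 (o ++ (fun _ : ℕ => []) e)) := by
    intro g β φ cnt e t A o
    rw [List.append_nil]; exact Tr.nop
  refine ⟨_, Tr.mono (Tr.seq (Tr.push_scalar rfl h0 (le_trans (by simp) hcap'))
    (Tr.seq (Tr.push_scalar rfl h0 (le_trans (by simp) hcap'))
    (Tr.seq (Tr.push_scalar rfl h0 (le_trans (by simp) hcap'))
    (Tr.seq (Tr.push_scalar rfl h0 (le_trans (by simp) hcap'))
    (Tr.seq (Tr.push_scalar rfl h0 (le_trans (by simp) hcap'))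
    (Tr.seq (Tr.push_scalar rfl h0 (le_trans (by simp) hcap'))
    (Tr.seq (Tr.push_scalar rfl h0 (le_trans (by simp) hcap'))
    (Tr.seq (Tr.loop (fun g => st [n, k] [] v [g, (bestCand v k g).1, (bestCand v k g).2,
      0, 0, 0, 0] [] 0 []) E (E * (E * E * 3 + 9) + 8) ?_ ?_ ?_)
    (Tr.seq (Tr.set_scalar (S' := [(bestCand v k E).1, (bestCand v k E).1, (bestCand v k E).2,
      0, 0, 0, 0]) rfl (lt_of_le_of_lt (hbest E) (by omega)))
    (tr_greedy hE (by omega) hcap (hem _ _ _))))))))))) (by linarith), by simp⟩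
  · intro g hg
    exact Expr.eval_lt_ne_zero.2 (show g < v.length / 5 by omega)
  · exact Expr.eval_lt_eq_zero.2 (show v.length / 5 ≤ E by omega)
  · intro g hg
    have hout : ∀ e, emitMarks v g (fun _ => []) e = [] := by
      intro e
      induction e with
      | zero => rfl
      | succ e ih => rw [emitMarks, ih]; simp
    have hgr := tr_greedy (o := []) (β := (bestCand v k g).1) (φ := (bestCand v k g).2)
      hE (by omega) hcap (hnop g (bestCand v k g).1 (bestCand v k g).2)
    rw [hout, List.append_nil] at hgr
    refine Tr.mono (Tr.seq hgr
      (Tr.seq (t := 3) (s' := st [n, k] [] v [g, (bestCand v k (g + 1)).1,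
        (bestCand v k (g + 1)).2, countMarks v g E, E, 0, 0] (marks v g E) 0 []) ?_
      (Tr.seq (Tr.set_scalar (S' := [g, (bestCand v k (g + 1)).1,
        (bestCand v k (g + 1)).2, 0, E, 0, 0]) rfl h0)
      (Tr.seq (Tr.set_scalar (S' := [g, (bestCand v k (g + 1)).1,
        (bestCand v k (g + 1)).2, 0, 0, 0, 0]) rfl h0)
      (Tr.seq Tr.clear_array
      (Tr.set_scalar rfl (show g + 1 < 2 ^ b by omega))))))) (by omega)
    by_cases h : replaceTest v k (bestCand v k g).1 (bestCand v k g).2 g = 0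
    · rw [bestCand, if_pos h]
      subst hE
      exact Tr.mono (Tr.ite_false h Tr.nop) (by omega)
    · rw [bestCand, if_neg h]
      subst hE
      exact Tr.ite_true h (Tr.seq (Tr.set_scalar (S' := [g, g, (bestCand v k g).2,
        countMarks v g _, _, 0, 0]) rfl (show g < 2 ^ b by omega))
        (Tr.set_scalar rfl (show 1 < 2 ^ b by omega)))

end

/-! ### Drawing levels -/

/-- The expression `e ^ j`. -/
def powExpr (e : Expr 5) : ℕ → Expr 5
  | 0 => .lit 1
  | j + 1 => .mul (powExpr e j) e

theorem eval_powExpr (s : Fin 5 → List ℕ) (e : Expr 5) (j : ℕ) :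
    (powExpr e j).eval s = e.eval s ^ j := by
  induction j with
  | zero => rfl
  | succ j ih => rw [powExpr, Expr.eval, ih, pow_succ]

/-- The expression `f 0 + ⋯ + f (j - 1)`. -/
def sumExpr (f : ℕ → Expr 5) : ℕ → Expr 5
  | 0 => .lit 0
  | j + 1 => .add (sumExpr f j) (f j)

theorem eval_sumExpr (s : Fin 5 → List ℕ) (f : ℕ → Expr 5) (j : ℕ) :
    (sumExpr f j).eval s = ∑ i ∈ Finset.range j, (f i).eval s := by
  induction j with
  | zero => rfl
  | succ j ih => rw [sumExpr, Expr.eval, ih, Finset.sum_range_succ]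

/-- The least positive integer `b` with `n ≤ b ^ m`. -/
noncomputable def ceilRoot (m n : ℕ) : ℕ := sInf {j | n ≤ (j + 1) ^ m} + 1

/-- The level of a point whose coins have shown `G`: it is at most `i` if and only if `G` exceeds
`n / (2 C k b ^ (i + 2))`, where `b` is the rounded `m`-th root of `n`. -/
noncomputable def level (m C n k G : ℕ) : ℕ :=
  ∑ i ∈ Finset.range m, if n < 2 * C * (k * G) * ceilRoot m n ^ (i + 2) then 0 else 1

/-- Whether the first `j` coins all show `true`. -/
def allTrue (coins : ℕ → Bool) : ℕ → ℕ
  | 0 => 1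
  | j + 1 => allTrue coins j * (coins j).toNat

/-- Two to the number of coins showing `true` before the first `false`, or before the coin number
`j` if there is none. -/
def geom (coins : ℕ → Bool) : ℕ → ℕ
  | 0 => 1
  | j + 1 => geom coins j * (1 + allTrue coins (j + 1))

/-- The first reducer, on the machine `[x, y]`. If `x = y`, it draws the level of `x` and sends it
as a message. The scalar variables are `b`, a power of two which counts the coins, `allTrue` and
`geom`. -/
def initCode (m C : ℕ) : Cmd 5 :=
  .seq
    (.ite (.eq (keyAt 0) (keyAt 1))
      (seqs (List.replicate 4 (.instr (.push 3 (.lit 1))))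
        (seqs [.loop (.lt (powExpr (scal 0) m) (.get 0 (.lit 0))) (incr 0),
          .loop (.lt (scal 1) (.get 0 (.lit 0)))
            (seqs [.instr (.flip 4),
              .instr (.set 3 (.lit 2) (.mul (scal 2) (.get 4 (.lit 0)))),
              .instr (.clear 4),
              .instr (.set 3 (.lit 3) (.mul (scal 3) (.add (.lit 1) (scal 2))))]
              (.instr (.set 3 (.lit 1) (.mul (scal 1) (.lit 2)))))]
          (.instr (.emit [] [.add (sumExpr (fun i => .eq (.lt (.get 0 (.lit 0))
            (.mul (.mul (.lit (2 * C)) (.mul (.get 0 (.lit 1)) (scal 3)))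
              (powExpr (scal 0) (i + 2)))) (.lit 0)) m) (.lit 1)]))))
      (.instr .nop))
    (.instr (.emit [] [valAt 1, valAt 2, .lit 0, .lit 0, .lit 0, .lit 0, .lit 0]))

/-- The values which the first reducer emits on the machine `[x, y]`. -/
noncomputable def initOut (m C n k : ℕ) (coins : ℕ → Bool) (x y a a' : ℕ) : List (List ℕ) :=
  (if x = y then [[level m C n k (geom coins (Nat.clog 2 n)) + 1]] else []) ++
    [[a, a', 0, 0, 0, 0, 0]]

/-- The first mapper, which leaves all pairs unchanged. -/
def copyCode : Cmd 5 := .instr (.emit [keyAt 0, keyAt 1] [valAt 1, valAt 2])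

theorem le_ceilRoot_pow {m : ℕ} (hm : m ≠ 0) (n : ℕ) : n ≤ ceilRoot m n ^ m :=
  Nat.sInf_mem (s := {j | n ≤ (j + 1) ^ m})
    ⟨n, (Nat.le_succ n).trans (Nat.le_self_pow hm (n + 1))⟩

theorem lt_of_lt_ceilRoot {m n j : ℕ} (h : j + 1 < ceilRoot m n) : (j + 1) ^ m < n := by
  have : j < sInf {j | n ≤ (j + 1) ^ m} := by unfold ceilRoot at h; omega
  simpa using Nat.notMem_of_lt_sInf this

theorem ceilRoot_pos (m n : ℕ) : 0 < ceilRoot m n := Nat.succ_pos _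

theorem ceilRoot_le {m n : ℕ} (hm : m ≠ 0) (hn : 1 ≤ n) : ceilRoot m n ≤ n := by
  have : sInf {j | n ≤ (j + 1) ^ m} ≤ n - 1 := Nat.sInf_le (by
    show n ≤ (n - 1 + 1) ^ m
    rw [Nat.sub_add_cancel hn]; exact Nat.le_self_pow hm n)
  unfold ceilRoot; omega

theorem two_pow_clog_le {n : ℕ} (hn : 1 ≤ n) : 2 ^ Nat.clog 2 n ≤ 2 * n := by
  rcases Nat.lt_or_ge 1 n with h | h
  · have h1 := Nat.pow_pred_clog_lt_self one_lt_two h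
    have h2 : 0 < Nat.clog 2 n := Nat.clog_pos one_lt_two h
    have : 2 ^ Nat.clog 2 n = 2 * 2 ^ (Nat.clog 2 n).pred := by
      rw [← pow_succ', ← Nat.succ_eq_add_one, Nat.succ_pred_eq_of_pos h2]
    omega
  · have : n = 1 := le_antisymm h hn
    subst this; simp

theorem allTrue_le (coins : ℕ → Bool) (j : ℕ) : allTrue coins j ≤ 1 := by
  induction j with
  | zero => exact le_rfl
  | succ j ih =>
    rw [allTrue]
    exact (Nat.mul_le_mul ih (Bool.toNat_le _)).trans le_rfl

theorem geom_le (coins : ℕ → Bool) (j : ℕ) : geom coins j ≤ 2 ^ j := by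
  induction j with
  | zero => exact le_rfl
  | succ j ih =>
    rw [geom, pow_succ]
    exact Nat.mul_le_mul ih (by have := allTrue_le coins (j + 1); omega)

theorem geom_cases (coins : ℕ → Bool) (j : ℕ) :
    (allTrue coins j = 1 ∧ geom coins j = 2 ^ j ∧ ∀ i < j, coins i = true) ∨
    (allTrue coins j = 0 ∧ ∃ g < j, geom coins j = 2 ^ g ∧ coins g = false ∧
      ∀ i < g, coins i = true) := by
  induction j with
  | zero => left; simp [allTrue, geom]
  | succ j ih =>
    rcases ih with ⟨h1, h2, h3⟩ | ⟨h1, g, hg, h2, h3, h4⟩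
    · cases hc : coins j with
      | false =>
        right
        refine ⟨by simp [allTrue, hc], j, Nat.lt_succ_self j, ?_, hc, h3⟩
        simp [geom, allTrue, hc, h2]
      | true =>
        left
        refine ⟨by simp [allTrue, hc, h1], by simp [geom, allTrue, hc, h1, h2, pow_succ], ?_⟩
        intro i hi
        rcases Nat.lt_succ_iff_lt_or_eq.1 hi with hi | rfl
        exacts [h3 i hi, hc]
    · right
      exact ⟨by simp [allTrue, h1], g, Nat.lt_succ_of_lt hg, by simp [geom, allTrue, h1, h2],
        h3, h4⟩

theorem two_pow_le_geom_iff {coins : ℕ → Bool} {l j : ℕ} (hl : l ≤ j) :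
    2 ^ l ≤ geom coins j ↔ ∀ i < l, coins i = true := by
  rcases geom_cases coins j with ⟨-, h2, h3⟩ | ⟨-, g, hg, h2, h3, h4⟩
  · rw [h2]
    exact ⟨fun _ i hi => h3 i (hi.trans_le hl), fun _ => Nat.pow_le_pow_right two_pos hl⟩
  · rw [h2, Nat.pow_le_pow_iff_right one_lt_two]
    refine ⟨fun h i hi => h4 i (hi.trans_le h), fun h => ?_⟩
    by_contra hgl
    rw [h g (not_le.1 hgl)] at h3
    exact Bool.noConfusion h3

theorem geom_eq_two_pow (coins : ℕ → Bool) (j : ℕ) : ∃ g, geom coins j = 2 ^ g := by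
  rcases geom_cases coins j with ⟨-, h2, -⟩ | ⟨-, g, -, h2, -⟩
  exacts [⟨j, h2⟩, ⟨g, h2⟩]

theorem level_le (m C n k G : ℕ) : level m C n k G ≤ m := by
  unfold level
  calc _ ≤ ∑ i ∈ Finset.range m, 1 := Finset.sum_le_sum fun i _ => by split_ifs <;> simp
    _ = m := by simp

theorem level_le_iff {m C n k G i : ℕ} (hi : i < m) :
    level m C n k G ≤ i ↔ n < 2 * C * (k * G) * ceilRoot m n ^ (i + 2) := by
  have hmono : ∀ i j, i ≤ j → 2 * C * (k * G) * ceilRoot m n ^ (i + 2) ≤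
      2 * C * (k * G) * ceilRoot m n ^ (j + 2) := fun i j hij =>
    Nat.mul_le_mul_left _ (Nat.pow_le_pow_right (ceilRoot_pos m n) (by omega))
  constructor
  · intro h
    by_contra hn
    have : i + 1 ≤ level m C n k G := by
      calc i + 1 = ∑ j ∈ Finset.range (i + 1), 1 := by simp
        _ ≤ ∑ j ∈ Finset.range (i + 1),
            if n < 2 * C * (k * G) * ceilRoot m n ^ (j + 2) then 0 else 1 := by
          refine Finset.sum_le_sum fun j hj => ?_
          rw [if_neg]
          rw [Finset.mem_range] at hj
          exact fun h' => hn (h'.trans_le (hmono j i (by omega)))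
        _ ≤ _ := Finset.sum_le_sum_of_subset (Finset.range_mono hi)
    omega
  · intro h
    unfold level
    calc (∑ j ∈ Finset.range m, if n < 2 * C * (k * G) * ceilRoot m n ^ (j + 2) then 0 else 1)
        ≤ ∑ j ∈ Finset.range m, if j < i then 1 else 0 := by
          refine Finset.sum_le_sum fun j _ => ?_
          by_cases hj : j < i
          · rw [if_pos hj]; split_ifs <;> simp
          · rw [if_pos (h.trans_le (hmono i j (by omega)))]; simp
      _ = i := by
          rw [Finset.sum_ite]
          simp only [Finset.sum_const, smul_eq_mul, mul_one, mul_zero, add_zero]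
          rw [show (Finset.range m).filter (fun j => j < i) = Finset.range i by
            ext j; simp; omega, Finset.card_range]

section

variable {coins : ℕ → Bool} {b : ℕ} {cap : Fin 5 → ℕ}

theorem tr_copy {p κ : List ℕ} {x y a a' : ℕ} (hκ : κ = [x, y]) :
    Tr coins b cap copyCode (st p κ [2, a, a'] [] [] 0 []) 1
      (st p κ [2, a, a'] [] [] 0 [(κ, [a, a'])]) := by
  subst hκ
  exact Tr.emit rfl

theorem tr_init {m C n k x y a a' : ℕ} (hm : m ≠ 0) (hn : 1 ≤ n) (hb : 2 * n < 2 ^ b)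
    (hcap : 4 ≤ cap 3) (hcap' : 1 ≤ cap 4) :
    ∃ s', Tr coins b cap (initCode m C) (st [n, k] [x, y] [2, a, a'] [] [] 0 []) (n * 10 + 10) s' ∧
      s'.out = (initOut m C n k coins x y a a').map fun a => ([], a) := by
  have hb0 : 0 < b := by
    rcases Nat.eq_zero_or_pos b with rfl | h
    · simp at hb; omega
    · exact h
  by_cases hxy : x = y
  · have h1 : 1 < 2 ^ b := by omega
    have hr := ceilRoot_le hm hn
    have hL : Nat.clog 2 n ≤ n := Nat.clog_le_of_le_pow Nat.lt_two_pow_self.le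
    have h2L := two_pow_clog_le hn
    have hloop1 := Tr.loop (coins := coins) (b := b) (cap := cap)
      (e := .lt (powExpr (scal 0) m) (.get 0 (.lit 0))) (a := incr 0)
      (fun j => st [n, k] [x, y] [2, a, a'] [j + 1, 1, 1, 1] [] 0 []) (ceilRoot m n - 1) 1
      (fun j hj => Expr.eval_lt_ne_zero.2 (by
        rw [eval_powExpr]
        exact lt_of_lt_ceilRoot (show j + 1 < ceilRoot m n by omega)))
      (Expr.eval_lt_eq_zero.2 (by
        rw [eval_powExpr]
        show n ≤ (ceilRoot m n - 1 + 1) ^ m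
        rw [Nat.sub_add_cancel (ceilRoot_pos m n)]
        exact le_ceilRoot_pow hm n))
      (fun j hj => Tr.set_scalar rfl (show j + 1 + 1 < 2 ^ b by omega))
    rw [Nat.sub_add_cancel (ceilRoot_pos m n)] at hloop1
    have hloop2 := Tr.loop (coins := coins) (b := b) (cap := cap)
      (e := .lt (scal 1) (.get 0 (.lit 0)))
      (a := (seqs [.instr (.flip 4),
              .instr (.set 3 (.lit 2) (.mul (scal 2) (.get 4 (.lit 0)))),
              .instr (.clear 4),
              .instr (.set 3 (.lit 3) (.mul (scal 3) (.add (.lit 1) (scal 2))))]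
              (.instr (.set 3 (.lit 1) (.mul (scal 1) (.lit 2))))))
      (fun j => st [n, k] [x, y] [2, a, a'] [ceilRoot m n, 2 ^ j, allTrue coins j, geom coins j]
        [] j []) (Nat.clog 2 n) 5
      (fun j hj => Expr.eval_lt_ne_zero.2 (show 2 ^ j < n from
        (Nat.lt_clog_iff_pow_lt one_lt_two).1 hj))
      (Expr.eval_lt_eq_zero.2 (show n ≤ 2 ^ _ from Nat.le_pow_clog one_lt_two n))
      (fun j hj => by
        have h2j : 2 ^ j * 2 ≤ 2 ^ Nat.clog 2 n := by
          rw [← pow_succ]; exact Nat.pow_le_pow_right two_pos hj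
        have ha := allTrue_le coins (j + 1)
        have hg := geom_le coins (j + 1)
        rw [pow_succ] at hg
        refine Tr.mono (Tr.seq (Tr.flip_array hcap' hb0)
          (Tr.seq (Tr.set_scalar (S' := [ceilRoot m n, 2 ^ j, allTrue coins (j + 1),
            geom coins j]) rfl (show allTrue coins (j + 1) < 2 ^ b by omega))
          (Tr.seq Tr.clear_array
          (Tr.seq (Tr.set_scalar (S' := [ceilRoot m n, 2 ^ j, allTrue coins (j + 1),
            geom coins (j + 1)]) rfl (show geom coins (j + 1) < 2 ^ b by omega))
          (Tr.set_scalar rfl (show 2 ^ j * 2 < 2 ^ b by omega)))))) le_rfl)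
    refine ⟨_, Tr.mono (Tr.seq (Tr.ite_true (by simp [Expr.eval, hxy])
      (Tr.seq (Tr.push_scalar rfl h1 (le_trans (by simp) hcap))
      (Tr.seq (Tr.push_scalar rfl h1 (le_trans (by simp) hcap))
      (Tr.seq (Tr.push_scalar rfl h1 (le_trans (by simp) hcap))
      (Tr.seq (Tr.push_scalar rfl h1 (le_trans (by simp) hcap))
      (Tr.seq hloop1 (Tr.seq hloop2 (Tr.emit rfl)))))))) (Tr.emit rfl)) (by omega), ?_⟩
    rw [initOut, if_pos hxy]
    have hsum : (sumExpr (fun i => .eq (.lt (.get 0 (.lit 0))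
            (.mul (.mul (.lit (2 * C)) (.mul (.get 0 (.lit 1)) (scal 3)))
              (powExpr (scal 0) (i + 2)))) (.lit 0)) m).eval
        ![[n, k], [x, y], [2, a, a'], [ceilRoot m n, 2 ^ Nat.clog 2 n,
          allTrue coins (Nat.clog 2 n), geom coins (Nat.clog 2 n)], []] =
        level m C n k (geom coins (Nat.clog 2 n)) := by
      rw [eval_sumExpr, level]
      refine Finset.sum_congr rfl fun i _ => ?_
      have hlt := @Expr.eval_lt_ne_zero 5 ![[n, k], [x, y], [2, a, a'], [ceilRoot m n,
        2 ^ Nat.clog 2 n, allTrue coins (Nat.clog 2 n), geom coins (Nat.clog 2 n)], []]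
        (.get 0 (.lit 0)) (.mul (.mul (.lit (2 * C)) (.mul (.get 0 (.lit 1)) (scal 3)))
              (powExpr (scal 0) (i + 2)))
      have hev : Expr.eval ![[n, k], [x, y], [2, a, a'], [ceilRoot m n,
        2 ^ Nat.clog 2 n, allTrue coins (Nat.clog 2 n), geom coins (Nat.clog 2 n)], []]
        (.mul (.mul (.lit (2 * C)) (.mul (.get 0 (.lit 1)) (scal 3)))
              (powExpr (scal 0) (i + 2))) =
        2 * C * (k * geom coins (Nat.clog 2 n)) * ceilRoot m n ^ (i + 2) := by
        rw [Expr.eval, eval_powExpr]; rfl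
      rw [hev] at hlt
      rw [Expr.eval]
      by_cases h : n < 2 * C * (k * geom coins (Nat.clog 2 n)) * ceilRoot m n ^ (i + 2)
      · rw [if_pos h, if_neg]
        exact hlt.2 h
      · rw [if_neg h, if_pos]
        by_contra h'
        exact h (hlt.1 h')
    rw [← hsum]
    rfl
  · refine ⟨_, Tr.mono (Tr.seq (Tr.ite_false (by simp [Expr.eval, hxy]) Tr.nop)
      (Tr.emit rfl)) (by omega), ?_⟩
    rw [initOut, if_neg hxy]
    rfl

end

/-! ### Correctness of the selection of centers -/

theorem getD_flatten {w : ℕ} {L : List (List ℕ)} (h : ∀ l ∈ L, l.length = w) {i j : ℕ}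
    (hi : i < w) :
    L.flatten.getD (w * j + i) 0 = (L.getD j []).getD i 0 := by
  induction L generalizing j with
  | nil => simp
  | cons a L ih =>
    have ha : a.length = w := h a (by simp)
    rw [List.flatten_cons]
    cases j with
    | zero =>
      rw [Nat.mul_zero, Nat.zero_add, List.getD_append _ _ _ _ (by omega)]
      rfl
    | succ j =>
      rw [List.getD_append_right _ _ _ _ (by rw [ha, Nat.mul_succ]; omega), ha,
        show w * (j + 1) + i - w = w * j + i by rw [Nat.mul_succ]; omega,
        ih (fun l hl => h l (by simp [hl]))]
      rfl

theorem length_flatten_of_forall {w : ℕ} {L : List (List ℕ)} (h : ∀ l ∈ L, l.length = w) :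
    L.flatten.length = w * L.length := by
  rw [List.length_flatten, List.map_congr_left (g := fun _ => w) h]
  simp [mul_comm]

theorem hitUpTo_ne_zero {v F : List ℕ} {g e t : ℕ} :
    hitUpTo v F g e t ≠ 0 ↔ ∃ t' < t, hitAt v F g e t' ≠ 0 := by
  induction t with
  | zero => simp [hitUpTo]
  | succ t ih =>
    rw [hitUpTo]
    have : (if 0 < hitUpTo v F g e t + hitAt v F g e t then 1 else 0) ≠ 0 ↔
        hitUpTo v F g e t ≠ 0 ∨ hitAt v F g e t ≠ 0 := by
      split_ifs with h
      · simp; omega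
      · simp; omega
    rw [this, ih]
    constructor
    · rintro (⟨t', h1, h2⟩ | h)
      exacts [⟨t', by omega, h2⟩, ⟨t, by omega, h⟩]
    · rintro ⟨t', h1, h2⟩
      rcases Nat.lt_succ_iff_lt_or_eq.1 h1 with h | rfl
      exacts [Or.inl ⟨t', h, h2⟩, Or.inr h2]

theorem getD_marks (v : List ℕ) (g e e' : ℕ) :
    (marks v g e).getD e' 0 = if e' < e then newMark v g e' else 0 := by
  induction e with
  | zero => simp [marks]
  | succ e ih =>
    rw [marks]
    rcases Nat.lt_trichotomy e' e with h | rfl | h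
    · rw [List.getD_append _ _ _ _ (by rw [length_marks]; exact h), ih, if_pos h,
        if_pos (by omega)]
    · rw [List.getD_append_right _ _ _ _ (by rw [length_marks]), length_marks, if_pos (by omega)]
      simp [newMark]
    · rw [List.getD_append_right _ _ _ _ (by rw [length_marks]; omega), length_marks,
        if_neg (by omega)]
      obtain ⟨i, rfl⟩ := Nat.exists_eq_add_of_lt h
      rw [show e + i + 1 - e = i + 1 by omega]
      rfl

/-- The points `X e` and `Y e` of the entries `e` of the list `v` and their distances form the
complete distance table of `T`. -/
structure IsTable {n : ℕ} (d : Fin n → Fin n → NNRat) (T : Finset (Fin n)) (v : List ℕ)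
    (X Y : ℕ → Fin n) : Prop where
  left : ∀ e < v.length / 5, v.getD (5 * e + 1) 0 = X e
  right : ∀ e < v.length / 5, v.getD (5 * e + 2) 0 = Y e
  num : ∀ e < v.length / 5, v.getD (5 * e + 3) 0 = (d (X e) (Y e)).num
  den : ∀ e < v.length / 5, v.getD (5 * e + 4) 0 = (d (X e) (Y e)).den
  mem : ∀ e < v.length / 5, X e ∈ T ∧ Y e ∈ T
  exists_eq : ∀ x ∈ T, ∀ y ∈ T, ∃ e < v.length / 5, X e = x ∧ Y e = y

theorem IsTable.of_mem {n : ℕ} {d : Fin n → Fin n → NNRat} {T : Finset (Fin n)}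
    {vals : List (List ℕ)} (hT : T.Nonempty) (h : ∀ w, w ∈ vals ↔ ∃ x ∈ T, ∃ y ∈ T,
      w = [x.val, y.val, (d x y).num, (d x y).den]) :
    (vals.map fun v => v.length :: v).flatten.length = 5 * vals.length ∧
    ∃ X Y, IsTable d T (vals.map fun v => v.length :: v).flatten X Y := by
  have hlen : ∀ l ∈ vals.map fun v => v.length :: v, l.length = 5 := by
    intro l hl
    obtain ⟨w, hw, rfl⟩ := List.mem_map.1 hl
    obtain ⟨x, -, y, -, rfl⟩ := (h w).1 hw
    rfl
  have hL : (vals.map fun v => v.length :: v).flatten.length = 5 * vals.length := by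
    rw [length_flatten_of_forall hlen, List.length_map]
  have hE : (vals.map fun v => v.length :: v).flatten.length / 5 = vals.length := by omega
  refine ⟨hL, ?_⟩
  have hex : ∀ e, ∃ x y : Fin n, e < vals.length → x ∈ T ∧ y ∈ T ∧
      vals.getD e [] = [x.val, y.val, (d x y).num, (d x y).den] := by
    intro e
    by_cases he : e < vals.length
    · obtain ⟨x, hx, y, hy, hw⟩ := (h (vals[e])).1 (List.getElem_mem he)
      exact ⟨x, y, fun _ => ⟨hx, hy, by rw [List.getD_eq_getElem _ _ he, hw]⟩⟩
    · obtain ⟨x, -⟩ := hT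
      exact ⟨x, x, fun h => absurd h he⟩
  choose X Y hXY using hex
  have hget : ∀ e < vals.length, ∀ i < 5,
      (vals.map fun v => v.length :: v).flatten.getD (5 * e + i) 0 =
      [4, (X e).val, (Y e).val, (d (X e) (Y e)).num, (d (X e) (Y e)).den].getD i 0 := by
    intro e he i hi
    rw [getD_flatten hlen hi, List.getD_eq_getElem _ [] (by rw [List.length_map]; exact he),
      List.getElem_map, ← List.getD_eq_getElem _ [] he, (hXY e he).2.2]
    rfl
  refine ⟨X, Y, ?_, ?_, ?_, ?_, ?_, ?_⟩ <;> rw [hE]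
  · exact fun e he => hget e he 1 (by norm_num)
  · exact fun e he => hget e he 2 (by norm_num)
  · exact fun e he => hget e he 3 (by norm_num)
  · exact fun e he => hget e he 4 (by norm_num)
  · exact fun e he => ⟨(hXY e he).1, (hXY e he).2.1⟩
  · intro x hx y hy
    obtain ⟨e, he, hw⟩ := List.mem_iff_getElem.1 ((h _).2 ⟨x, hx, y, hy, rfl⟩)
    refine ⟨e, he, ?_⟩
    have := (hXY e he).2.2
    rw [List.getD_eq_getElem _ _ he, hw] at this
    simp only [List.cons.injEq] at this
    exact ⟨Fin.ext this.1.symm, Fin.ext this.2.1.symm⟩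

/-- No more than `k` points have pairwise distances larger than `ρ`. By the pigeonhole principle,
this holds if `ρ` is twice the cost of some solution; it is the only lower bound on the optimal
cost that is used. -/
def NetBound {n : ℕ} (d : Fin n → Fin n → NNRat) (k : ℕ) (ρ : NNRat) : Prop :=
  ∀ A : Finset (Fin n), (∀ x ∈ A, ∀ y ∈ A, x ≠ y → ρ < d x y) → A.card ≤ k

section

variable {n : ℕ} {d : Fin n → Fin n → NNRat} {T : Finset (Fin n)} {v : List ℕ}
  {X Y : ℕ → Fin n}

/-- The greedy rule: an entry becomes a center if and only if it is farther than the radius from all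
earlier centers. -/
theorem newMark_ne_zero (h : IsTable d T v X Y) {g e : ℕ} (hg : g < v.length / 5)
    (he : e < v.length / 5) :
    newMark v g e ≠ 0 ↔ ∀ e' < e, newMark v g e' ≠ 0 → d (X g) (Y g) < d (X e) (X e') := by
  set E := v.length / 5 with hE
  have h1 : newMark v g e ≠ 0 ↔ ¬ hitUpTo v (marks v g e) g e (E * E) ≠ 0 := by
    show 1 - hitUpTo v (marks v g e) g e (E * E) ≠ 0 ↔ _
    have := hitUpTo_le v (marks v g e) g e (E * E)
    omega
  rw [h1, hitUpTo_ne_zero, ← not_iff_not, not_not]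
  push Not
  have hE0 : 0 < E := by omega
  constructor
  · rintro ⟨t, ht, hh⟩
    have hq : t / E < E := Nat.div_lt_of_lt_mul ht
    have hr : t % E < E := Nat.mod_lt _ hE0
    simp only [hitAt, ← hE, mul_ne_zero_iff, getD_marks] at hh
    obtain ⟨⟨⟨hh1, hh2⟩, hh3⟩, hh4⟩ := hh
    by_cases hte : t / E < e
    · rw [if_pos hte] at hh1
      simp only [ne_eq, ite_eq_right_iff, one_ne_zero, imp_false, not_not] at hh2 hh3
      have hh5 : ¬ (v.getD (5 * g + 3) 0 * v.getD (5 * (t % E) + 4) 0 <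
          v.getD (5 * (t % E) + 3) 0 * v.getD (5 * g + 4) 0) := by
        intro hlt; rw [if_pos hlt] at hh4; exact hh4 rfl
      rw [h.left _ hr, h.left _ he] at hh2
      rw [h.right _ hr, h.left _ hq] at hh3
      rw [h.num _ hg, h.num _ hr, h.den _ hg, h.den _ hr, ← NNRat.lt_def,
        Fin.ext hh2, Fin.ext hh3] at hh5
      exact ⟨t / E, hte, hh1, not_lt.1 hh5⟩
    · rw [if_neg hte] at hh1; exact absurd rfl hh1
  · rintro ⟨e', he', hm, hd⟩
    obtain ⟨f, hf, hfx, hfy⟩ := h.exists_eq (X e) (h.mem e he).1 (X e') (h.mem e' (by omega)).1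
    have hdiv : (E * e' + f) / E = e' := by
      rw [Nat.mul_add_div hE0, Nat.div_eq_of_lt hf, Nat.add_zero]
    have hmod : (E * e' + f) % E = f := by
      rw [Nat.mul_add_mod, Nat.mod_eq_of_lt hf]
    refine ⟨E * e' + f, ?_, ?_⟩
    · calc E * e' + f < E * e' + E := by omega
        _ = E * (e' + 1) := by ring
        _ ≤ E * E := Nat.mul_le_mul_left _ (by omega)
    · simp only [hitAt, ← hE, mul_ne_zero_iff, getD_marks, hdiv, hmod]
      rw [if_pos he', h.left _ hf, h.left _ he, h.right _ hf, h.left _ (show e' < E by omega),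
        h.num _ hg, h.num _ hf, h.den _ hg, h.den _ hf, hfx, hfy,
        if_pos rfl, if_pos rfl, if_neg (fun hlt => not_lt.2 hd (NNRat.lt_def.2 hlt))]
      exact ⟨⟨⟨hm, one_ne_zero⟩, one_ne_zero⟩, one_ne_zero⟩

/-- The entries at which the greedy construction for the candidate `g` finds a center. -/
def centerEntries (v : List ℕ) (g E : ℕ) : List ℕ :=
  (List.range E).filter fun e => newMark v g e ≠ 0

theorem length_centerEntries (v : List ℕ) (g E : ℕ) :
    (centerEntries v g E).length = countMarks v g E := by
  induction E with
  | zero => rfl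
  | succ E ih =>
    rw [centerEntries, List.range_succ, List.filter_append, List.length_append, countMarks, ← ih,
      centerEntries]
    congr 1
    have := newMark_le v g E
    rcases Nat.eq_zero_or_pos (newMark v g E) with h | h
    · simp [h]
    · have : newMark v g E = 1 := by omega
      simp [this]

theorem emitMarks_eq (v : List ℕ) (g E : ℕ) (f : ℕ → KV) :
    emitMarks v g (fun e => [f e]) E = (centerEntries v g E).map f := by
  induction E with
  | zero => rfl
  | succ E ih =>
    rw [emitMarks, ih, centerEntries, centerEntries, List.range_succ, List.filter_append,
      List.map_append]
    congr 1
    by_cases h : newMark v g E = 0 <;> simp [h]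

theorem mem_centerEntries {g E e : ℕ} :
    e ∈ centerEntries v g E ↔ e < E ∧ newMark v g e ≠ 0 := by
  simp [centerEntries]

theorem separated_centerEntries (h : IsTable d T v X Y) (hd : IsMetric d) {g e e' : ℕ}
    (hg : g < v.length / 5) (he : e ∈ centerEntries v g (v.length / 5))
    (he' : e' ∈ centerEntries v g (v.length / 5)) (hne : e ≠ e') :
    d (X g) (Y g) < d (X e) (X e') := by
  rw [mem_centerEntries] at he he'
  rcases Nat.lt_or_gt_of_ne hne with hlt | hlt
  · rw [hd.symm (X e)]
    exact (newMark_ne_zero h hg he'.1).1 he'.2 e hlt he.2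
  · exact (newMark_ne_zero h hg he.1).1 he.2 e' hlt he'.2

theorem nodup_centers (h : IsTable d T v X Y) (hd : IsMetric d) {g : ℕ} (hg : g < v.length / 5) :
    ((centerEntries v g (v.length / 5)).map X).Nodup := by
  refine List.Nodup.map_on ?_ ((List.nodup_range).filter _)
  intro e he e' he' hX
  by_contra hne
  have := separated_centerEntries h hd hg he he' hne
  rw [hX, (hd.eq_zero_iff _ _).2 rfl] at this
  exact not_lt_bot this

theorem exists_center (h : IsTable d T v X Y) (hd : IsMetric d) {g : ℕ} (hg : g < v.length / 5)
    {x : Fin n} (hx : x ∈ T) :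
    ∃ c ∈ (centerEntries v g (v.length / 5)).map X, d x c ≤ d (X g) (Y g) := by
  obtain ⟨e, he, rfl, -⟩ := h.exists_eq x hx x hx
  by_cases hm : newMark v g e ≠ 0
  · refine ⟨X e, List.mem_map_of_mem (mem_centerEntries.2 ⟨he, hm⟩), ?_⟩
    rw [(hd.eq_zero_iff _ _).2 rfl]; exact zero_le
  · rw [newMark_ne_zero h hg he] at hm
    push Not at hm
    obtain ⟨e', he', hm', hle⟩ := hm
    exact ⟨X e', List.mem_map_of_mem (mem_centerEntries.2 ⟨by omega, hm'⟩), hle⟩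

/-- The search keeps the smallest radius whose greedy net has at most `k` centers. -/
theorem bestCand_spec (h : IsTable d T v X Y) (k : ℕ) {g : ℕ} (hg : g ≤ v.length / 5) :
    ((bestCand v k g).2 = 0 ∧ ∀ g' < g, k < countMarks v g' (v.length / 5)) ∨
    ((bestCand v k g).2 = 1 ∧ (bestCand v k g).1 < g ∧
      countMarks v (bestCand v k g).1 (v.length / 5) ≤ k ∧
      ∀ g' < g, countMarks v g' (v.length / 5) ≤ k →
        d (X (bestCand v k g).1) (Y (bestCand v k g).1) ≤ d (X g') (Y g')) := by
  induction g with
  | zero => left; simp [bestCand]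
  | succ g ih =>
    have hgE : g < v.length / 5 := hg
    rw [bestCand]
    by_cases hk : k < countMarks v g (v.length / 5)
    · rw [if_pos (by rw [replaceTest, if_pos hk]; simp)]
      rcases ih (by omega) with ⟨h1, h2⟩ | ⟨h1, h2, h3, h4⟩
      · left
        refine ⟨h1, fun g' hg' => ?_⟩
        rcases Nat.lt_succ_iff_lt_or_eq.1 hg' with h' | rfl
        exacts [h2 g' h', hk]
      · right
        refine ⟨h1, by omega, h3, fun g' hg' hle => ?_⟩
        rcases Nat.lt_succ_iff_lt_or_eq.1 hg' with h' | rfl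
        exacts [h4 g' h' hle, absurd hk (not_lt.2 hle)]
    · rcases ih (by omega) with ⟨h1, h2⟩ | ⟨h1, h2, h3, h4⟩
      · rw [if_neg (by rw [replaceTest, if_neg hk, h1]; simp)]
        right
        refine ⟨rfl, Nat.lt_succ_self g, not_lt.1 hk, fun g' hg' hle => ?_⟩
        rcases Nat.lt_succ_iff_lt_or_eq.1 hg' with h' | rfl
        exacts [absurd (h2 g' h') (not_lt.2 hle), le_rfl]
      · have hβ : (bestCand v k g).1 < v.length / 5 := by omega
        have ht : replaceTest v k (bestCand v k g).1 (bestCand v k g).2 g = 0 ↔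
            ¬ d (X g) (Y g) < d (X (bestCand v k g).1) (Y (bestCand v k g).1) := by
          rw [replaceTest, if_neg hk, h1, h.num _ hgE, h.num _ hβ, h.den _ hgE, h.den _ hβ,
            NNRat.lt_def]
          simp
        by_cases hlt : d (X g) (Y g) < d (X (bestCand v k g).1) (Y (bestCand v k g).1)
        · rw [if_neg (fun h0 => ht.1 h0 hlt)]
          right
          refine ⟨rfl, Nat.lt_succ_self g, not_lt.1 hk, fun g' hg' hle => ?_⟩
          rcases Nat.lt_succ_iff_lt_or_eq.1 hg' with h' | rfl
          exacts [hlt.le.trans (h4 g' h' hle), le_rfl]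
        · rw [if_pos (ht.2 hlt)]
          right
          refine ⟨h1, by omega, h3, fun g' hg' hle => ?_⟩
          rcases Nat.lt_succ_iff_lt_or_eq.1 hg' with h' | rfl
          exacts [h4 g' h' hle, not_lt.1 hlt]

/-- There is a radius at most `ρ` whose greedy net has at most `k` centers. This is the reason why
the distances within `T` suffice as candidates. -/
theorem exists_candidate (h : IsTable d T v X Y) (hd : IsMetric d) (hT : T.Nonempty) {k : ℕ}
    {ρ : NNRat} (hρ : NetBound d k ρ) :
    ∃ g < v.length / 5, countMarks v g (v.length / 5) ≤ k ∧ d (X g) (Y g) ≤ ρ := by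
  obtain ⟨x, hx⟩ := hT
  have hne : ((Finset.range (v.length / 5)).filter fun g => d (X g) (Y g) ≤ ρ).Nonempty := by
    obtain ⟨e, he, h1, h2⟩ := h.exists_eq x hx x hx
    refine ⟨e, ?_⟩
    rw [Finset.mem_filter, Finset.mem_range, h1, h2, (hd.eq_zero_iff _ _).2 rfl]
    exact ⟨he, zero_le⟩
  -- The largest distance that is at most `ρ`: a net for this radius is also one for `ρ`.
  obtain ⟨g, hg, hmax⟩ := Finset.exists_max_image _ (fun g => d (X g) (Y g)) hne
  rw [Finset.mem_filter, Finset.mem_range] at hg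
  refine ⟨g, hg.1, ?_, hg.2⟩
  rw [← length_centerEntries, ← List.length_map (f := X),
    ← List.toFinset_card_of_nodup (nodup_centers h hd hg.1)]
  refine hρ _ fun c hc c' hc' hcc => ?_
  rw [List.mem_toFinset, List.mem_map] at hc hc'
  obtain ⟨e, he, rfl⟩ := hc
  obtain ⟨e', he', rfl⟩ := hc'
  have hlt := separated_centerEntries h hd hg.1 he he' (fun h => hcc (by rw [h]))
  rw [mem_centerEntries] at he he'
  obtain ⟨f, hf, h1, h2⟩ := h.exists_eq _ (h.mem e he.1).1 _ (h.mem e' he'.1).1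
  by_contra hle
  have := hmax f (by
    rw [Finset.mem_filter, Finset.mem_range, h1, h2]; exact ⟨hf, not_lt.1 hle⟩)
  rw [h1, h2] at this
  exact absurd hlt (not_lt.2 this)

/-- The reducer on the machine with the empty key selects at most `k` of the points `T` which
cover `T` with a radius that is a distance in `T` and at most twice the optimal cost. -/
theorem exists_selected (h : IsTable d T v X Y) (hd : IsMetric d) (hT : T.Nonempty) {k : ℕ}
    (hk : ∃ ρ, NetBound d k ρ) (f : ℕ → ℕ → ℕ → List ℕ) :
    ∃ (L : List (Fin n)) (a a' : Fin n), L.Nodup ∧ L.length ≤ k ∧ (∀ c ∈ L, c ∈ T) ∧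
      (∀ x ∈ T, ∃ c ∈ L, d x c ≤ d a a') ∧ (∀ ρ, NetBound d k ρ → d a a' ≤ ρ) ∧
      emitMarks v (bestCand v k (v.length / 5)).1
        (fun e => [([], f (v.getD (5 * e + 1) 0)
          (v.getD (5 * (bestCand v k (v.length / 5)).1 + 3) 0)
          (v.getD (5 * (bestCand v k (v.length / 5)).1 + 4) 0))]) (v.length / 5) =
        L.map fun c : Fin n => ([], f c.val (d a a').num (d a a').den) := by
  set β := (bestCand v k (v.length / 5)).1 with hβ
  obtain ⟨ρ₀, hρ₀⟩ := hk
  obtain ⟨g₀, hg₀, hc₀, -⟩ := exists_candidate h hd hT hρ₀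
  rcases bestCand_spec h k le_rfl with ⟨-, h2⟩ | ⟨-, h2, h3, h4⟩
  · exact absurd (h2 g₀ hg₀) (not_lt.2 hc₀)
  · rw [← hβ] at h2 h3 h4
    refine ⟨(centerEntries v β (v.length / 5)).map X, X β, Y β, nodup_centers h hd h2, ?_, ?_,
      fun x hx => exists_center h hd h2 hx, ?_, ?_⟩
    · rw [List.length_map, length_centerEntries]; exact h3
    · intro c hc
      obtain ⟨e, he, rfl⟩ := List.mem_map.1 hc
      exact (h.mem e (mem_centerEntries.1 he).1).1
    · intro ρ hρ
      obtain ⟨g, hg, hc, hle⟩ := exists_candidate h hd hT hρ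
      exact (h4 g hg hc).trans hle
    · rw [emitMarks_eq, List.map_map]
      refine List.map_congr_left fun e he => ?_
      rw [Function.comp, h.left e (mem_centerEntries.1 he).1, h.num _ h2, h.den _ h2]

end

/-! ### Executing a round -/

theorem Round.runs_of {R : Round} {T : ℕ} {Q : ℝ} {shuffle : List KV → List KV}
    {coins : List ℕ → ℕ → Bool} {params : List ℕ} {input : List KV} (F : KV → List KV)
    (g : List ℕ → List (List ℕ))
    (hm : ∀ p ∈ input, R.mapper.Runs T Q (fun _ => false) params p.1 [p.2] (F p))
    (hr : ∀ κ ∈ (shuffle (input.flatMap F)).map Prod.fst, ∃ e : List KV,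
      R.reducer.Runs T Q (coins κ) params κ (valuesAt (shuffle (input.flatMap F)) κ) e ∧
      e.map Prod.snd = g κ ∧ ((((g κ).map fun w => bits κ + bits w).sum : ℕ) : ℝ) ≤ Q) :
    R.Runs T Q shuffle coins params input
      (((shuffle (input.flatMap F)).map Prod.fst).dedup.flatMap fun κ =>
        (g κ).map fun w => (κ, w)) := by
  refine ⟨input.map F, ((shuffle (input.flatMap F)).map Prod.fst).dedup.map fun κ =>
    (g κ).map fun w => (κ, w), ?_, ?_, ?_⟩
  · rw [List.forall₂_map_right_iff, List.forall₂_same]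
    exact hm
  · rw [← List.flatMap_def, List.forall₂_map_right_iff, List.forall₂_same]
    intro κ hκ
    obtain ⟨e, he, heg, hQ⟩ := hr κ (List.mem_dedup.1 hκ)
    refine ⟨e, he, ?_, ?_⟩
    · rw [← heg, List.map_map]; rfl
    · rw [List.map_map]; exact hQ
  · rw [List.flatMap_def]

theorem mem_valuesAt {l : List KV} {κ w : List ℕ} : w ∈ valuesAt l κ ↔ (κ, w) ∈ l := by
  simp [valuesAt]

theorem nodup_valuesAt {l : List KV} (hl : l.Nodup) (κ : List ℕ) : (valuesAt l κ).Nodup := by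
  refine List.Nodup.map_on ?_ (hl.filter _)
  rintro ⟨a, b⟩ hab ⟨a', b'⟩ hab' h
  simp only [List.mem_filter, decide_eq_true_eq] at hab hab'
  exact Prod.ext (hab.2.trans hab'.2.symm) h

theorem nodup_outputs {keys : List (List ℕ)} {g : List ℕ → List (List ℕ)} (hk : keys.Nodup)
    (hg : ∀ κ ∈ keys, (g κ).Nodup) :
    (keys.flatMap fun κ => (g κ).map fun w => ((κ, w) : KV)).Nodup := by
  rw [List.nodup_flatMap]
  refine ⟨fun κ hκ => (hg κ hκ).map fun a b h => (Prod.ext_iff.1 h).2, ?_⟩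
  refine hk.pairwise_of_forall_ne fun κ _ κ' _ hne => ?_
  intro p hp hp'
  obtain ⟨w, -, rfl⟩ := List.mem_map.1 hp
  obtain ⟨w', -, h⟩ := List.mem_map.1 hp'
  exact hne (Prod.ext_iff.1 h).1.symm

theorem mem_outputs {keys : List (List ℕ)} {g : List ℕ → List (List ℕ)} {p : KV} :
    p ∈ (keys.flatMap fun κ => (g κ).map fun w => ((κ, w) : KV)) ↔
      p.1 ∈ keys ∧ p.2 ∈ g p.1 := by
  rw [List.mem_flatMap]
  constructor
  · rintro ⟨κ, hκ, hp⟩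
    obtain ⟨w, hw, rfl⟩ := List.mem_map.1 hp
    exact ⟨hκ, hw⟩
  · rintro ⟨h1, h2⟩
    exact ⟨p.1, h1, List.mem_map.2 ⟨p.2, h2, rfl⟩⟩

/-- The limits on time and memory, and the sizes which they allow: numbers below `2 ^ b`, samples
of `s` points, and `K` messages for each point. A sample has a distance table of at most `n ^ 2`
entries, and for each entry as the radius and each entry as the possible center, the selection
examines all pairs of entries. -/
structure Limits (n b s K T : ℕ) (Q : ℝ) : Prop where
  pos : 1 ≤ n
  size : n ^ 4 + 8 < 2 ^ b
  time : 100 * n ^ 8 ≤ T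
  memory : (((6 * s ^ 2 + 16 * K + 40) * (b + 1) : ℕ) : ℝ) ≤ Q

section

variable {n b s K T : ℕ} {Q : ℝ}

theorem Limits.le_memory (lim : Limits n b s K T Q) {q : ℕ}
    (hq : q ≤ 6 * s ^ 2 + 16 * K + 40) : ((q * (b + 1) : ℕ) : ℝ) ≤ Q :=
  le_trans (by exact_mod_cast Nat.mul_le_mul_right _ hq) lim.memory

theorem Limits.le_time (lim : Limits n b s K T Q) {t : ℕ} (ht : t ≤ 100 * n) : t ≤ T :=
  (ht.trans (Nat.mul_le_mul_left _ (Nat.le_self_pow (by norm_num) n))).trans lim.time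

theorem Limits.two_mul_lt (lim : Limits n b s K T Q) : 2 * n < 2 ^ b := by
  have h1 := lim.size
  have h2 := lim.pos
  have : 2 * n ≤ n ^ 4 + 8 := by
    rcases Nat.lt_or_ge 1 n with h | h
    · have : n * 2 ≤ n * n ^ 3 := Nat.mul_le_mul_left _
        (le_trans h (Nat.le_self_pow (by norm_num) n))
      have h3 : n * n ^ 3 = n ^ 4 := by ring
      omega
    · have : n = 1 := le_antisymm h h2
      subst this; norm_num
  omega

/-- The number of bits of a list of pairs with a common key. -/
theorem sum_bits_le {κ : List ℕ} {L : List (List ℕ)} {j : ℕ} (hκ : ∀ a ∈ κ, a < 2 ^ b)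
    (hL : ∀ w ∈ L, w.length ≤ j ∧ ∀ a ∈ w, a < 2 ^ b) :
    (L.map fun w => bits κ + bits w).sum ≤ L.length * (κ.length + j) * (b + 1) := by
  calc (L.map fun w => bits κ + bits w).sum
      ≤ (L.map fun w => bits κ + bits w).length • ((κ.length + j) * (b + 1)) := by
        apply List.sum_le_card_nsmul
        intro x hx
        obtain ⟨w, hw, rfl⟩ := List.mem_map.1 hx
        have h1 := bits_le hκ
        have h2 := (bits_le (hL w hw).2).trans (Nat.mul_le_mul_right _ (hL w hw).1)
        rw [Nat.add_mul]
        omega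
    _ = _ := by simp [mul_assoc]

end

/-! ### The state of the algorithm -/

/-- The list `l` consists of the states of all pairs of points, where `f x` is the code of the point
`x`; of the tokens of the new centers `I` with the radius `r / r'`; and of the messages `msg z c`
that are not zero, which tell `z` that it gets the code `msg z c` because of the new center `c`. The
order is arbitrary. -/
def IsState {n : ℕ} (d : Fin n → Fin n → NNRat) (f : Fin n → ℕ) (I : Finset (Fin n)) (r r' : ℕ)
    (msg : Fin n → Fin n → ℕ) (l : List KV) : Prop :=
  l.Nodup ∧ ∀ p, p ∈ l ↔
    (∃ x y : Fin n, p = ([x.val, y.val], [(d x y).num, (d x y).den, f x, f y, 0, 0, 0])) ∨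
    (∃ c ∈ I, p = ([], [c.val, r, r'])) ∨
    (∃ z c : Fin n, msg z c ≠ 0 ∧ p = ([z.val, c.val], [msg z c]))

/-- The list `l` consists of all pairs which the mapper with the parameter `i` produces from the
state described by `IsState`. -/
def IsMapped {n : ℕ} (d : Fin n → Fin n → NNRat) (f : Fin n → ℕ) (I : Finset (Fin n)) (r r' : ℕ)
    (msg : Fin n → Fin n → ℕ) (i : ℕ) (l : List KV) : Prop :=
  l.Nodup ∧ ∀ p, p ∈ l ↔
    (∃ x y : Fin n, p = ([x.val, y.val], [(d x y).num, (d x y).den, f x, f y, 0, 0, 0])) ∨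
    (∃ x y : Fin n, f x = i ∧ f y = i ∧
      p = ([], [x.val, y.val, (d x y).num, (d x y).den])) ∨
    (∃ c ∈ I, ∃ z : Fin n, p = ([z.val, c.val], [0, 0, 0, 0, 1, r, r'])) ∨
    (∃ z c y : Fin n, msg z c ≠ 0 ∧
      p = ([z.val, y.val], [0, 0, msg z c, 0, 0, 0, c.val + 1])) ∨
    (∃ z c y : Fin n, msg z c ≠ 0 ∧
      p = ([y.val, z.val], [0, 0, 0, msg z c, 0, 0, c.val + 1]))

/-- The output of the mapper with the parameter `i`. -/
def stepMap (i n : ℕ) : KV → List KV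
  | ([], [c, r, r']) => mapToken n c r r'
  | ([z, c], [a]) => mapMessage n z c a
  | ([x, y], [a, a', f, f', _, _, _]) => mapState i x y a a' f f'
  | _ => []

theorem mem_mapToken {n c r r' : ℕ} {p : KV} :
    p ∈ mapToken n c r r' ↔ ∃ z : Fin n, p = ([z.val, c], [0, 0, 0, 0, 1, r, r']) := by
  rw [mapToken, List.mem_map]
  constructor
  · rintro ⟨z, hz, rfl⟩; exact ⟨⟨z, List.mem_range.1 hz⟩, rfl⟩
  · rintro ⟨z, rfl⟩; exact ⟨z, List.mem_range.2 z.2, rfl⟩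

theorem mem_mapMessage {n z c a : ℕ} {p : KV} :
    p ∈ mapMessage n z c a ↔ ∃ y : Fin n, p = ([z, y.val], [0, 0, a, 0, 0, 0, c + 1]) ∨
      p = ([y.val, z], [0, 0, 0, a, 0, 0, c + 1]) := by
  rw [mapMessage, List.mem_flatMap]
  constructor
  · rintro ⟨y, hy, hp⟩
    exact ⟨⟨y, List.mem_range.1 hy⟩, by simpa using hp⟩
  · rintro ⟨y, hy⟩
    exact ⟨y, List.mem_range.2 y.2, by simpa using hy⟩

theorem mem_mapState {i x y a a' f f' : ℕ} {p : KV} :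
    p ∈ mapState i x y a a' f f' ↔ p = ([x, y], [a, a', f, f', 0, 0, 0]) ∨
      (f = i ∧ f' = i ∧ p = ([], [x, y, a, a'])) := by
  rw [mapState, List.mem_cons]
  split_ifs with h
  · simp [h]
  · simp only [List.not_mem_nil, or_false]
    tauto

theorem nodup_mapToken (n c r r' : ℕ) : (mapToken n c r r').Nodup := by
  refine List.nodup_range.map ?_
  intro z z' h
  simp only [Prod.mk.injEq, List.cons.injEq] at h
  exact h.1.1

theorem nodup_mapMessage {n z c a : ℕ} (ha : a ≠ 0) : (mapMessage n z c a).Nodup := by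
  rw [mapMessage, List.nodup_flatMap]
  constructor
  · intro y _
    simp [ha]
  · refine List.nodup_range.pairwise_of_forall_ne fun y _ y' _ hne => ?_
    intro p hp hp'
    simp only [List.mem_cons, List.not_mem_nil, or_false] at hp hp'
    rcases hp with rfl | rfl <;> rcases hp' with h | h <;> simp [ha] at h <;> omega

theorem nodup_mapState (i x y a a' f f' : ℕ) : (mapState i x y a a' f f').Nodup := by
  rw [mapState]
  split_ifs <;> simp

section

variable {n : ℕ} {d : Fin n → Fin n → NNRat} {f : Fin n → ℕ} {I : Finset (Fin n)} {r r' : ℕ}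
  {msg : Fin n → Fin n → ℕ} {l : List KV}

theorem IsState.isMapped (h : IsState d f I r r' msg l) (i : ℕ) :
    IsMapped d f I r r' msg i (l.flatMap (stepMap i n)) := by
  constructor
  · rw [List.nodup_flatMap]
    constructor
    · intro p hp
      rcases (h.2 p).1 hp with ⟨x, y, rfl⟩ | ⟨c, -, rfl⟩ | ⟨z, c, hm, rfl⟩
      · exact nodup_mapState _ _ _ _ _ _ _
      · exact nodup_mapToken _ _ _ _
      · exact nodup_mapMessage hm
    · refine h.1.pairwise_of_forall_ne fun p hp p' hp' hne => ?_
      intro q hq hq'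
      rcases (h.2 p).1 hp with ⟨x, y, rfl⟩ | ⟨c, -, rfl⟩ | ⟨z, c, hm, rfl⟩ <;>
      rcases (h.2 p').1 hp' with ⟨x', y', rfl⟩ | ⟨c', -, rfl⟩ | ⟨z', c', hm', rfl⟩ <;>
      simp only [stepMap, mem_mapState, mem_mapToken, mem_mapMessage] at hq hq'
      · have : x = x' ∧ y = y' := by
          rcases hq with rfl | ⟨-, -, rfl⟩ <;> rcases hq' with hq' | ⟨-, -, hq'⟩ <;>
            simp [Fin.val_inj] at hq' <;> tauto
        obtain ⟨rfl, rfl⟩ := this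
        exact hne rfl
      · rcases hq with rfl | ⟨-, -, rfl⟩ <;> simp at hq'
      · rcases hq with rfl | ⟨-, -, rfl⟩ <;> simp at hq'
      · rcases hq' with rfl | ⟨-, -, rfl⟩ <;> simp at hq
      · obtain ⟨u, rfl⟩ := hq
        have : c = c' := by simp [Fin.val_inj] at hq'; tauto
        subst this
        exact hne rfl
      · obtain ⟨u, rfl⟩ := hq; simp at hq'
      · rcases hq' with rfl | ⟨-, -, rfl⟩ <;> simp at hq
      · obtain ⟨u, rfl⟩ := hq'; simp at hq
      · have : z = z' ∧ c = c' := by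
          obtain ⟨u, rfl | rfl⟩ := hq <;> obtain ⟨u', hq' | hq'⟩ := hq' <;>
            simp [Fin.val_inj, hm] at hq' <;> tauto
        obtain ⟨rfl, rfl⟩ := this
        exact hne rfl
  · intro p
    rw [List.mem_flatMap]
    constructor
    · rintro ⟨q, hq, hp⟩
      rcases (h.2 q).1 hq with ⟨x, y, rfl⟩ | ⟨c, hc, rfl⟩ | ⟨z, c, hm, rfl⟩ <;>
      simp only [stepMap, mem_mapState, mem_mapToken, mem_mapMessage] at hp
      · rcases hp with hp | ⟨h1, h2, hp⟩
        exacts [Or.inl ⟨x, y, hp⟩, Or.inr (Or.inl ⟨x, y, h1, h2, hp⟩)]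
      · exact Or.inr (Or.inr (Or.inl ⟨c, hc, hp⟩))
      · obtain ⟨y, hp | hp⟩ := hp
        exacts [Or.inr (Or.inr (Or.inr (Or.inl ⟨z, c, y, hm, hp⟩))),
          Or.inr (Or.inr (Or.inr (Or.inr ⟨z, c, y, hm, hp⟩)))]
    · rintro (⟨x, y, hp⟩ | ⟨x, y, h1, h2, hp⟩ | ⟨c, hc, hp⟩ | ⟨z, c, y, hm, hp⟩ |
        ⟨z, c, y, hm, hp⟩)
      · exact ⟨_, (h.2 _).2 (Or.inl ⟨x, y, rfl⟩), mem_mapState.2 (Or.inl hp)⟩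
      · exact ⟨_, (h.2 _).2 (Or.inl ⟨x, y, rfl⟩), mem_mapState.2 (Or.inr ⟨h1, h2, hp⟩)⟩
      · exact ⟨_, (h.2 _).2 (Or.inr (Or.inl ⟨c, hc, rfl⟩)), mem_mapToken.2 hp⟩
      · exact ⟨_, (h.2 _).2 (Or.inr (Or.inr ⟨z, c, hm, rfl⟩)),
          mem_mapMessage.2 ⟨y, Or.inl hp⟩⟩
      · exact ⟨_, (h.2 _).2 (Or.inr (Or.inr ⟨z, c, hm, rfl⟩)),
          mem_mapMessage.2 ⟨y, Or.inr hp⟩⟩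

theorem IsMapped.perm {i : ℕ} {l' : List KV} (h : IsMapped d f I r r' msg i l) (hp : l'.Perm l) :
    IsMapped d f I r r' msg i l' :=
  ⟨hp.nodup_iff.2 h.1, fun p => hp.mem_iff.trans (h.2 p)⟩

theorem IsMapped.mem_values {i : ℕ} (h : IsMapped d f I r r' msg i l) (x y : Fin n)
    (w : List ℕ) : w ∈ valuesAt l [x.val, y.val] ↔
      w = [(d x y).num, (d x y).den, f x, f y, 0, 0, 0] ∨
      (y ∈ I ∧ w = [0, 0, 0, 0, 1, r, r']) ∨
      (∃ c, msg x c ≠ 0 ∧ w = [0, 0, msg x c, 0, 0, 0, c.val + 1]) ∨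
      (∃ c, msg y c ≠ 0 ∧ w = [0, 0, 0, msg y c, 0, 0, c.val + 1]) := by
  rw [mem_valuesAt, h.2]
  constructor
  · rintro (⟨x', y', hp⟩ | ⟨x', y', h1, h2, hp⟩ | ⟨c, hc, z, hp⟩ | ⟨z, c, y', hm, hp⟩ |
      ⟨z, c, y', hm, hp⟩) <;> simp only [Prod.mk.injEq, List.cons.injEq, Fin.val_inj] at hp
    · obtain ⟨⟨rfl, rfl, -⟩, hw⟩ := hp; exact Or.inl hw
    · exact absurd hp.1 (by simp)
    · obtain ⟨⟨rfl, rfl, -⟩, hw⟩ := hp; exact Or.inr (Or.inl ⟨hc, hw⟩)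
    · obtain ⟨⟨rfl, rfl, -⟩, hw⟩ := hp; exact Or.inr (Or.inr (Or.inl ⟨c, hm, hw⟩))
    · obtain ⟨⟨rfl, rfl, -⟩, hw⟩ := hp; exact Or.inr (Or.inr (Or.inr ⟨c, hm, hw⟩))
  · rintro (rfl | ⟨hc, rfl⟩ | ⟨c, hm, rfl⟩ | ⟨c, hm, rfl⟩)
    · exact Or.inl ⟨x, y, rfl⟩
    · exact Or.inr (Or.inr (Or.inl ⟨y, hc, x, rfl⟩))
    · exact Or.inr (Or.inr (Or.inr (Or.inl ⟨x, c, y, hm, rfl⟩)))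
    · exact Or.inr (Or.inr (Or.inr (Or.inr ⟨y, c, x, hm, rfl⟩)))

theorem IsMapped.mem_values_nil {i : ℕ} (h : IsMapped d f I r r' msg i l) (w : List ℕ) :
    w ∈ valuesAt l [] ↔ ∃ x ∈ Finset.univ.filter (fun x => f x = i),
      ∃ y ∈ Finset.univ.filter (fun x => f x = i),
        w = [x.val, y.val, (d x y).num, (d x y).den] := by
  rw [mem_valuesAt, h.2]
  simp only [Finset.mem_filter, Finset.mem_univ, true_and]
  constructor
  · rintro (⟨x', y', hp⟩ | ⟨x', y', h1, h2, hp⟩ | ⟨c, hc, z, hp⟩ | ⟨z, c, y', hm, hp⟩ |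
      ⟨z, c, y', hm, hp⟩)
    · simp at hp
    · exact ⟨x', h1, y', h2, (Prod.ext_iff.1 hp).2⟩
    all_goals simp at hp
  · rintro ⟨x, h1, y, h2, rfl⟩
    exact Or.inr (Or.inl ⟨x, y, h1, h2, rfl⟩)

theorem IsMapped.mem_keys {i : ℕ} (h : IsMapped d f I r r' msg i l) (κ : List ℕ) :
    κ ∈ l.map Prod.fst ↔ (∃ x y : Fin n, κ = [x.val, y.val]) ∨ (κ = [] ∧ ∃ x, f x = i) := by
  rw [List.mem_map]
  constructor
  · rintro ⟨p, hp, rfl⟩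
    rcases (h.2 p).1 hp with ⟨x', y', rfl⟩ | ⟨x', y', h1, h2, rfl⟩ | ⟨c, hc, z, rfl⟩ |
      ⟨z, c, y', hm, rfl⟩ | ⟨z, c, y', hm, rfl⟩
    · exact Or.inl ⟨x', y', rfl⟩
    · exact Or.inr ⟨rfl, x', h1⟩
    · exact Or.inl ⟨z, c, rfl⟩
    · exact Or.inl ⟨z, y', rfl⟩
    · exact Or.inl ⟨y', z, rfl⟩
  · rintro (⟨x, y, rfl⟩ | ⟨rfl, x, hx⟩)
    · exact ⟨_, (h.2 _).2 (Or.inl ⟨x, y, rfl⟩), rfl⟩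
    · exact ⟨_, (h.2 _).2 (Or.inr (Or.inl ⟨x, x, hx, hx, rfl⟩)), rfl⟩

/-- A machine `[x, y]` receives at most `2 K + 2` values. -/
theorem IsMapped.length_values_le {i K : ℕ} (h : IsMapped d f I r r' msg i l)
    (hK : ∀ x, (Finset.univ.filter fun c => msg x c ≠ 0).card ≤ K) (x y : Fin n) :
    (valuesAt l [x.val, y.val]).length ≤ 2 * K + 2 := by
  rw [← List.toFinset_card_of_nodup (nodup_valuesAt h.1 _)]
  have hsub : (valuesAt l [x.val, y.val]).toFinset ⊆
      {[(d x y).num, (d x y).den, f x, f y, 0, 0, 0]} ∪ ({[0, 0, 0, 0, 1, r, r']} ∪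
      ((Finset.univ.filter fun c => msg x c ≠ 0).image
        (fun c => [0, 0, msg x c, 0, 0, 0, c.val + 1]) ∪
      (Finset.univ.filter fun c => msg y c ≠ 0).image
        (fun c => [0, 0, 0, msg y c, 0, 0, c.val + 1]))) := by
    intro w hw
    rw [List.mem_toFinset, h.mem_values] at hw
    simp only [Finset.mem_union, Finset.mem_singleton, Finset.mem_image, Finset.mem_filter,
      Finset.mem_univ, true_and]
    rcases hw with hw | ⟨-, hw⟩ | ⟨c, hc, hw⟩ | ⟨c, hc, hw⟩
    exacts [Or.inl hw, Or.inr (Or.inl hw), Or.inr (Or.inr (Or.inl ⟨c, hc, hw.symm⟩)),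
      Or.inr (Or.inr (Or.inr ⟨c, hc, hw.symm⟩))]
  refine (Finset.card_le_card hsub).trans ?_
  refine (Finset.card_union_le _ _).trans ?_
  have h1 := Finset.card_union_le {[0, 0, 0, 0, 1, r, r']}
      ((Finset.univ.filter fun c => msg x c ≠ 0).image
        (fun c => [0, 0, msg x c, 0, 0, 0, c.val + 1]) ∪
      (Finset.univ.filter fun c => msg y c ≠ 0).image
        (fun c => [0, 0, 0, msg y c, 0, 0, c.val + 1]))
  have h2 := Finset.card_union_le ((Finset.univ.filter fun c => msg x c ≠ 0).image
        (fun c => [0, 0, msg x c, 0, 0, 0, c.val + 1]))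
      ((Finset.univ.filter fun c => msg y c ≠ 0).image
        (fun c => [0, 0, 0, msg y c, 0, 0, c.val + 1]))
  have h3 := (Finset.card_image_le (s := Finset.univ.filter fun c => msg x c ≠ 0)
    (f := fun c => [0, 0, msg x c, 0, 0, 0, c.val + 1])).trans (hK x)
  have h4 := (Finset.card_image_le (s := Finset.univ.filter fun c => msg y c ≠ 0)
    (f := fun c => [0, 0, 0, msg y c, 0, 0, c.val + 1])).trans (hK y)
  simp only [Finset.card_singleton] at h1 ⊢
  omega

theorem IsMapped.length_values_nil_le {i : ℕ} (h : IsMapped d f I r r' msg i l) :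
    (valuesAt l []).length ≤ (Finset.univ.filter fun x => f x = i).card ^ 2 := by
  rw [← List.toFinset_card_of_nodup (nodup_valuesAt h.1 _)]
  have hsub : (valuesAt l []).toFinset ⊆
      ((Finset.univ.filter fun x => f x = i) ×ˢ (Finset.univ.filter fun x => f x = i)).image
        fun q => [q.1.val, q.2.val, (d q.1 q.2).num, (d q.1 q.2).den] := by
    intro w hw
    rw [List.mem_toFinset, h.mem_values_nil] at hw
    obtain ⟨x, hx, y, hy, rfl⟩ := hw
    exact Finset.mem_image.2 ⟨(x, y), Finset.mem_product.2 ⟨hx, hy⟩, rfl⟩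
  refine (Finset.card_le_card hsub).trans (Finset.card_image_le.trans ?_)
  rw [Finset.card_product, sq]

end

/-! ### The rounds of the algorithm -/

/-- The reducer of all rounds but the first and the last. -/
def stepReduce (m : ℕ) : Cmd 5 :=
  .ite (.eq (.len 1) (.lit 0))
    (selectCode (.instr (.emit [] [field 1 (scal 4), field 3 (scal 0), field 4 (scal 0)])))
    (combineCode m)

/-- The reducer of the last round, which outputs only the selected points. -/
def finalReduce : Cmd 5 :=
  .ite (.eq (.len 1) (.lit 0)) (selectCode (.instr (.emit [] [field 1 (scal 4)]))) (.instr .nop)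

/-- The first round, which draws the levels of all points. -/
def initRound (m C : ℕ) : Round := ⟨⟨2, copyCode⟩, ⟨2, initCode m C⟩⟩

/-- A round which covers the points with the code `i`, if there are any, by new centers, and
delivers tokens and messages. -/
def stepRound (m i : ℕ) : Round := ⟨⟨2, mapCode i⟩, ⟨2, stepReduce m⟩⟩

/-- The last round, which outputs centers that cover the points with the code `i`. -/
def finalRound (i : ℕ) : Round := ⟨⟨2, mapCode i⟩, ⟨2, finalReduce⟩⟩

/-- The points in `L` are at most `k` points of `T` which cover `T` with the radius `d a a'`, and
this radius is at most twice the optimal cost. -/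
def IsSelected {n : ℕ} (d : Fin n → Fin n → NNRat) (k : ℕ) (T : Finset (Fin n))
    (L : List (Fin n)) (a a' : Fin n) : Prop :=
  L.Nodup ∧ L.length ≤ k ∧ (∀ c ∈ L, c ∈ T) ∧ (∀ x ∈ T, ∃ c ∈ L, d x c ≤ d a a') ∧
    ∀ ρ, NetBound d k ρ → d a a' ≤ ρ

/-- The code of `x` after the messages have been delivered. -/
def newCode {n : ℕ} (f : Fin n → ℕ) (msg : Fin n → Fin n → ℕ) (x : Fin n) : ℕ :=
  max (f x) (Finset.univ.sup (msg x))

/-- The message to `x` caused by the token of `y`: the code `m + 2` marks the centers, and the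
code `m + 1` the points covered by them. -/
def newMsg {n : ℕ} (d : Fin n → Fin n → NNRat) (m : ℕ) (I : Finset (Fin n)) (r r' : ℕ)
    (x y : Fin n) : ℕ :=
  if y ∈ I then if x = y then m + 2 else if r * (d x y).den < (d x y).num * r' then 0 else m + 1
  else 0

theorem runMax_le_iff {v : List ℕ} {i N B : ℕ} :
    runMax v i N ≤ B ↔ ∀ j < N, v.getD (8 * j + (i + 1)) 0 ≤ B := by
  induction N with
  | zero => simp [runMax]
  | succ N ih =>
    rw [runMax]
    constructor
    · intro h j hj
      rcases Nat.lt_succ_iff_lt_or_eq.1 hj with hj | rfl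
      · exact ih.1 (by omega) j hj
      · omega
    · intro h
      have h1 := ih.2 fun j hj => h j (by omega)
      have h2 := h N (Nat.lt_succ_self N)
      omega

theorem runMax_flatten_le_iff {vals : List (List ℕ)} (h : ∀ w ∈ vals, w.length = 7) {i B : ℕ}
    (hi : i < 7) :
    runMax (vals.map fun v => v.length :: v).flatten i vals.length ≤ B ↔
      ∀ w ∈ vals, w.getD i 0 ≤ B := by
  have hlen : ∀ l ∈ vals.map fun v => v.length :: v, l.length = 8 := by
    intro l hl
    obtain ⟨w, hw, rfl⟩ := List.mem_map.1 hl
    rw [List.length_cons, h w hw]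
  rw [runMax_le_iff, List.forall_mem_iff_forall_getElem]
  refine forall_congr' fun j => forall_congr' fun hj => ?_
  rw [getD_flatten hlen (by omega : i + 1 < 8),
    List.getD_eq_getElem _ [] (by rw [List.length_map]; exact hj), List.getElem_map]
  rfl

section

variable {n k b s K T : ℕ} {Q : ℝ} {d : Fin n → Fin n → NNRat} {f : Fin n → ℕ}
  {I : Finset (Fin n)} {r r' : ℕ} {msg : Fin n → Fin n → ℕ} {l : List KV} {i : ℕ}

/-- All numbers in the state of the algorithm have at most `b` bits. -/
structure SmallState (b : ℕ) (d : Fin n → Fin n → NNRat) (f : Fin n → ℕ) (r r' : ℕ)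
    (msg : Fin n → Fin n → ℕ) : Prop where
  dist : ∀ x y, (d x y).num < 2 ^ b ∧ (d x y).den < 2 ^ b
  code : ∀ x, f x < 2 ^ b
  radius : r < 2 ^ b ∧ r' < 2 ^ b
  msg : ∀ x y, msg x y < 2 ^ b

theorem Limits.val_lt (lim : Limits n b s K T Q) (x : Fin n) : x.val + 1 < 2 ^ b := by
  have h1 := lim.two_mul_lt
  have h2 := x.2
  omega

theorem IsState.mapper_runs (lim : Limits n b s K T Q) (hk : k ≤ n)
    (hs : SmallState b d f r r' msg) (h : IsState d f I r r' msg l) (coins : ℕ → Bool) {p : KV}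
    (hp : p ∈ l) :
    (Program.mk 2 (mapCode i)).Runs T Q coins [n, k] p.1 [p.2] (stepMap i n p) := by
  have hn := lim.two_mul_lt
  have hn1 := lim.pos
  have h0 : 0 < 2 ^ b := by positivity
  have h7 := lim.size
  have hQ : (((∑ r, (![2, 2, 8, 8, 0] : Fin 5 → ℕ) r) * (b + 1) : ℕ) : ℝ) ≤ Q :=
    lim.le_memory (by simp [Fin.sum_univ_succ])
  have hpar : ∀ a ∈ [n, k], a < 2 ^ b := by simp; omega
  have hv := fun x : Fin n => lim.val_lt x
  rcases (h.2 p).1 hp with ⟨x, y, rfl⟩ | ⟨c, -, rfl⟩ | ⟨z, c, -, rfl⟩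
  · refine Program.Runs.of_tr tr_mapState ?_ (lim.le_time (by omega)) hQ rfl
    rw [st_ok_iff]
    have h1 := hv x; have h2 := hv y
    refine ⟨⟨by simp, hpar⟩, ⟨by simp, ?_⟩, ⟨by simp, ?_⟩, by simp, by simp⟩
    · simp; omega
    · simp [hs.dist x y, hs.code]; omega
  · refine Program.Runs.of_tr (tr_mapToken (by omega) (by simp)) ?_ (lim.le_time (by omega)) hQ rfl
    rw [st_ok_iff]
    have h1 := hv c
    refine ⟨⟨by simp, hpar⟩, ⟨by simp, by simp⟩, ⟨by simp, ?_⟩, by simp, by simp⟩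
    simp [hs.radius]; omega
  · refine Program.Runs.of_tr (tr_mapMessage (by omega) (by simp)) ?_ (lim.le_time (by omega))
      hQ rfl
    rw [st_ok_iff]
    have h1 := hv z; have h2 := hv c
    refine ⟨⟨by simp, hpar⟩, ⟨by simp, ?_⟩, ⟨by simp, ?_⟩, by simp, by simp⟩
    · simp; omega
    · simp [hs.msg]
      exact Nat.pos_iff_ne_zero.1 (by by_contra hb; simp at hb; subst hb; omega)

theorem IsMapped.values_small (lim : Limits n b s K T Q)
    (hs : SmallState b d f r r' msg) (h : IsMapped d f I r r' msg i l) (x y : Fin n) {w : List ℕ}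
    (hw : w ∈ valuesAt l [x.val, y.val]) : w.length = 7 ∧ ∀ a ∈ w, a < 2 ^ b := by
  have h7 := lim.size
  have h0 : 0 < 2 ^ b := by positivity
  rcases (h.mem_values x y w).1 hw with rfl | ⟨-, rfl⟩ | ⟨c, -, rfl⟩ | ⟨c, -, rfl⟩
  · simp [hs.dist x y, hs.code]
  · simp [hs.radius]
    exact Nat.pos_iff_ne_zero.1 (by by_contra hb; simp at hb; subst hb; omega)
  · have h1 := lim.val_lt c
    simp [hs.msg, h1]
  · have h1 := lim.val_lt c
    simp [hs.msg, h1]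

/-- The componentwise maximum of the values received by the machine `[x, y]`. -/
theorem IsMapped.combineOut_eq (lim : Limits n b s K T Q)
    (hs : SmallState b d f r r' msg) (h : IsMapped d f I r r' msg i l)
    (hIm : I = ∅ ∨ ∀ x y, msg x y = 0) (m : ℕ) (x y : Fin n) :
    (combineOut m x.val y.val fun j => runMax
      ((valuesAt l [x.val, y.val]).map fun v => v.length :: v).flatten j
      (valuesAt l [x.val, y.val]).length) =
    [(d x y).num, (d x y).den, newCode f msg x, newCode f msg y, 0, 0, 0] ::
      if newMsg d m I r r' x y = 0 then [] else [[newMsg d m I r r' x y]] := by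
  have key : ∀ j < 7, ∀ a, (∀ B, (∀ w ∈ valuesAt l [x.val, y.val], w.getD j 0 ≤ B) ↔ a ≤ B) →
      runMax ((valuesAt l [x.val, y.val]).map fun v => v.length :: v).flatten j
        (valuesAt l [x.val, y.val]).length = a := by
    intro j hj a ha
    refine eq_of_forall_ge_iff fun B => ?_
    rw [runMax_flatten_le_iff (fun w hw => (h.values_small lim hs x y hw).1) hj]
    exact ha B
  have hmem := h.mem_values x y
  have hall : ∀ (P : List ℕ → Prop), (∀ w ∈ valuesAt l [x.val, y.val], P w) ↔
      P [(d x y).num, (d x y).den, f x, f y, 0, 0, 0] ∧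
      (y ∈ I → P [0, 0, 0, 0, 1, r, r']) ∧
      (∀ c, msg x c ≠ 0 → P [0, 0, msg x c, 0, 0, 0, c.val + 1]) ∧
      (∀ c, msg y c ≠ 0 → P [0, 0, 0, msg y c, 0, 0, c.val + 1]) := by
    intro P
    constructor
    · intro hP
      exact ⟨hP _ ((hmem _).2 (Or.inl rfl)),
        fun hy => hP _ ((hmem _).2 (Or.inr (Or.inl ⟨hy, rfl⟩))),
        fun c hc => hP _ ((hmem _).2 (Or.inr (Or.inr (Or.inl ⟨c, hc, rfl⟩)))),
        fun c hc => hP _ ((hmem _).2 (Or.inr (Or.inr (Or.inr ⟨c, hc, rfl⟩))))⟩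
    · rintro ⟨h1, h2, h3, h4⟩ w hw
      rcases (hmem w).1 hw with rfl | ⟨hy, rfl⟩ | ⟨c, hc, rfl⟩ | ⟨c, hc, rfl⟩
      exacts [h1, h2 hy, h3 c hc, h4 c hc]
  have hsup : ∀ (z : Fin n) (B : ℕ), (f z ≤ B ∧ ∀ c, msg z c ≠ 0 → msg z c ≤ B) ↔
      newCode f msg z ≤ B := by
    intro z B
    rw [newCode, max_le_iff, Finset.sup_le_iff]
    refine and_congr_right fun _ => ⟨fun h' c _ => ?_, fun h' c _ => h' c (Finset.mem_univ c)⟩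
    by_cases hc : msg z c = 0
    · rw [hc]; exact Nat.zero_le _
    · exact h' c hc
  have e0 := key 0 (by omega) (d x y).num (fun B => by rw [hall]; simp)
  have e1 := key 1 (by omega) (d x y).den (fun B => by rw [hall]; simp)
  have e2 := key 2 (by omega) (newCode f msg x) (fun B => by rw [hall, ← hsup]; simp)
  have e3 := key 3 (by omega) (newCode f msg y) (fun B => by rw [hall, ← hsup]; simp)
  by_cases hy : y ∈ I
  · have hmsg : ∀ x y, msg x y = 0 := hIm.resolve_left fun h => by simp [h] at hy
    have e4 := key 4 (by omega) 1 (fun B => by rw [hall]; simp [hy])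
    have e5 := key 5 (by omega) r (fun B => by rw [hall]; simp [hy])
    have e6 := key 6 (by omega) r' (fun B => by rw [hall]; simp [hy, hmsg])
    rw [combineOut, e0, e1, e2, e3, e4, e5, e6, newMsg, if_pos hy, if_neg one_ne_zero]
    simp only [Fin.val_inj]
    by_cases hxy : x = y
    · simp [hxy]
    · by_cases hr : r * (d x y).den < (d x y).num * r'
      · simp [hxy, hr]
      · simp [hxy, hr]
  · have e4 := key 4 (by omega) 0 (fun B => by rw [hall]; simp [hy])
    rw [combineOut, e0, e1, e2, e3, e4, newMsg, if_neg hy, if_pos rfl, if_pos rfl]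

end

/-! ### Correctness of the rounds -/

section

variable {n k b s K T : ℕ} {Q : ℝ} {d : Fin n → Fin n → NNRat} {f : Fin n → ℕ}
  {I : Finset (Fin n)} {r r' : ℕ} {msg : Fin n → Fin n → ℕ} {l : List KV} {i : ℕ}

theorem mem_flatten_lt {vals : List (List ℕ)} {B : ℕ}
    (h : ∀ w ∈ vals, w.length < B ∧ ∀ a ∈ w, a < B) :
    ∀ a ∈ (vals.map fun v => v.length :: v).flatten, a < B := by
  intro a ha
  rw [List.mem_flatten] at ha
  obtain ⟨l, hl, hal⟩ := ha
  obtain ⟨w, hw, rfl⟩ := List.mem_map.1 hl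
  rcases List.mem_cons.1 hal with rfl | ha
  exacts [(h w hw).1, (h w hw).2 a ha]

theorem IsMapped.combine_runs (lim : Limits n b s K T Q) (hk : k ≤ n)
    (hs : SmallState b d f r r' msg) (h : IsMapped d f I r r' msg i l)
    (hIm : I = ∅ ∨ ∀ x y, msg x y = 0)
    (hK : ∀ x, (Finset.univ.filter fun c => msg x c ≠ 0).card ≤ K) (m : ℕ) (x y : Fin n)
    (coins : ℕ → Bool) :
    ∃ e : List KV, (Program.mk 2 (stepReduce m)).Runs T Q coins [n, k] [x.val, y.val]
      (valuesAt l [x.val, y.val]) e ∧ e.map Prod.snd =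
      [(d x y).num, (d x y).den, newCode f msg x, newCode f msg y, 0, 0, 0] ::
        if newMsg d m I r r' x y = 0 then [] else [[newMsg d m I r r' x y]] := by
  set vals := valuesAt l [x.val, y.val] with hvals
  have hsmall := fun w (hw : w ∈ vals) => h.values_small lim hs x y hw
  have h7 := lim.size
  have hn := lim.two_mul_lt
  have hx := lim.val_lt x
  have hy := lim.val_lt y
  have hlen : (vals.map fun v => v.length :: v).flatten.length = 8 * vals.length := by
    rw [length_flatten_of_forall (w := 8), List.length_map]
    intro l hl
    obtain ⟨w, hw, rfl⟩ := List.mem_map.1 hl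
    rw [List.length_cons, (hsmall w hw).1]
  have hlt := mem_flatten_lt (vals := vals) (B := 2 ^ b)
    fun w hw => ⟨by rw [(hsmall w hw).1]; omega, (hsmall w hw).2⟩
  have hN := h.length_values_le hK x y
  have hN' := h.length_values_le (K := n) (fun x => (Finset.card_le_univ _).trans (by simp)) x y
  rw [← hvals] at hN hN'
  have hNb : vals.length < 2 ^ b := by
    have : 2 * n + 2 ≤ n ^ 4 + 7 := by
      rcases Nat.lt_or_ge 1 n with h | h
      · have : n * 2 ≤ n * n ^ 3 := Nat.mul_le_mul_left _
          (le_trans h (Nat.le_self_pow (by norm_num) n))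
        have h3 : n * n ^ 3 = n ^ 4 := by ring
        omega
      · omega
    omega
  refine ⟨_, Program.Runs.of_tr (b := b) (cap := ![2, 2, 8 * vals.length, 8, 0])
    (Tr.ite_false (by simp [Expr.eval]) (tr_combine hlt hlen hNb le_rfl)) ?_
    (lim.le_time (by have := lim.pos; omega)) (lim.le_memory ?_) rfl, ?_⟩
  · rw [st_ok_iff]
    refine ⟨⟨by simp, by simp; omega⟩, ⟨by simp, by simp; omega⟩, ⟨hlen.le, hlt⟩,
      by simp, by simp⟩
  · simp [Fin.sum_univ_succ]; omega
  · rw [← h.combineOut_eq lim hs hIm m x y, List.map_map]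
    exact List.map_id _

theorem IsMapped.select_runs (lim : Limits n b s K T Q) (hk : k ≤ n) (hd : IsMetric d)
    (hρ : ∃ ρ, NetBound d k ρ)
    (hs : SmallState b d f r r' msg) (h : IsMapped d f I r r' msg i l)
    (hcard : (Finset.univ.filter fun x => f x = i).card ≤ s) (hne : ∃ x, f x = i)
    (es : List (Expr 5)) (em : ℕ → ℕ → ℕ → List ℕ) (other : Cmd 5)
    (hem : ∀ v g β φ cnt e t A, es.map (Expr.eval ![[n, k], [], v, [g, β, φ, cnt, e, t, 0], A]) =
      em (v.getD (5 * e + 1) 0) (v.getD (5 * g + 3) 0) (v.getD (5 * g + 4) 0)) :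
    ∃ L a a', IsSelected d k (Finset.univ.filter fun x => f x = i) L a a' ∧ ∀ coins,
      ∃ e : List KV, (Program.mk 2 (.ite (.eq (.len 1) (.lit 0))
        (selectCode (.instr (.emit [] es))) other)).Runs T Q coins [n, k] [] (valuesAt l []) e ∧
        e.map Prod.snd = L.map fun c => em c.val (d a a').num (d a a').den := by
  set vals := valuesAt l [] with hvals
  have hTne : (Finset.univ.filter fun x => f x = i).Nonempty := by
    obtain ⟨x, hx⟩ := hne
    exact ⟨x, by simp [hx]⟩
  obtain ⟨hlen, X, Y, htab⟩ := IsTable.of_mem hTne h.mem_values_nil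
  rw [← hvals] at hlen htab
  set v := (vals.map fun v => v.length :: v).flatten with hv
  have hE : vals.length = v.length / 5 := by omega
  obtain ⟨L, a, a', h1, h2, h3, h4, h5, h6⟩ := exists_selected htab hd hTne hρ em
  have hsq := h.length_values_nil_le
  have hEs : vals.length ≤ s ^ 2 := hsq.trans (Nat.pow_le_pow_left hcard 2)
  have hEn : vals.length ≤ n ^ 2 := hsq.trans (Nat.pow_le_pow_left
    ((Finset.card_le_univ _).trans (by simp)) 2)
  have h7 := lim.size
  have hn := lim.two_mul_lt
  have hlt : ∀ a ∈ v, a < 2 ^ b := by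
    refine mem_flatten_lt fun w hw => ?_
    obtain ⟨x, -, y, -, rfl⟩ := (h.mem_values_nil w).1 hw
    have hx := lim.val_lt x
    have hy := lim.val_lt y
    have hxy := hs.dist x y
    refine ⟨by simp; omega, ?_⟩
    simp; omega
  have hEb : vals.length * vals.length + 1 < 2 ^ b := by
    have : vals.length * vals.length ≤ n ^ 2 * n ^ 2 := Nat.mul_le_mul hEn hEn
    have h3 : n ^ 2 * n ^ 2 = n ^ 4 := by ring
    omega
  refine ⟨L, a, a', ⟨h1, h2, h3, h4, h5⟩, fun coins => ?_⟩
  obtain ⟨s', htr, hout⟩ := tr_select (coins := coins) (b := b)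
    (cap := ![2, 2, 5 * vals.length, 8, vals.length])
    (emission := .instr (.emit [] es)) (n := n) (k := k) (v := v)
    (f := fun g e => [([], em (v.getD (5 * e + 1) 0) (v.getD (5 * g + 3) 0)
      (v.getD (5 * g + 4) 0))]) hE hEb le_rfl (show 7 ≤ 8 by norm_num)
    (fun g β φ cnt e t A o => Tr.emit (by rw [hem]; rfl))
  refine ⟨_, Program.Runs.of_tr (Tr.ite_true (by simp [Expr.eval]) htr) ?_ ?_
    (lim.le_memory ?_) rfl, ?_⟩
  · rw [st_ok_iff]
    refine ⟨⟨by simp, by simp; omega⟩, ⟨by simp, by simp⟩, ⟨hlen.le, hlt⟩,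
      by simp, by simp⟩
  · refine le_trans ?_ lim.time
    have h1n : 1 ≤ n ^ 2 := Nat.one_le_pow _ _ lim.pos
    set N := n ^ 2 with hN
    have h8 : n ^ 8 = N * (N * (N * N)) := by rw [hN]; ring
    have hNN : N * N ≤ N * (N * N) := Nat.mul_le_mul_left _ (Nat.le_mul_of_pos_left _ h1n)
    have hNN' : N ≤ N * N := Nat.le_mul_of_pos_left _ h1n
    rw [h8]
    set E := vals.length
    have e1 : E * (E * E * 3 + 9) ≤ N * (N * N * 3 + 9) := by gcongr
    have e2 : N * (N * N * 3 + 9) + 9 ≤ 21 * (N * (N * N)) := by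
      have : N * (N * N * 3 + 9) = 3 * (N * (N * N)) + 9 * N := by ring
      omega
    have e3 : (E + 1) * (E * (E * E * 3 + 9) + 9) ≤ (2 * N) * (21 * (N * (N * N))) :=
      Nat.mul_le_mul (by omega) (by omega)
    have e4 : (2 * N) * (21 * (N * (N * N))) = 42 * (N * (N * (N * N))) := by ring
    have e5 : N ≤ N * (N * (N * N)) := Nat.le_mul_of_pos_right _ (by positivity)
    omega
  · simp [Fin.sum_univ_succ]; omega
  · rw [hout, hE]
    refine (congrArg (List.map Prod.snd) h6).trans ?_
    rw [List.map_map]; rfl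

theorem exists_keyFun {β : Type*} (out : Fin n → Fin n → β) (e : β) :
    ∃ g : List ℕ → β, (∀ x y : Fin n, g [x.val, y.val] = out x y) ∧ g [] = e := by
  refine ⟨fun κ => if h : κ.getD 0 n < n ∧ κ.getD 1 n < n then
    out ⟨κ.getD 0 n, h.1⟩ ⟨κ.getD 1 n, h.2⟩ else e, fun x y => ?_, ?_⟩
  · exact dif_pos (show x.val < n ∧ y.val < n from ⟨x.2, y.2⟩)
  · exact dif_neg (fun h => lt_irrefl n h.1)

/-- One round of the algorithm, from state to state. -/
theorem IsState.step (lim : Limits n b s K T Q) (hk : k ≤ n) (hkK : k ≤ K) (hd : IsMetric d)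
    (hρ : ∃ ρ, NetBound d k ρ) {m : ℕ} (hm : m + 2 < 2 ^ b)
    (hs : SmallState b d f r r' msg) (h : IsState d f I r r' msg l)
    (hIm : I = ∅ ∨ ∀ x y, msg x y = 0)
    (hK : ∀ x, (Finset.univ.filter fun c => msg x c ≠ 0).card ≤ K)
    (hcard : (Finset.univ.filter fun x => f x = i).card ≤ s)
    {shuffle : List KV → List KV} (hsh : ∀ l, (shuffle l).Perm l) (coins : List ℕ → ℕ → Bool) :
    ∃ L a a' l', IsSelected d k (Finset.univ.filter fun x => f x = i) L a a' ∧
      (stepRound m i).Runs T Q shuffle coins [n, k] l l' ∧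
      IsState d (newCode f msg) L.toFinset (d a a').num (d a a').den (newMsg d m I r r') l' := by
  have hmap : IsMapped d f I r r' msg i (shuffle (l.flatMap (stepMap i n))) :=
    (h.isMapped i).perm (hsh _)
  have h7 := lim.size
  set l₁ := shuffle (l.flatMap (stepMap i n)) with hl₁
  obtain ⟨L, a, a', hsel, hrun⟩ : ∃ L a a',
      IsSelected d k (Finset.univ.filter fun x => f x = i) L a a' ∧ ((∃ x, f x = i) → ∀ coins,
      ∃ e : List KV, (Program.mk 2 (stepReduce m)).Runs T Q coins [n, k] [] (valuesAt l₁ []) e ∧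
        e.map Prod.snd = L.map fun c : Fin n => [c.val, (d a a').num, (d a a').den]) := by
    by_cases hne : ∃ x, f x = i
    · obtain ⟨L, a, a', h1, h2⟩ := hmap.select_runs lim hk hd hρ hs hcard hne
        [field 1 (scal 4), field 3 (scal 0), field 4 (scal 0)] (fun a b c => [a, b, c])
        (combineCode m) (fun _ _ _ _ _ _ _ _ => rfl)
      exact ⟨L, a, a', h1, fun _ => h2⟩
    · let x₀ : Fin n := ⟨0, lim.pos⟩
      refine ⟨[], x₀, x₀, ⟨List.nodup_nil, by simp, by simp, ?_, ?_⟩, fun h => absurd h hne⟩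
      · intro x hx
        exact absurd ⟨x, (Finset.mem_filter.1 hx).2⟩ hne
      · intro ρ _
        rw [(hd.eq_zero_iff _ _).2 rfl]; exact zero_le
  have hsmallsel := hs.dist a a'
  let out : Fin n → Fin n → List (List ℕ) := fun x y =>
    [(d x y).num, (d x y).den, newCode f msg x, newCode f msg y, 0, 0, 0] ::
      if newMsg d m I r r' x y = 0 then [] else [[newMsg d m I r r' x y]]
  -- The values emitted on each machine, as a function of the key.
  obtain ⟨g, hg1, hg2⟩ := exists_keyFun out (L.map fun c => [c.val, (d a a').num, (d a a').den])
  have hsup : ∀ x, newCode f msg x < 2 ^ b := fun x =>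
    max_lt (hs.code x) ((Finset.sup_lt_iff (by positivity)).2 fun c _ => hs.msg x c)
  have hmsgb : ∀ x y, newMsg d m I r r' x y < 2 ^ b := by
    intro x y
    rw [newMsg]; split_ifs <;> omega
  have hR := Round.runs_of (R := stepRound m i) (T := T) (Q := Q) (shuffle := shuffle)
    (coins := coins) (params := [n, k]) (input := l) (stepMap i n) g
    (fun p hp => h.mapper_runs lim hk hs _ hp) (by
      intro κ hκ
      rcases (hmap.mem_keys κ).1 hκ with ⟨x, y, rfl⟩ | ⟨rfl, hne⟩
      · obtain ⟨e, he, heo⟩ := hmap.combine_runs lim hk hs hIm hK m x y (coins [x.val, y.val])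
        refine ⟨e, he, by rw [hg1, heo], le_trans ?_ (lim.le_memory (q := 18) (by omega))⟩
        rw [hg1]
        have hx := lim.val_lt x
        have hy := lim.val_lt y
        have hxy := hs.dist x y
        refine Nat.cast_le.2 ((sum_bits_le (b := b) (j := 7) (by simp; omega) ?_).trans ?_)
        · intro w hw
          simp only [out, List.mem_cons] at hw
          rcases hw with rfl | hw
          · simp [hxy, hsup]
          · split_ifs at hw
            · simp at hw
            · rw [List.mem_singleton] at hw
              subst hw
              simp [hmsgb]
        · refine Nat.mul_le_mul_right _ ?_
          simp only [out]
          split_ifs <;> simp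
      · obtain ⟨e, he, heo⟩ := hrun hne (coins [])
        refine ⟨e, he, by rw [hg2, heo], le_trans ?_ (lim.le_memory (q := 3 * K) (by omega))⟩
        rw [hg2]
        refine Nat.cast_le.2 ((sum_bits_le (b := b) (j := 3) (by simp) ?_).trans ?_)
        · intro w hw
          obtain ⟨c, -, rfl⟩ := List.mem_map.1 hw
          have hc := lim.val_lt c
          simp [hsmallsel]; omega
        · refine Nat.mul_le_mul_right _ ?_
          have := hsel.2.1
          simp only [List.length_map, List.length_nil]
          omega)
  refine ⟨L, a, a', _, hsel, hR, ?_, ?_⟩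
  · refine nodup_outputs (List.nodup_dedup _) fun κ hκ => ?_
    rcases (hmap.mem_keys κ).1 (List.mem_dedup.1 hκ) with ⟨x, y, rfl⟩ | ⟨rfl, hne⟩
    · rw [hg1]
      simp only [out]
      split_ifs <;> simp
    · rw [hg2]
      refine hsel.1.map fun c c' hc => ?_
      simp only [List.cons.injEq, Fin.val_inj] at hc
      exact hc.1
  · intro p
    rw [mem_outputs, List.mem_dedup, ← hl₁, hmap.mem_keys]
    constructor
    · obtain ⟨κ, w⟩ := p
      rintro ⟨⟨x, y, rfl⟩ | ⟨rfl, hne⟩, hw⟩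
      · simp only [hg1, out, List.mem_cons] at hw
        rcases hw with rfl | hw
        · exact Or.inl ⟨x, y, rfl⟩
        · split_ifs at hw with h0
          · simp at hw
          · rw [List.mem_singleton] at hw
            subst hw
            exact Or.inr (Or.inr ⟨x, y, h0, rfl⟩)
      · simp only [hg2] at hw
        obtain ⟨c, hc, rfl⟩ := List.mem_map.1 hw
        exact Or.inr (Or.inl ⟨c, List.mem_toFinset.2 hc, rfl⟩)
    · rintro (⟨x, y, rfl⟩ | ⟨c, hc, rfl⟩ | ⟨x, y, h0, rfl⟩)
      · refine ⟨Or.inl ⟨x, y, rfl⟩, ?_⟩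
        simp [hg1, out]
      · have hc' := List.mem_toFinset.1 hc
        refine ⟨Or.inr ⟨rfl, c, (Finset.mem_filter.1 (hsel.2.2.1 c hc')).2⟩, ?_⟩
        simp only [hg2]
        exact List.mem_map.2 ⟨c, hc', rfl⟩
      · refine ⟨Or.inl ⟨x, y, rfl⟩, ?_⟩
        simp [hg1, out, h0]

/-- The last round, which outputs the selected points. -/
theorem IsState.final (lim : Limits n b s K T Q) (hk : k ≤ n) (hkK : k ≤ K) (hd : IsMetric d)
    (hρ : ∃ ρ, NetBound d k ρ)
    (hs : SmallState b d f r r' msg) (h : IsState d f I r r' msg l)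
    (hK : ∀ x, (Finset.univ.filter fun c => msg x c ≠ 0).card ≤ K)
    (hcard : (Finset.univ.filter fun x => f x = i).card ≤ s) (hne : ∃ x, f x = i)
    {shuffle : List KV → List KV} (hsh : ∀ l, (shuffle l).Perm l) (coins : List ℕ → ℕ → Bool) :
    ∃ L a a' l', IsSelected d k (Finset.univ.filter fun x => f x = i) L a a' ∧
      (finalRound i).Runs T Q shuffle coins [n, k] l l' ∧ Outputs l' L.toFinset := by
  have hmap : IsMapped d f I r r' msg i (shuffle (l.flatMap (stepMap i n))) :=
    (h.isMapped i).perm (hsh _)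
  have h7 := lim.size
  have hn := lim.two_mul_lt
  set l₁ := shuffle (l.flatMap (stepMap i n)) with hl₁
  obtain ⟨L, a, a', hsel, hrun⟩ := hmap.select_runs lim hk hd hρ hs hcard hne
        [field 1 (scal 4)] (fun a b c => [a]) (.instr .nop) (fun _ _ _ _ _ _ _ _ => rfl)
  let g : List ℕ → List (List ℕ) := fun κ => if κ = [] then L.map fun c => [c.val] else []
  have hR := Round.runs_of (R := finalRound i) (T := T) (Q := Q) (shuffle := shuffle)
    (coins := coins) (params := [n, k]) (input := l) (stepMap i n) g
    (fun p hp => h.mapper_runs lim hk hs _ hp) (by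
      intro κ hκ
      rcases (hmap.mem_keys κ).1 hκ with ⟨x, y, rfl⟩ | ⟨rfl, hne⟩
      · have hx := lim.val_lt x
        have hy := lim.val_lt y
        have hsmall := fun w (hw : w ∈ valuesAt l₁ [x.val, y.val]) =>
          hmap.values_small lim hs x y hw
        have hlen : ((valuesAt l₁ [x.val, y.val]).map fun v => v.length :: v).flatten.length =
            8 * (valuesAt l₁ [x.val, y.val]).length := by
          rw [length_flatten_of_forall (w := 8), List.length_map]
          intro l hl
          obtain ⟨w, hw, rfl⟩ := List.mem_map.1 hl
          rw [List.length_cons, (hsmall w hw).1]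
        have hN := hmap.length_values_le hK x y
        refine ⟨[], Program.Runs.of_tr (b := b)
          (cap := ![2, 2, 8 * (valuesAt l₁ [x.val, y.val]).length, 8, 0])
          (Tr.ite_false (by simp [Expr.eval]) Tr.nop) ?_
          (lim.le_time (by have := lim.pos; omega)) (lim.le_memory ?_) rfl, by simp [g], ?_⟩
        · rw [st_ok_iff]
          refine ⟨⟨by simp, by simp; omega⟩, ⟨by simp, by simp; omega⟩, ⟨hlen.le, ?_⟩,
            by simp, by simp⟩
          exact mem_flatten_lt fun w hw => ⟨by rw [(hsmall w hw).1]; omega, (hsmall w hw).2⟩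
        · simp [Fin.sum_univ_succ]; omega
        · refine le_trans ?_ (lim.le_memory (q := 0) (by omega))
          simp [g]
      · obtain ⟨e, he, heo⟩ := hrun (coins [])
        refine ⟨e, he, by simp [g, heo], le_trans ?_ (lim.le_memory (q := K) (by omega))⟩
        simp only [g, if_pos]
        refine Nat.cast_le.2 ((sum_bits_le (b := b) (j := 1) (by simp) ?_).trans ?_)
        · intro w hw
          obtain ⟨c, -, rfl⟩ := List.mem_map.1 hw
          have hc := lim.val_lt c
          simp; omega
        · refine Nat.mul_le_mul_right _ ?_
          have := hsel.2.1
          simp only [List.length_map, List.length_nil]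
          omega)
  refine ⟨L, a, a', _, hsel, hR, ?_⟩
  intro w
  rw [List.mem_map]
  constructor
  · rintro ⟨p, hp, rfl⟩
    rw [mem_outputs] at hp
    have hw := hp.2
    simp only [g] at hw
    split_ifs at hw
    · obtain ⟨c, hc, hcw⟩ := List.mem_map.1 hw
      exact ⟨c, List.mem_toFinset.2 hc, hcw.symm⟩
    · simp at hw
  · rintro ⟨c, hc, rfl⟩
    refine ⟨([], [c.val]), mem_outputs.2 ⟨?_, ?_⟩, rfl⟩
    · rw [List.mem_dedup, ← hl₁]
      exact (hmap.mem_keys []).2 (Or.inr ⟨rfl, hne⟩)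
    · simp only [g, if_pos]
      exact List.mem_map.2 ⟨c, List.mem_toFinset.1 hc, rfl⟩

end

/-! ### Correctness of the first round -/

section

variable {n k b s K T : ℕ} {Q : ℝ} {d : Fin n → Fin n → NNRat}

theorem mem_inputPairs {p : KV} : p ∈ inputPairs d ↔
    ∃ x y : Fin n, p = ([x.val, y.val], [(d x y).num, (d x y).den]) := by
  simp only [inputPairs, List.mem_flatMap, List.mem_map, List.mem_finRange, true_and]
  constructor
  · rintro ⟨x, y, rfl⟩; exact ⟨x, y, rfl⟩
  · rintro ⟨x, y, rfl⟩; exact ⟨x, y, rfl⟩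

theorem nodup_inputPairs : (inputPairs d).Nodup := by
  rw [inputPairs, List.nodup_flatMap]
  constructor
  · intro x _
    refine (List.nodup_finRange n).map fun y y' h => ?_
    simp only [Prod.mk.injEq, List.cons.injEq, Fin.val_inj] at h
    exact h.1.2.1
  · refine (List.nodup_finRange n).pairwise_of_forall_ne fun x _ x' _ hne => ?_
    intro p hp hp'
    obtain ⟨y, -, rfl⟩ := List.mem_map.1 hp
    obtain ⟨y', -, h⟩ := List.mem_map.1 hp'
    simp only [Prod.mk.injEq, List.cons.injEq, Fin.val_inj] at h
    exact hne h.1.1.symm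

theorem eq_singleton_of_mem_iff {α : Type*} {l : List α} {a : α} (hl : l.Nodup)
    (h : ∀ w, w ∈ l ↔ w = a) : l = [a] := by
  refine List.perm_singleton.1 ((List.perm_ext_iff_of_nodup hl (List.nodup_singleton a)).2 ?_)
  simpa using h

/-- The first round: the level of each point is sent to it as a message. -/
theorem init_step (lim : Limits n b s K T Q) (hk : k ≤ n) {m C : ℕ} (hm0 : m ≠ 0)
    (hm : m + 2 < 2 ^ b) (hdist : ∀ x y, (d x y).num < 2 ^ b ∧ (d x y).den < 2 ^ b)
    {shuffle : List KV → List KV} (hsh : ∀ l, (shuffle l).Perm l) (coins : List ℕ → ℕ → Bool) :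
    ∃ l', (initRound m C).Runs T Q shuffle coins [n, k] (inputPairs d) l' ∧
      IsState d (fun _ => 0) ∅ 0 0 (fun x y => if x = y then
        level m C n k (geom (coins [x.val, x.val]) (Nat.clog 2 n)) + 1 else 0) l' := by
  have h7 := lim.size
  have hn := lim.two_mul_lt
  set lv : Fin n → ℕ := fun x => level m C n k (geom (coins [x.val, x.val]) (Nat.clog 2 n)) + 1
    with hlv
  have hlvb : ∀ x, lv x < 2 ^ b := by
    intro x
    have := level_le m C n k (geom (coins [x.val, x.val]) (Nat.clog 2 n))
    simp only [hlv]; omega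
  set l₁ := shuffle ((inputPairs d).flatMap fun p => [p]) with hl₁
  have hp : l₁.Perm (inputPairs d) :=
    (hsh _).trans (List.Perm.of_eq (List.flatMap_singleton' _))
  have hmem : ∀ p, p ∈ l₁ ↔ ∃ x y : Fin n, p = ([x.val, y.val], [(d x y).num, (d x y).den]) :=
    fun p => hp.mem_iff.trans mem_inputPairs
  have hnd : l₁.Nodup := hp.nodup_iff.2 nodup_inputPairs
  have hkeys : ∀ κ, κ ∈ l₁.map Prod.fst ↔ ∃ x y : Fin n, κ = [x.val, y.val] := by
    intro κ
    rw [List.mem_map]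
    constructor
    · rintro ⟨p, hp, rfl⟩
      obtain ⟨x, y, rfl⟩ := (hmem p).1 hp
      exact ⟨x, y, rfl⟩
    · rintro ⟨x, y, rfl⟩
      exact ⟨_, (hmem _).2 ⟨x, y, rfl⟩, rfl⟩
  have hvals : ∀ x y : Fin n, valuesAt l₁ [x.val, y.val] = [[(d x y).num, (d x y).den]] := by
    intro x y
    refine eq_singleton_of_mem_iff (nodup_valuesAt hnd _) fun w => ?_
    rw [mem_valuesAt, hmem]
    constructor
    · rintro ⟨x', y', h⟩
      simp only [Prod.mk.injEq, List.cons.injEq, Fin.val_inj] at h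
      obtain ⟨⟨rfl, rfl, -⟩, h⟩ := h
      exact h
    · rintro rfl; exact ⟨x, y, rfl⟩
  let out : Fin n → Fin n → List (List ℕ) := fun x y =>
    (if x = y then [[lv x]] else []) ++ [[(d x y).num, (d x y).den, 0, 0, 0, 0, 0]]
  obtain ⟨g, hg, -⟩ := exists_keyFun out []
  have hR := Round.runs_of (R := initRound m C) (T := T) (Q := Q) (shuffle := shuffle)
    (coins := coins) (params := [n, k]) (input := inputPairs d) (fun p => [p]) g
    (by
      intro p hp
      obtain ⟨x, y, rfl⟩ := mem_inputPairs.1 hp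
      have hx := lim.val_lt x
      have hy := lim.val_lt y
      have hxy := hdist x y
      refine Program.Runs.of_tr (b := b) (cap := ![2, 2, 3, 0, 0]) (tr_copy rfl) ?_
        (lim.le_time (by have := lim.pos; omega)) (lim.le_memory (by simp [Fin.sum_univ_succ])) rfl
      rw [st_ok_iff]
      refine ⟨⟨by simp, by simp; omega⟩, ⟨by simp, by simp; omega⟩, ⟨by simp, ?_⟩,
        by simp, by simp⟩
      simp; omega)
    (by
      intro κ hκ
      obtain ⟨x, y, rfl⟩ := (hkeys κ).1 hκ
      rw [hvals]
      have hx := lim.val_lt x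
      have hy := lim.val_lt y
      have hxy := hdist x y
      obtain ⟨s', htr, hout⟩ := tr_init (coins := coins [x.val, y.val]) (b := b)
        (cap := ![2, 2, 3, 4, 1]) (m := m) (C := C) (n := n) (k := k) (x := x.val) (y := y.val)
        (a := (d x y).num) (a' := (d x y).den) hm0 lim.pos hn le_rfl le_rfl
      refine ⟨_, Program.Runs.of_tr htr ?_ (lim.le_time (by have := lim.pos; omega))
        (lim.le_memory (by simp [Fin.sum_univ_succ])) rfl, ?_,
        le_trans ?_ (lim.le_memory (q := 18) (by omega))⟩
      · rw [st_ok_iff]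
        refine ⟨⟨by simp, by simp; omega⟩, ⟨by simp, by simp; omega⟩, ⟨by simp, ?_⟩,
          by simp, by simp⟩
        simp; omega
      · rw [hout, hg, List.map_map]
        refine (List.map_id _).trans ?_
        simp only [initOut, out, Fin.val_inj]
        by_cases h : x = y
        · subst h; rfl
        · simp [h]
      · rw [hg]
        refine Nat.cast_le.2 ((sum_bits_le (b := b) (j := 7) (by simp; omega) ?_).trans ?_)
        · intro w hw
          simp only [out, List.mem_append, List.mem_singleton] at hw
          rcases hw with hw | rfl
          · split_ifs at hw
            · rw [List.mem_singleton] at hw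
              subst hw
              simp [hlvb]
            · simp at hw
          · simp [hxy]
        · refine Nat.mul_le_mul_right _ ?_
          simp only [out]
          split_ifs <;> simp)
  refine ⟨_, hR, ?_, ?_⟩
  · refine nodup_outputs (List.nodup_dedup _) fun κ hκ => ?_
    obtain ⟨x, y, rfl⟩ := (hkeys κ).1 (List.mem_dedup.1 hκ)
    rw [hg]
    simp only [out]
    split_ifs <;> simp
  · intro p
    rw [mem_outputs, List.mem_dedup, ← hl₁, hkeys]
    constructor
    · obtain ⟨κ, w⟩ := p
      rintro ⟨⟨x, y, rfl⟩, hw⟩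
      simp only [hg, out, List.mem_append, List.mem_singleton] at hw
      rcases hw with hw | rfl
      · split_ifs at hw with hxy
        · rw [List.mem_singleton] at hw
          subst hw hxy
          exact Or.inr (Or.inr ⟨x, x, by simp, by simp [hlv]⟩)
        · simp at hw
      · exact Or.inl ⟨x, y, rfl⟩
    · rintro (⟨x, y, rfl⟩ | ⟨c, hc, rfl⟩ | ⟨x, y, h0, rfl⟩)
      · refine ⟨⟨x, y, rfl⟩, ?_⟩
        simp [hg, out]
      · simp at hc
      · refine ⟨⟨x, y, rfl⟩, ?_⟩
        have hxy : x = y := by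
          by_contra hne
          simp [hne] at h0
        subst hxy
        simp [hg, out, hlv]

end

/-! ### The run of the algorithm for given levels -/

/-- The points outside a list of balls. The ball `(c, a, a')` has the center `c` and the radius
`d a a'`. -/
def outside {n : ℕ} (d : Fin n → Fin n → NNRat) (hist : List (Fin n × Fin n × Fin n)) :
    Finset (Fin n) :=
  Finset.univ.filter fun x => ∀ t ∈ hist, d t.2.1 t.2.2 < d x t.1

/-- The property of the random levels `lam` on which the memory bound rests: whenever all points of
lower levels are covered by at most `m k` balls, at most `s` uncovered points have the next
level. -/
def GoodLevels {n : ℕ} (d : Fin n → Fin n → NNRat) (lam : Fin n → ℕ) (m k s : ℕ) : Prop :=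
  ∀ i < m, ∀ hist : List (Fin n × Fin n × Fin n), hist.length ≤ m * k →
    (∀ x ∈ outside d hist, i ≤ lam x) →
    ((outside d hist).filter fun x => lam x = i).card ≤ s

/-- The situation after `i` iterations: the points of level less than `i` are covered by the balls
in `hist`, whose radii are at most twice the optimal cost. An uncovered point `x` has the code
`lam x + 1`, a center has the code `m + 2`, and all other points have the code `m + 1`. -/
def Covered {n : ℕ} (d : Fin n → Fin n → NNRat) (lam : Fin n → ℕ) (m k i : ℕ) (f : Fin n → ℕ)
    (hist : List (Fin n × Fin n × Fin n)) : Prop :=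
  hist.length ≤ i * k ∧
  (∀ t ∈ hist, f t.1 = m + 2 ∧ ∀ ρ, NetBound d k ρ → d t.2.1 t.2.2 ≤ ρ) ∧
  (∀ x ∈ outside d hist, f x = lam x + 1 ∧ i ≤ lam x) ∧
  (∀ x ∉ outside d hist, f x = m + 1 ∨ f x = m + 2) ∧
  ∀ x, f x = m + 2 → x ∈ hist.map Prod.fst

theorem mem_outside {n : ℕ} {d : Fin n → Fin n → NNRat} {hist : List (Fin n × Fin n × Fin n)}
    {x : Fin n} : x ∈ outside d hist ↔ ∀ t ∈ hist, d t.2.1 t.2.2 < d x t.1 := by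
  simp [outside]

section

variable {n k b s K T : ℕ} {Q : ℝ} {d : Fin n → Fin n → NNRat}

theorem newCode_zero (f : Fin n → ℕ) {msg : Fin n → Fin n → ℕ} (h : ∀ x y, msg x y = 0) :
    newCode f msg = f := by
  funext x
  rw [newCode, Finset.sup_eq_bot_iff _ _ |>.2 (fun y _ => h x y)]
  simp

theorem newMsg_empty (m r r' : ℕ) (x y : Fin n) : newMsg d m ∅ r r' x y = 0 := by
  simp [newMsg]

theorem newMsg_le (m : ℕ) (I : Finset (Fin n)) (r r' : ℕ) (x y : Fin n) :
    newMsg d m I r r' x y ≤ m + 2 := by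
  rw [newMsg]; split_ifs <;> omega

theorem card_newMsg_le {m r r' : ℕ} {I : Finset (Fin n)} (hI : I.card ≤ K) (x : Fin n) :
    (Finset.univ.filter fun c => newMsg d m I r r' x c ≠ 0).card ≤ K := by
  refine (Finset.card_le_card fun c hc => ?_).trans hI
  by_contra h
  simp [newMsg, h] at hc

/-- One iteration covers the points of level `i`. -/
theorem Covered.succ {lam : Fin n → ℕ} {m i : ℕ} {f : Fin n → ℕ}
    {hist : List (Fin n × Fin n × Fin n)} (hd : IsMetric d) (hlam : ∀ x, lam x < m)
    (h : Covered d lam m k i f hist) {L : List (Fin n)} {a a' : Fin n}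
    (hL : IsSelected d k (Finset.univ.filter fun x => f x = i + 1) L a a') :
    Covered d lam m k (i + 1)
      (newCode f (newMsg d m L.toFinset (d a a').num (d a a').den))
      (hist ++ L.map fun c => (c, a, a')) := by
  obtain ⟨h1, h2, h3, h4, h5⟩ := h
  obtain ⟨hL1, hL2, hL3, hL4, hL5⟩ := hL
  set f' := newCode f (newMsg d m L.toFinset (d a a').num (d a a').den) with hf'
  have hle : ∀ x, f x ≤ m + 2 := by
    intro x
    by_cases hx : x ∈ outside d hist
    · have := (h3 x hx).1; have := hlam x; omega
    · rcases h4 x hx with h | h <;> omega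
  have hle' : ∀ x, f' x ≤ m + 2 := fun x =>
    max_le (hle x) (Finset.sup_le fun c _ => newMsg_le _ _ _ _ _ _)
  have hge : ∀ x, f x ≤ f' x := fun x => le_max_left _ _
  have hmsg : ∀ x c, newMsg d m L.toFinset (d a a').num (d a a').den x c ≤ f' x := fun x c =>
    (Finset.le_sup (f := newMsg d m L.toFinset (d a a').num (d a a').den x)
      (Finset.mem_univ c)).trans (le_max_right _ _)
  have hcen : ∀ c ∈ L, f' c = m + 2 := by
    intro c hc
    refine le_antisymm (hle' c) ?_
    have := hmsg c c
    rwa [newMsg, if_pos (List.mem_toFinset.2 hc), if_pos rfl] at this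
  have hout : ∀ x, x ∈ outside d (hist ++ L.map fun c => (c, a, a')) ↔
      x ∈ outside d hist ∧ ∀ c ∈ L, d a a' < d x c := by
    intro x
    rw [mem_outside, mem_outside]
    constructor
    · intro h
      exact ⟨fun t ht => h t (List.mem_append_left _ ht), fun c hc =>
        h (c, a, a') (List.mem_append_right _ (List.mem_map.2 ⟨c, hc, rfl⟩))⟩
    · rintro ⟨h, h'⟩ t ht
      rcases List.mem_append.1 ht with ht | ht
      · exact h t ht
      · obtain ⟨c, hc, rfl⟩ := List.mem_map.1 ht
        exact h' c hc
  -- A point which is not a new center gets at most the code `m + 1`.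
  have hnot : ∀ x, x ∉ L → f x ≤ m + 1 → f' x ≤ m + 1 := by
    intro x hx hfx
    refine max_le hfx (Finset.sup_le fun c _ => ?_)
    rw [newMsg]
    split_ifs with hc hxc
    · subst hxc; exact absurd (List.mem_toFinset.1 hc) hx
    all_goals omega
  refine ⟨?_, ?_, ?_, ?_, ?_⟩
  · rw [List.length_append, List.length_map, Nat.succ_mul]; omega
  · intro t ht
    rcases List.mem_append.1 ht with ht | ht
    · exact ⟨le_antisymm (hle' _) ((h2 t ht).1 ▸ hge t.1), (h2 t ht).2⟩
    · obtain ⟨c, hc, rfl⟩ := List.mem_map.1 ht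
      exact ⟨hcen c hc, hL5⟩
  · intro x hx
    obtain ⟨hx1, hx2⟩ := (hout x).1 hx
    have hzero : ∀ c, newMsg d m L.toFinset (d a a').num (d a a').den x c = 0 := by
      intro c
      rw [newMsg]
      split_ifs with hc hxc hr
      · subst hxc
        have := hx2 x (List.mem_toFinset.1 hc)
        rw [(hd.eq_zero_iff _ _).2 rfl] at this
        exact absurd this not_lt_bot
      · rfl
      · exact absurd (NNRat.lt_def.1 (hx2 c (List.mem_toFinset.1 hc))) hr
      · rfl
    have hfx : f' x = f x := by
      rw [hf', newCode, Finset.sup_eq_bot_iff _ _ |>.2 (fun y _ => hzero y)]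
      simp
    rw [hfx]
    refine ⟨(h3 x hx1).1, ?_⟩
    by_contra hlt
    have hi : f x = i + 1 := by have := h3 x hx1; omega
    obtain ⟨c, hc, hdc⟩ := hL4 x (by simp [hi])
    exact absurd (hx2 c hc) (not_lt.2 hdc)
  · intro x hx
    by_cases hxL : x ∈ L
    · exact Or.inr (hcen x hxL)
    have hx1 : m + 1 ≤ f' x := by
      by_cases hxo : x ∈ outside d hist
      · have : ¬ ∀ c ∈ L, d a a' < d x c := fun h => hx ((hout x).2 ⟨hxo, h⟩)
        push Not at this
        obtain ⟨c, hc, hdc⟩ := this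
        have := hmsg x c
        rw [newMsg, if_pos (List.mem_toFinset.2 hc), if_neg (fun h : x = c => hxL (h ▸ hc)),
          if_neg] at this
        · exact this
        · exact fun hr => absurd (NNRat.lt_def.2 hr) (not_lt.2 hdc)
      · have := hge x
        rcases h4 x hxo with h | h <;> omega
    have := hle' x
    omega
  · intro x hx
    rw [List.map_append, List.mem_append]
    by_cases hxL : x ∈ L
    · right
      rw [List.map_map]
      exact List.mem_map.2 ⟨x, hxL, rfl⟩
    · left
      refine h5 x ?_
      by_contra hne
      have := hnot x hxL (by have := hle x; omega)
      omega

theorem Covered.code_le {lam : Fin n → ℕ} {m i : ℕ} {f : Fin n → ℕ}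
    {hist : List (Fin n × Fin n × Fin n)} (hlam : ∀ x, lam x < m)
    (h : Covered d lam m k i f hist) (x : Fin n) : f x ≤ m + 2 := by
  by_cases hx : x ∈ outside d hist
  · have := (h.2.2.1 x hx).1; have := hlam x; omega
  · rcases h.2.2.2.1 x hx with h | h <;> omega

theorem Covered.filter_eq {lam : Fin n → ℕ} {m i : ℕ} {f : Fin n → ℕ}
    {hist : List (Fin n × Fin n × Fin n)} (hi : i < m)
    (h : Covered d lam m k i f hist) :
    (Finset.univ.filter fun x => f x = i + 1) = (outside d hist).filter fun x => lam x = i := by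
  ext x
  rw [Finset.mem_filter, Finset.mem_filter]
  by_cases hx : x ∈ outside d hist
  · have := h.2.2.1 x hx
    simp only [Finset.mem_univ, true_and, hx]
    omega
  · have := h.2.2.2.1 x hx
    simp only [Finset.mem_univ, true_and, hx, false_and, iff_false]
    omega

theorem runsFrom_append {shuffle : ℕ → List KV → List KV} {ω : Coins} {params : List ℕ}
    {r : ℕ} {A B : Algorithm} {input mid output : List KV}
    (hA : RunsFrom T Q shuffle ω params r A input mid)
    (hB : RunsFrom T Q shuffle ω params (r + A.length) B mid output) :
    RunsFrom T Q shuffle ω params r (A ++ B) input output := by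
  induction A generalizing r input with
  | nil => rw [RunsFrom] at hA; subst hA; exact hB
  | cons R A ih =>
    obtain ⟨l, hR, hA⟩ := hA
    refine ⟨l, hR, ih hA ?_⟩
    rwa [List.length_cons, Nat.add_comm A.length, ← Nat.add_assoc] at hB

/-- The rounds of the iteration number `i`: selecting new centers among the uncovered points of
level `i`, delivering their tokens, and delivering the messages to the points they cover. No point
has the code `m + 3`. -/
def iterRounds (m i : ℕ) : Algorithm :=
  [stepRound m (i + 1), stepRound m (m + 3), stepRound m (m + 3)]

/-- The algorithm: drawing the levels, one iteration for each level, and a final selection among all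
centers found, which have the code `m + 2`. -/
def algorithm (m C : ℕ) : Algorithm :=
  [initRound m C, stepRound m (m + 3)] ++
    ((List.range m).flatMap (iterRounds m) ++ [finalRound (m + 2)])

theorem length_algorithm (m C : ℕ) : (algorithm m C).length = 3 * m + 3 := by
  simp [algorithm, iterRounds, List.length_flatMap]
  ring

theorem IsSelected.eq_nil {T : Finset (Fin n)} {L : List (Fin n)} {a a' : Fin n} (hT : T = ∅)
    (h : IsSelected d k T L a a') : L = [] := by
  rw [List.eq_nil_iff_forall_not_mem]
  intro c hc
  have := h.2.2.1 c hc
  simp [hT] at this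

theorem filter_code_eq_empty {m : ℕ} {f : Fin n → ℕ} (h : ∀ x, f x ≤ m + 2) :
    (Finset.univ.filter fun x => f x = m + 3) = ∅ := by
  ext x
  have := h x
  simp; omega

/-- A round in which no point has the selected code. -/
theorem IsState.deliver (lim : Limits n b s K T Q) (hk : k ≤ n) (hkK : k ≤ K) (hd : IsMetric d)
    (hρ : ∃ ρ, NetBound d k ρ) {m : ℕ} (hm : m + 2 < 2 ^ b)
    {f : Fin n → ℕ} {I : Finset (Fin n)} {r r' : ℕ} {msg : Fin n → Fin n → ℕ} {l : List KV}
    (hs : SmallState b d f r r' msg) (h : IsState d f I r r' msg l)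
    (hIm : I = ∅ ∨ ∀ x y, msg x y = 0)
    (hK : ∀ x, (Finset.univ.filter fun c => msg x c ≠ 0).card ≤ K)
    (hf : ∀ x, f x ≤ m + 2)
    {shuffle : List KV → List KV} (hsh : ∀ l, (shuffle l).Perm l) (coins : List ℕ → ℕ → Bool) :
    ∃ r₁ r₁' l', r₁ < 2 ^ b ∧ r₁' < 2 ^ b ∧
      (stepRound m (m + 3)).Runs T Q shuffle coins [n, k] l l' ∧
      IsState d (newCode f msg) ∅ r₁ r₁' (newMsg d m I r r') l' := by
  have hempty := filter_code_eq_empty hf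
  obtain ⟨L, a, a', l', h1, h2, h3⟩ := h.step (i := m + 3) lim hk hkK hd hρ hm hs hIm hK
    (by rw [hempty]; simp) hsh coins
  rw [h1.eq_nil hempty] at h3
  exact ⟨_, _, l', (hs.dist a a').1, (hs.dist a a').2, h2, h3⟩

/-- The three rounds of an iteration lead from `Covered d lam m k i` to
`Covered d lam m k (i + 1)`. -/
theorem iteration (lim : Limits n b s K T Q) (hk : k ≤ n) (hkK : k ≤ K) (hd : IsMetric d)
    (hρ : ∃ ρ, NetBound d k ρ) {m : ℕ} (hm : m + 2 < 2 ^ b)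
    (hdist : ∀ x y, (d x y).num < 2 ^ b ∧ (d x y).den < 2 ^ b)
    {lam : Fin n → ℕ} (hlam : ∀ x, lam x < m) (hgood : GoodLevels d lam m k s)
    {f : Fin n → ℕ} {r r' i : ℕ} {msg : Fin n → Fin n → ℕ} {l : List KV} (hi : i < m)
    {hist : List (Fin n × Fin n × Fin n)} (hcov : Covered d lam m k i f hist)
    (hr : r < 2 ^ b) (hr' : r' < 2 ^ b)
    (hmsg : ∀ x y, msg x y = 0) (h : IsState d f ∅ r r' msg l)
    {shuffle : ℕ → List KV → List KV} (hsh : ∀ j l, (shuffle j l).Perm l) (ω : Coins) (j : ℕ) :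
    ∃ f' r₁ r₁' msg' l' hist', Covered d lam m k (i + 1) f' hist' ∧
      r₁ < 2 ^ b ∧ r₁' < 2 ^ b ∧ (∀ x y, msg' x y = 0) ∧ IsState d f' ∅ r₁ r₁' msg' l' ∧
      RunsFrom T Q shuffle ω [n, k] j (iterRounds m i) l l' := by
  have h0 : 0 < 2 ^ b := by positivity
  have hle := hcov.code_le hlam
  have hcode : ∀ x, f x < 2 ^ b := fun x => (hle x).trans_lt hm
  have hcard : (Finset.univ.filter fun x => f x = i + 1).card ≤ s := by
    rw [hcov.filter_eq hi]
    refine hgood i hi hist (hcov.1.trans (Nat.mul_le_mul_right _ hi.le)) fun x hx => ?_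
    exact (hcov.2.2.1 x hx).2
  obtain ⟨L, a, a', l₁, hsel, hrun₁, hst₁⟩ := h.step (i := i + 1) lim hk hkK hd hρ hm
    ⟨hdist, hcode, ⟨hr, hr'⟩, fun x y => by rw [hmsg]; exact h0⟩ (Or.inl rfl)
    (by simp [hmsg]) hcard (hsh j) (fun κ i => ω (j, κ, i))
  rw [newCode_zero f hmsg] at hst₁
  have hz : ∀ x y, newMsg d m ∅ r r' x y = 0 := newMsg_empty m r r'
  have hLK : L.toFinset.card ≤ K := (List.toFinset_card_le L).trans (hsel.2.1.trans hkK)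
  obtain ⟨r₂, r₂', l₂, hr₂, hr₂', hrun₂, hst₂⟩ := hst₁.deliver lim hk hkK hd hρ hm
    ⟨hdist, hcode, hdist a a', fun x y => by rw [hz]; exact h0⟩ (Or.inr hz)
    (by simp [hz]) hle (hsh (j + 1)) (fun κ i => ω (j + 1, κ, i))
  rw [newCode_zero f hz] at hst₂
  obtain ⟨r₃, r₃', l₃, hr₃, hr₃', hrun₃, hst₃⟩ := hst₂.deliver lim hk hkK hd hρ hm
    ⟨hdist, hcode, ⟨hr₂, hr₂'⟩, fun x y => (newMsg_le _ _ _ _ _ _).trans_lt hm⟩ (Or.inl rfl)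
    (card_newMsg_le hLK) hle (hsh (j + 1 + 1)) (fun κ i => ω (j + 1 + 1, κ, i))
  exact ⟨_, r₃, r₃', _, l₃, _, hcov.succ hd hlam hsel, hr₃, hr₃', newMsg_empty m r₂ r₂', hst₃,
    l₁, hrun₁, l₂, hrun₂, l₃, hrun₃, rfl⟩

/-- The level of the point `x`, as drawn in the first round. -/
noncomputable def levelOf (m C n k : ℕ) (ω : Coins) (x : Fin n) : ℕ :=
  level m C n k (geom (fun j => ω (0, [x.val, x.val], j)) (Nat.clog 2 n))

theorem geom_pos (coins : ℕ → Bool) (j : ℕ) : 0 < geom coins j := by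
  obtain ⟨g, hg⟩ := geom_eq_two_pow coins j
  rw [hg]; positivity

theorem levelOf_lt {m C : ℕ} (hm : m ≠ 0) (hC : 1 ≤ C) (hk : 1 ≤ k) (hn : 1 ≤ n) (ω : Coins)
    (x : Fin n) : levelOf m C n k ω x < m := by
  have : levelOf m C n k ω x ≤ m - 1 := by
    rw [levelOf, level_le_iff (by omega)]
    have h1 := le_ceilRoot_pow hm n
    have h2 : ceilRoot m n ^ m ≤ ceilRoot m n ^ (m - 1 + 2) :=
      Nat.pow_le_pow_right (ceilRoot_pos m n) (by omega)
    have h3 : 0 < C * (k * geom (fun j => ω (0, [x.val, x.val], j)) (Nat.clog 2 n)) := by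
      have := geom_pos (fun j => ω (0, [x.val, x.val], j)) (Nat.clog 2 n)
      positivity
    calc n < 2 * n := by omega
      _ ≤ 2 * (C * (k * geom (fun j => ω (0, [x.val, x.val], j)) (Nat.clog 2 n))) *
          ceilRoot m n ^ (m - 1 + 2) := Nat.mul_le_mul (by omega) (h1.trans h2)
      _ = _ := by ring
  omega

theorem netBound_two_mul_cost (hd : IsMetric d) {S : Finset (Fin n)} (hS : S.Nonempty)
    (hSk : S.card ≤ k) : NetBound d k (2 * cost d S hS) := by
  have hnear : ∀ x, ∃ y ∈ S, d x y ≤ cost d S hS := by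
    intro x
    obtain ⟨y, hy, h⟩ := Finset.exists_mem_eq_inf' hS fun y => d x y
    refine ⟨y, hy, ?_⟩
    rw [← h]
    exact Finset.le_sup (f := fun x => S.inf' hS fun y => d x y) (Finset.mem_univ x)
  choose y hyS hy using hnear
  intro A hA
  refine le_trans (Finset.card_le_card_of_injOn y (fun x _ => hyS x) ?_) hSk
  intro x hx x' hx' hyy
  by_contra hne
  refine absurd (hA x hx x' hx' hne) (not_lt.2 ?_)
  calc d x x' ≤ d x (y x) + d (y x) x' := hd.triangle _ _ _
    _ ≤ cost d S hS + cost d S hS := by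
      refine add_le_add (hy x) ?_
      rw [hyy, hd.symm]; exact hy x'
    _ = _ := (two_mul _).symm

/-- For good levels, the algorithm stays within its limits and outputs a `4`-approximation. -/
theorem exists_run (lim : Limits n b s K T Q) (hk1 : 1 ≤ k) (hk : k ≤ n) (hkK : k ≤ K)
    {m C : ℕ} (hms : m * k ≤ s) (hd : IsMetric d) (hm0 : m ≠ 0) (hC : 1 ≤ C) (hm : m + 2 < 2 ^ b)
    (hdist : ∀ x y, (d x y).num < 2 ^ b ∧ (d x y).den < 2 ^ b)
    {shuffle : ℕ → List KV → List KV} (hsh : ∀ j l, (shuffle j l).Perm l) (ω : Coins)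
    (hgood : GoodLevels d (levelOf m C n k ω) m k s) :
    ∃ out S, RunsFrom T Q shuffle ω [n, k] 0 (algorithm m C) (inputPairs d) out ∧
      Outputs out S ∧ IsApprox d k 4 S := by
  have h0 : 0 < 2 ^ b := by positivity
  have hlam := levelOf_lt (C := C) hm0 hC hk1 lim.pos ω
  set lam := levelOf m C n k ω with hlamdef
  let x₀ : Fin n := ⟨0, lim.pos⟩
  have hρ : ∃ ρ, NetBound d k ρ :=
    ⟨_, netBound_two_mul_cost hd (Finset.singleton_nonempty x₀) (by simpa using hk1)⟩
  obtain ⟨l₀, hrun₀, hst₀⟩ := init_step lim hk (C := C) hm0 hm hdist (hsh 0)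
    (fun κ i => ω (0, κ, i))
  have hmsg₀ : ∀ x y : Fin n, (if x = y then level m C n k (geom (fun i => ω (0, [x.val, x.val], i))
      (Nat.clog 2 n)) + 1 else 0) = if x = y then lam x + 1 else 0 := fun x y => rfl
  obtain ⟨r₁, r₁', l₁, hr₁, hr₁', hrun₁, hst₁⟩ := hst₀.deliver lim hk hkK hd hρ hm
    ⟨hdist, fun _ => h0, ⟨h0, h0⟩, fun x y => by
      have := hlam x
      rw [hmsg₀]; split_ifs <;> omega⟩ (Or.inl rfl)
    (fun x => by
      refine le_trans (Finset.card_le_card (t := {x}) fun c hc => ?_) (by simpa using hk1.trans hkK)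
      by_contra hne
      rw [Finset.mem_singleton] at hne
      simp [Ne.symm hne] at hc) (by simp) (hsh 1) (fun κ i => ω (1, κ, i))
  have hcode₁ : newCode (fun _ => 0) (fun x y : Fin n => if x = y then level m C n k
      (geom (fun i => ω (0, [x.val, x.val], i)) (Nat.clog 2 n)) + 1 else 0) =
      fun x => lam x + 1 := by
    funext x
    rw [newCode]
    refine le_antisymm (max_le (Nat.zero_le _) (Finset.sup_le fun c _ => ?_)) ?_
    · show (if x = c then lam x + 1 else 0) ≤ _
      split_ifs <;> omega
    · refine le_trans ?_ ((Finset.le_sup (Finset.mem_univ x)).trans (le_max_right _ _))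
      exact (if_pos rfl : (if x = x then lam x + 1 else 0) = _).ge
  rw [hcode₁] at hst₁
  -- The invariant of the iterations; afterwards no point is uncovered, since levels are below `m`.
  have hiter : ∀ i ≤ m, ∃ f r r' msg l hist, Covered d lam m k i f hist ∧
      r < 2 ^ b ∧ r' < 2 ^ b ∧ (∀ x y, msg x y = 0) ∧ IsState d f ∅ r r' msg l ∧
      RunsFrom T Q shuffle ω [n, k] 2 ((List.range i).flatMap (iterRounds m)) l₁ l := by
    intro i
    induction i with
    | zero =>
      intro _
      refine ⟨_, r₁, r₁', _, l₁, [], ⟨by simp, by simp, fun x _ => ⟨rfl, Nat.zero_le _⟩, ?_, ?_⟩,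
        hr₁, hr₁', newMsg_empty m 0 0, hst₁, rfl⟩
      · intro x hx
        exact absurd (mem_outside.2 (by simp)) hx
      · intro x hx
        have := hlam x
        omega
    | succ i ih =>
      intro hi
      obtain ⟨f, r, r', msg, l, hist, hcov, hr, hr', hmsg, hst, hrun⟩ := ih (by omega)
      obtain ⟨f', r₂, r₂', msg', l', hist', hcov', hr₂, hr₂', hmsg', hst', hrun'⟩ :=
        iteration lim hk hkK hd hρ hm hdist hlam hgood hi hcov hr hr' hmsg hst hsh ω
          (2 + ((List.range i).flatMap (iterRounds m)).length)
      refine ⟨f', r₂, r₂', msg', l', hist', hcov', hr₂, hr₂', hmsg', hst', ?_⟩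
      rw [List.range_succ, List.flatMap_append]
      refine runsFrom_append hrun ?_
      rw [List.flatMap_cons, List.flatMap_nil, List.append_nil]
      exact hrun'
  obtain ⟨f, r, r', msg, l, hist, hcov, hr, hr', hmsg, hst, hrun⟩ := hiter m le_rfl
  have hcover : ∀ x, ∃ t ∈ hist, d x t.1 ≤ d t.2.1 t.2.2 := by
    intro x
    have : x ∉ outside d hist := fun hx => by
      have := (hcov.2.2.1 x hx).2
      have := hlam x
      omega
    rw [mem_outside] at this
    push Not at this
    exact this
  have hcard : (Finset.univ.filter fun x => f x = m + 2).card ≤ s := by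
    refine le_trans (Finset.card_le_card (t := (hist.map Prod.fst).toFinset) fun x hx => ?_) ?_
    · exact List.mem_toFinset.2 (hcov.2.2.2.2 x (Finset.mem_filter.1 hx).2)
    · refine (List.toFinset_card_le _).trans ?_
      rw [List.length_map]
      exact hcov.1.trans hms
  have hne : ∃ x, f x = m + 2 := by
    obtain ⟨t, ht, -⟩ := hcover x₀
    exact ⟨t.1, (hcov.2.1 t ht).1⟩
  obtain ⟨L, a, a', out, hsel, hfin, hout⟩ := hst.final lim hk hkK hd hρ
    ⟨hdist, fun x => (hcov.code_le hlam x).trans_lt hm, ⟨hr, hr'⟩,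
      fun x y => by rw [hmsg]; exact h0⟩ (by simp [hmsg]) hcard hne
    (hsh (2 + ((List.range m).flatMap (iterRounds m)).length))
    (fun κ i => ω (2 + ((List.range m).flatMap (iterRounds m)).length, κ, i))
  refine ⟨out, L.toFinset, ?_, hout, ?_⟩
  · refine runsFrom_append (mid := l₁) ⟨l₀, hrun₀, l₁, hrun₁, rfl⟩ ?_
    exact runsFrom_append hrun ⟨out, hfin, rfl⟩
  · have hLne : L.toFinset.Nonempty := by
      obtain ⟨x, hx⟩ := hne
      obtain ⟨c, hc, -⟩ := hsel.2.2.2.1 x (by simp [hx])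
      exact ⟨c, List.mem_toFinset.2 hc⟩
    refine ⟨hLne, (List.toFinset_card_le L).trans hsel.2.1, fun S' hS' hS'k => ?_⟩
    have hnet := netBound_two_mul_cost hd hS' hS'k
    refine Finset.sup_le fun x _ => ?_
    obtain ⟨t, ht, hxt⟩ := hcover x
    obtain ⟨c, hc, htc⟩ := hsel.2.2.2.1 t.1 (by simp [(hcov.2.1 t ht).1])
    refine (Finset.inf'_le _ (List.mem_toFinset.2 hc)).trans ?_
    calc d x c ≤ d x t.1 + d t.1 c := hd.triangle _ _ _
      _ ≤ 2 * cost d S' hS' + 2 * cost d S' hS' :=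
        add_le_add (hxt.trans ((hcov.2.1 t ht).2 _ hnet)) (htc.trans (hsel.2.2.2.2 _ hnet))
      _ = 4 * cost d S' hS' := by ring

end

/-! ### The random levels -/

instance : IsProbabilityMeasure coinMeasure := by
  unfold coinMeasure; infer_instance

section

variable {n : ℕ}

/-- The first `l` coins of the point `x` all show `true`. -/
def headStart (l : ℕ) (x : Fin n) : Set Coins := {ω | ∀ j < l, ω (0, [x.val, x.val], j) = true}

theorem measurableSet_headStart (l : ℕ) (x : Fin n) : MeasurableSet (headStart l x) := by
  have : headStart l x =
      ⋂ j ∈ Finset.range l, (fun ω : Coins => ω (0, [x.val, x.val], j)) ⁻¹' {true} := by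
    ext ω; simp [headStart]
  rw [this]
  exact Finset.measurableSet_biInter _ fun j _ =>
    (measurable_pi_apply _) (MeasurableSet.singleton true)

theorem coinMeasure_iInter_headStart (l : ℕ) (A : Finset (Fin n)) :
    coinMeasure.real {ω | ∀ x ∈ A, ω ∈ headStart l x} = ((1 / 2 : ℝ) ^ l) ^ A.card := by
  let e : Fin n × ℕ → ℕ × List ℕ × ℕ := fun q => (0, [q.1.val, q.1.val], q.2)
  have he : Function.Injective e := by
    rintro ⟨x, j⟩ ⟨x', j'⟩ h
    simp only [e, Prod.mk.injEq, List.cons.injEq, Fin.val_inj] at h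
    exact Prod.ext h.2.1.1 h.2.2
  have hset : {ω : Coins | ∀ x ∈ A, ω ∈ headStart l x} =
      Set.pi ((A ×ˢ Finset.range l).image e : Finset (ℕ × List ℕ × ℕ)) fun _ => {true} := by
    ext ω
    simp only [headStart, Set.mem_ofPred_eq, Set.mem_pi, Finset.mem_coe, Finset.mem_image,
      Finset.mem_product, Finset.mem_range, Set.mem_singleton_iff]
    constructor
    · rintro h _ ⟨q, ⟨h1, h2⟩, rfl⟩; exact h q.1 h1 q.2 h2
    · intro h x hx j hj; exact h _ ⟨(x, j), ⟨hx, hj⟩, rfl⟩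
  have htrue : (PMF.uniformOfFintype Bool).toMeasure {true} = 2⁻¹ := by
    rw [PMF.toMeasure_apply_singleton _ _ (MeasurableSet.singleton true),
      PMF.uniformOfFintype_apply]
    simp
  rw [hset, measureReal_def, coinMeasure, Measure.infinitePi_pi _
    (fun _ _ => MeasurableSet.singleton true)]
  simp only [htrue, Finset.prod_const]
  rw [Finset.card_image_of_injective _ he, Finset.card_product, Finset.card_range,
    ENNReal.toReal_pow, mul_comm, pow_mul]
  norm_num

/-- The events `headStart l x` are independent; the following form is proved by inclusion and
exclusion from the case `W = ∅`. -/
theorem coinMeasure_headStart_inter (l : ℕ) (A W : Finset (Fin n)) (h : Disjoint A W) :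
    coinMeasure.real {ω | (∀ x ∈ A, ω ∈ headStart l x) ∧ ∀ x ∈ W, ω ∉ headStart l x} =
      ((1 / 2 : ℝ) ^ l) ^ A.card * (1 - (1 / 2 : ℝ) ^ l) ^ W.card := by
  induction W using Finset.induction_on generalizing A with
  | empty => simpa using coinMeasure_iInter_headStart l A
  | insert y W hy ih =>
    rw [Finset.disjoint_insert_right] at h
    have h1 := ih A h.2
    have h2 := ih (insert y A) (by rw [Finset.disjoint_insert_left]; exact ⟨hy, h.2⟩)
    rw [Finset.card_insert_of_notMem h.1] at h2
    rw [Finset.card_insert_of_notMem hy]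
    have h3 := measureReal_inter_add_sdiff (μ := coinMeasure) (s :=
      {ω | (∀ x ∈ A, ω ∈ headStart l x) ∧ ∀ x ∈ W, ω ∉ headStart l x})
      (measurableSet_headStart l y)
    have e1 : {ω | (∀ x ∈ A, ω ∈ headStart l x) ∧ ∀ x ∈ W, ω ∉ headStart l x} ∩ headStart l y =
        {ω | (∀ x ∈ insert y A, ω ∈ headStart l x) ∧ ∀ x ∈ W, ω ∉ headStart l x} := by
      ext ω; simp only [Set.mem_inter_iff, Set.mem_ofPred_eq, Finset.forall_mem_insert]; tauto
    have e2 : {ω | (∀ x ∈ A, ω ∈ headStart l x) ∧ ∀ x ∈ W, ω ∉ headStart l x} \ headStart l y =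
        {ω | (∀ x ∈ A, ω ∈ headStart l x) ∧ ∀ x ∈ insert y W, ω ∉ headStart l x} := by
      ext ω; simp only [Set.mem_sdiff, Set.mem_ofPred_eq, Finset.forall_mem_insert]; tauto
    rw [e1, e2, h1, h2] at h3
    rw [pow_succ] at h3 ⊢
    linarith

/-- A fixed set is missed by the sample only with small probability. -/
theorem coinMeasure_miss_le (l : ℕ) (W : Finset (Fin n)) :
    coinMeasure.real {ω | ∀ x ∈ W, ω ∉ headStart l x} ≤
      Real.exp (-((1 / 2 : ℝ) ^ l * W.card)) := by
  have h := coinMeasure_headStart_inter l ∅ W (Finset.disjoint_empty_left W)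
  simp only [Finset.notMem_empty, false_imp_iff, implies_true, true_and, Finset.card_empty,
    pow_zero, one_mul] at h
  rw [h]
  have h1 : (1 / 2 : ℝ) ^ l ≤ 1 := pow_le_one₀ (by norm_num) (by norm_num)
  calc (1 - (1 / 2 : ℝ) ^ l) ^ W.card ≤ (Real.exp (-(1 / 2 : ℝ) ^ l)) ^ W.card :=
        pow_le_pow_left₀ (by linarith) (Real.one_sub_le_exp_neg _) _
    _ = _ := by rw [← Real.exp_nat_mul]; congr 1; ring

open Classical in
/-- A fixed set contains many more sampled points than expected only with small probability. -/
theorem coinMeasure_many_le (l s : ℕ) (W : Finset (Fin n))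
    (hs : 8 * ((1 / 2 : ℝ) ^ l * W.card) ≤ s) :
    coinMeasure.real {ω | s ≤ (W.filter fun x => ω ∈ headStart l x).card} ≤ Real.exp (-s) := by
  set p : ℝ := (1 / 2 : ℝ) ^ l with hp
  have hp0 : 0 ≤ p := by positivity
  have hsub : {ω | s ≤ (W.filter fun x => ω ∈ headStart l x).card} ⊆
      ⋃ A ∈ W.powersetCard s, {ω | ∀ x ∈ A, ω ∈ headStart l x} := by
    intro ω hω
    obtain ⟨A, hA, hAc⟩ := Finset.exists_subset_card_eq (show s ≤ _ from hω)
    simp only [Set.mem_iUnion, Finset.mem_powersetCard]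
    exact ⟨A, ⟨hA.trans (Finset.filter_subset _ _), hAc⟩,
      fun x hx => (Finset.mem_filter.1 (hA hx)).2⟩
  calc coinMeasure.real {ω | s ≤ (W.filter fun x => ω ∈ headStart l x).card}
      ≤ coinMeasure.real (⋃ A ∈ W.powersetCard s, {ω | ∀ x ∈ A, ω ∈ headStart l x}) :=
        measureReal_mono hsub (measure_ne_top _ _)
    _ ≤ ∑ A ∈ W.powersetCard s, coinMeasure.real {ω | ∀ x ∈ A, ω ∈ headStart l x} :=
        measureReal_biUnion_finset_le _ _
    _ = ∑ A ∈ W.powersetCard s, p ^ s := by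
        refine Finset.sum_congr rfl fun A hA => ?_
        rw [coinMeasure_iInter_headStart, (Finset.mem_powersetCard.1 hA).2]
    _ = (W.card.choose s) * p ^ s := by
        rw [Finset.sum_const, Finset.card_powersetCard, nsmul_eq_mul]
    _ ≤ (W.card : ℝ) ^ s / s.factorial * p ^ s :=
        mul_le_mul_of_nonneg_right (Nat.choose_le_pow_div s W.card) (by positivity)
    _ = (p * W.card) ^ s / s.factorial := by rw [mul_pow]; ring
    _ ≤ ((s : ℝ) / 8) ^ s / s.factorial := by
        gcongr
        linarith
    _ = (s : ℝ) ^ s / s.factorial * (1 / 8) ^ s := by rw [div_pow, div_pow]; ring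
    _ ≤ Real.exp s * (Real.exp (-2)) ^ s := by
        refine mul_le_mul (Real.pow_div_factorial_le_exp _ (by positivity) _)
          (pow_le_pow_left₀ (by norm_num) ?_ _) (by positivity) (Real.exp_pos _).le
        rw [Real.exp_neg, one_div]
        refine inv_anti₀ (Real.exp_pos _) ?_
        have h1 := Real.exp_one_lt_d9
        have : Real.exp 2 = Real.exp 1 * Real.exp 1 := by rw [← Real.exp_add]; norm_num
        rw [this]
        nlinarith [Real.exp_pos 1]
    _ = Real.exp (-s) := by
        rw [← Real.exp_nat_mul, ← Real.exp_add]; congr 1; ring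

/-- A point has level at most `i` if and only if its first `threshold m C n k i` coins show `true`:
this is the least number `l` with `n < 2 ^ l * (2 C k b ^ (i + 2))`, where `b` is the rounded `m`-th
root of `n`. -/
noncomputable def threshold (m C n k i : ℕ) : ℕ :=
  Nat.clog 2 (n / (2 * C * k * ceilRoot m n ^ (i + 2)) + 1)

theorem levelOf_le_iff {m C k i : ℕ} (hC : 1 ≤ C) (hk : 1 ≤ k) (hn : 1 ≤ n) (hi : i < m)
    (ω : Coins) (x : Fin n) :
    levelOf m C n k ω x ≤ i ↔ ω ∈ headStart (threshold m C n k i) x := by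
  set D := 2 * C * k * ceilRoot m n ^ (i + 2) with hD
  have hR : 0 < ceilRoot m n ^ (i + 2) := pow_pos (ceilRoot_pos m n) _
  have hD2 : 2 ≤ D := by
    have : 1 ≤ C * k * ceilRoot m n ^ (i + 2) := by
      have : 0 < C * k * ceilRoot m n ^ (i + 2) := by positivity
      exact this
    calc 2 ≤ 2 * (C * k * ceilRoot m n ^ (i + 2)) := by omega
      _ = D := by rw [hD]; ring
  rw [levelOf, level_le_iff hi]
  obtain ⟨g, hg⟩ := geom_eq_two_pow (fun j => ω (0, [x.val, x.val], j)) (Nat.clog 2 n)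
  have hle : threshold m C n k i ≤ Nat.clog 2 n := by
    refine Nat.clog_mono_right 2 ?_
    have : n / D ≤ n / 2 := Nat.div_le_div_left hD2 two_pos
    show n / D + 1 ≤ n
    omega
  have h1 : ω ∈ headStart (threshold m C n k i) x ↔
      2 ^ threshold m C n k i ≤ geom (fun j => ω (0, [x.val, x.val], j)) (Nat.clog 2 n) :=
    (two_pow_le_geom_iff hle).symm
  rw [h1, hg, Nat.pow_le_pow_iff_right one_lt_two, threshold,
    Nat.clog_le_iff_le_pow one_lt_two, Nat.succ_le_iff, Nat.div_lt_iff_lt_mul (by omega)]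
  rw [show 2 * C * (k * 2 ^ g) * ceilRoot m n ^ (i + 2) = 2 ^ g * D by rw [hD]; ring]

theorem threshold_upper {m C k i : ℕ} (hC : 1 ≤ C) (hk : 1 ≤ k) :
    (1 / 2 : ℝ) ^ threshold m C n k i * n ≤ 2 * C * k * ceilRoot m n ^ (i + 2) := by
  set D := 2 * C * k * ceilRoot m n ^ (i + 2) with hD
  have hR : 0 < ceilRoot m n ^ (i + 2) := pow_pos (ceilRoot_pos m n) _
  have hD0 : 0 < D := by positivity
  have h1 : n / D + 1 ≤ 2 ^ threshold m C n k i := Nat.le_pow_clog one_lt_two _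
  have h2 : n < 2 ^ threshold m C n k i * D := (Nat.div_lt_iff_lt_mul hD0).1 h1
  have h3 : (n : ℝ) ≤ 2 ^ threshold m C n k i * D := by exact_mod_cast h2.le
  have h4 : (2 * C * k * ceilRoot m n ^ (i + 2) : ℝ) = D := by rw [hD]; push_cast; ring
  rw [h4, one_div, inv_pow, inv_mul_le_iff₀ (by positivity)]
  exact h3

theorem threshold_lower {m C k i : ℕ} (hC : 1 ≤ C) (hk : 1 ≤ k)
    (h0 : threshold m C n k i ≠ 0) :
    (C * k * ceilRoot m n ^ (i + 2) : ℝ) ≤ (1 / 2 : ℝ) ^ threshold m C n k i * n := by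
  set D := 2 * C * k * ceilRoot m n ^ (i + 2) with hD
  have hR : 0 < ceilRoot m n ^ (i + 2) := pow_pos (ceilRoot_pos m n) _
  have hD0 : 0 < D := by positivity
  obtain ⟨l, hl⟩ := Nat.exists_eq_succ_of_ne_zero h0
  have h1 : 2 ^ l < n / D + 1 := by
    refine (Nat.lt_clog_iff_pow_lt one_lt_two).1 ?_
    have : threshold m C n k i = Nat.clog 2 (n / D + 1) := rfl
    omega
  have h2 : 2 ^ l * D ≤ n := (Nat.le_div_iff_mul_le hD0).1 (Nat.lt_succ_iff.1 h1)
  have h3 : (2 ^ l * D : ℝ) ≤ n := by exact_mod_cast h2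
  have h4 : (C * k * ceilRoot m n ^ (i + 2) : ℝ) = D / 2 := by rw [hD]; push_cast; ring
  rw [h4, hl, pow_succ, one_div, inv_pow]
  have h5 : (0 : ℝ) < 2 ^ l := by positivity
  rw [div_le_iff₀ two_pos]
  calc (D : ℝ) = (2 ^ l)⁻¹ * (2 ^ l * D) := by field_simp
    _ ≤ (2 ^ l)⁻¹ * n := by gcongr
    _ = _ := by ring

end

/-! ### The probability that the levels are bad -/

section

variable {n : ℕ}

/-- The points outside the balls given by a function; the value `none` stands for no ball. -/
def outsideFun (d : Fin n → Fin n → NNRat) {q : ℕ} (g : Fin q → Option (Fin n × Fin n × Fin n)) :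
    Finset (Fin n) :=
  Finset.univ.filter fun x => ∀ i, ∀ t, g i = some t → d t.2.1 t.2.2 < d x t.1

theorem exists_outsideFun (d : Fin n → Fin n → NNRat) {q : ℕ}
    (hist : List (Fin n × Fin n × Fin n)) (h : hist.length ≤ q) :
    ∃ g : Fin q → Option (Fin n × Fin n × Fin n), outsideFun d g = outside d hist := by
  refine ⟨fun i => hist[i.val]?, ?_⟩
  ext x
  rw [mem_outside, outsideFun, Finset.mem_filter]
  simp only [Finset.mem_univ, true_and]
  constructor
  · intro hx t ht
    obtain ⟨i, hi, rfl⟩ := List.mem_iff_getElem.1 ht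
    exact hx ⟨i, by omega⟩ _ (List.getElem?_eq_getElem hi)
  · intro hx i t ht
    exact hx t (List.mem_of_getElem? ht)

open Classical in
/-- The unlikely events for a fixed set `W` of points: the sample of level `i` misses `W` although
`W` is large, or it contains too many points of `W` although `W` is small. -/
def badEvent (m C n k s i : ℕ) (W : Finset (Fin n)) : Set Coins :=
  {ω | n < W.card * ceilRoot m n ^ (i + 1) ∧ ∀ x ∈ W, ω ∉ headStart (threshold m C n k i) x} ∪
  {ω | W.card * ceilRoot m n ^ i ≤ n ∧
    s ≤ (W.filter fun x => ω ∈ headStart (threshold m C n k i) x).card}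

/-- Let `R` be the rounded `m`-th root of `n`. From a set of more than `n / R ^ (i + 1)` points, at
least `C k R` are expected in the sample, unless all points are sampled; from a set of at most
`n / R ^ i` points, at most `s / 8`. -/
theorem coinMeasure_badEvent_le {m C k i s : ℕ} (hC : 1 ≤ C) (hk : 1 ≤ k) (hn : 1 ≤ n)
    (hs : s = 16 * C * k * ceilRoot m n ^ 2) (W : Finset (Fin n)) :
    coinMeasure.real (badEvent m C n k s i W) ≤
      2 * Real.exp (-(C * k * ceilRoot m n : ℝ)) := by
  classical
  have hn0 : (0 : ℝ) < n := by exact_mod_cast hn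
  have hR : (1 : ℝ) ≤ (ceilRoot m n : ℕ) := by exact_mod_cast ceilRoot_pos m n
  have hC' : (1 : ℝ) ≤ C := by exact_mod_cast hC
  have hk' : (1 : ℝ) ≤ k := by exact_mod_cast hk
  set R : ℝ := ((ceilRoot m n : ℕ) : ℝ) with hRdef
  have hpos := Real.exp_pos (-(C * k * R : ℝ))
  have h1 : coinMeasure.real {ω | n < W.card * ceilRoot m n ^ (i + 1) ∧
      ∀ x ∈ W, ω ∉ headStart (threshold m C n k i) x} ≤ Real.exp (-(C * k * R : ℝ)) := by
    by_cases hW : n < W.card * ceilRoot m n ^ (i + 1)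
    · simp only [hW, true_and]
      rcases eq_or_ne (threshold m C n k i) 0 with h0 | h0
      · have hne : W.Nonempty := by
          rw [Finset.nonempty_iff_ne_empty]
          rintro rfl
          simp at hW
        obtain ⟨x, hx⟩ := hne
        have : {ω : Coins | ∀ x ∈ W, ω ∉ headStart (threshold m C n k i) x} = ∅ := by
          ext ω
          simp only [Set.mem_ofPred_eq, Set.mem_empty_iff_false, iff_false]
          intro h
          exact h x hx (by rw [h0]; simp [headStart])
        rw [this, measureReal_empty]
        exact hpos.le
      · refine (coinMeasure_miss_le _ W).trans (Real.exp_le_exp.2 (neg_le_neg ?_))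
        have hl := threshold_lower (n := n) (i := i) (m := m) hC hk h0
        rw [← hRdef] at hl
        have hW' : (n : ℝ) ≤ W.card * R ^ (i + 1) := by rw [hRdef]; exact_mod_cast hW.le
        set p : ℝ := (1 / 2 : ℝ) ^ threshold m C n k i
        have hp : 0 ≤ p := by positivity
        have hRi : 0 < R ^ (i + 1) := by positivity
        refine le_of_mul_le_mul_right ?_ hRi
        calc C * k * R * R ^ (i + 1) = C * k * R ^ (i + 2) := by ring
          _ ≤ p * n := hl
          _ ≤ p * (W.card * R ^ (i + 1)) := by gcongr
          _ = _ := by ring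
    · simp only [hW, false_and, Set.ofPred_false, measureReal_empty]
      exact hpos.le
  have h2 : coinMeasure.real {ω | W.card * ceilRoot m n ^ i ≤ n ∧
      s ≤ (W.filter fun x => ω ∈ headStart (threshold m C n k i) x).card} ≤
      Real.exp (-(C * k * R : ℝ)) := by
    by_cases hW : W.card * ceilRoot m n ^ i ≤ n
    · simp only [hW, true_and]
      have hs' : (s : ℝ) = 16 * C * k * R ^ 2 := by rw [hs, hRdef]; push_cast; ring
      have hW' : (W.card : ℝ) * R ^ i ≤ n := by rw [hRdef]; exact_mod_cast hW
      refine (coinMeasure_many_le _ s W ?_).trans (Real.exp_le_exp.2 (neg_le_neg ?_))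
      · have hu := threshold_upper (n := n) (i := i) (m := m) hC hk
        rw [← hRdef] at hu
        set p : ℝ := (1 / 2 : ℝ) ^ threshold m C n k i
        have hp : 0 ≤ p := by positivity
        have hRi : 0 < R ^ i := by positivity
        rw [hs']
        refine le_of_mul_le_mul_right ?_ hRi
        calc 8 * (p * W.card) * R ^ i = 8 * (p * (W.card * R ^ i)) := by ring
          _ ≤ 8 * (p * n) := by gcongr
          _ ≤ 8 * (2 * C * k * R ^ (i + 2)) := by gcongr
          _ = _ := by ring
      · rw [hs']
        have : 0 ≤ (C * k * R : ℝ) := by positivity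
        calc (C * k * R : ℝ) ≤ (C * k * R) * (16 * R) :=
              le_mul_of_one_le_right this (by linarith)
          _ = _ := by ring
    · simp only [hW, false_and, Set.ofPred_false, measureReal_empty]
      exact hpos.le
  calc _ ≤ _ := measureReal_union_le _ _
    _ ≤ _ := by linarith

/-- If no unlikely event occurs, then the levels are good. -/
theorem not_goodLevels_subset (d : Fin n → Fin n → NNRat) {m C k s : ℕ} (hC : 1 ≤ C) (hk : 1 ≤ k)
    (hn : 1 ≤ n) :
    {ω | ¬ GoodLevels d (levelOf m C n k ω) m k s} ⊆
      ⋃ i ∈ Finset.range m, ⋃ g ∈ (Finset.univ :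
        Finset (Fin (m * k) → Option (Fin n × Fin n × Fin n))),
        badEvent m C n k s i (outsideFun d g) := by
  classical
  intro ω hω
  have hω' : ¬ GoodLevels d (levelOf m C n k ω) m k s := hω
  unfold GoodLevels at hω'
  push Not at hω'
  obtain ⟨i, hi, hist, hlen, hlev, hcard⟩ := hω'
  obtain ⟨g, hg⟩ := exists_outsideFun d hist hlen
  simp only [Set.mem_iUnion, Finset.mem_range, Finset.mem_univ, exists_prop, true_and]
  by_cases hW : (outside d hist).card * ceilRoot m n ^ i ≤ n
  · refine ⟨i, hi, g, Or.inr ⟨by rw [hg]; exact hW, ?_⟩⟩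
    rw [hg]
    refine hcard.le.trans (Finset.card_le_card fun x hx => ?_)
    rw [Finset.mem_filter] at hx ⊢
    exact ⟨hx.1, (levelOf_le_iff hC hk hn hi ω x).1 hx.2.le⟩
  · cases i with
    | zero =>
      refine absurd ?_ hW
      rw [pow_zero, mul_one]
      exact (Finset.card_le_univ _).trans (by simp)
    | succ i =>
      refine ⟨i, by omega, g, Or.inl ⟨by rw [hg]; exact not_le.1 hW, ?_⟩⟩
      rw [hg]
      intro x hx h
      have h1 := hlev x hx
      have h2 := (levelOf_le_iff hC hk hn (by omega) ω x).2 h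
      omega

/-- The levels are good with high probability. The choice of `C` makes `exp (-C k R)` absorb both
the number `exp (4 m ^ 2 k R)` of sets and a factor `n`. -/
theorem coinMeasure_not_goodLevels_le (d : Fin n → Fin n → NNRat) {m C k s : ℕ} (hm : m ≠ 0)
    (hC : C = 4 * m ^ 2 + m) (hk : 1 ≤ k) (hn : 1 ≤ n)
    (hs : s = 16 * C * k * ceilRoot m n ^ 2) :
    coinMeasure {ω | ¬ GoodLevels d (levelOf m C n k ω) m k s} ≤
      ((2 * m : ℕ) : ENNReal) / (n : ENNReal) := by
  have hm1 : 1 ≤ m := Nat.one_le_iff_ne_zero.2 hm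
  have hC1 : 1 ≤ C := by rw [hC]; omega
  rcases Nat.lt_or_ge 1 n with hn2 | hn2
  · have hn0 : (0 : ℝ) < n := by exact_mod_cast hn
    have hkey : coinMeasure.real {ω | ¬ GoodLevels d (levelOf m C n k ω) m k s} ≤
        ((2 * m : ℕ) : ℝ) / n := by
      set R : ℝ := ((ceilRoot m n : ℕ) : ℝ) with hR
      have hR1 : (1 : ℝ) ≤ R := by rw [hR]; exact_mod_cast ceilRoot_pos m n
      have hlog : Real.log n ≤ m * R := by
        have h1 : (n : ℝ) ≤ R ^ m := by rw [hR]; exact_mod_cast le_ceilRoot_pow hm n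
        calc Real.log n ≤ Real.log (R ^ m) := Real.log_le_log hn0 h1
          _ = m * Real.log R := Real.log_pow _ _
          _ ≤ m * R := by
            gcongr
            exact Real.log_le_self (by linarith)
      have hk1 : (1 : ℝ) ≤ k := by exact_mod_cast hk
      have hmR : 0 ≤ (m : ℝ) * R := by positivity
      have hcount : ((Fintype.card (Fin (m * k) → Option (Fin n × Fin n × Fin n)) : ℕ) : ℝ) ≤
          Real.exp (4 * m * k * (m * R)) := by
        have h4 : n ^ 3 + 1 ≤ n ^ 4 := by
          have : n ^ 3 * 2 ≤ n ^ 3 * n := Nat.mul_le_mul_left _ hn2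
          have h3 : 1 ≤ n ^ 3 := Nat.one_le_pow _ _ hn
          have : n ^ 3 * n = n ^ 4 := by ring
          omega
        rw [Fintype.card_fun, Fintype.card_option, Fintype.card_prod, Fintype.card_prod,
          Fintype.card_fin, Fintype.card_fin]
        calc (((n * (n * n) + 1) ^ (m * k) : ℕ) : ℝ) ≤ (((n ^ 4) ^ (m * k) : ℕ) : ℝ) := by
              refine Nat.cast_le.2 (Nat.pow_le_pow_left ?_ _)
              calc n * (n * n) + 1 = n ^ 3 + 1 := by ring
                _ ≤ n ^ 4 := h4
          _ = Real.exp (Real.log n) ^ (4 * (m * k)) := by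
              rw [Real.exp_log hn0, pow_mul]; push_cast; ring
          _ = Real.exp ((4 * (m * k) : ℕ) * Real.log n) := (Real.exp_nat_mul _ _).symm
          _ ≤ _ := by
              refine Real.exp_le_exp.2 ?_
              push_cast
              calc 4 * (m * k : ℝ) * Real.log n ≤ 4 * (m * k : ℝ) * (m * R) := by gcongr
                _ = _ := by ring
      calc coinMeasure.real {ω | ¬ GoodLevels d (levelOf m C n k ω) m k s}
          ≤ _ := measureReal_mono (not_goodLevels_subset d hC1 hk hn) (measure_ne_top _ _)
        _ ≤ ∑ i ∈ Finset.range m, coinMeasure.real (⋃ g ∈ (Finset.univ :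
            Finset (Fin (m * k) → Option (Fin n × Fin n × Fin n))),
            badEvent m C n k s i (outsideFun d g)) := measureReal_biUnion_finset_le _ _
        _ ≤ ∑ i ∈ Finset.range m, ∑ g : Fin (m * k) → Option (Fin n × Fin n × Fin n),
            2 * Real.exp (-(C * k * R : ℝ)) := by
          refine Finset.sum_le_sum fun i _ => (measureReal_biUnion_finset_le _ _).trans ?_
          exact Finset.sum_le_sum fun g _ => coinMeasure_badEvent_le hC1 hk hn hs _
        _ = m * (Fintype.card (Fin (m * k) → Option (Fin n × Fin n × Fin n)) *
            (2 * Real.exp (-(C * k * R : ℝ)))) := by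
          rw [Finset.sum_const, Finset.sum_const, Finset.card_range, nsmul_eq_mul, nsmul_eq_mul,
            Finset.card_univ]
        _ ≤ m * (Real.exp (4 * m * k * (m * R)) * (2 * Real.exp (-(C * k * R : ℝ)))) := by
          gcongr
        _ = 2 * m * Real.exp (-(k * (m * R))) := by
          rw [show Real.exp (4 * m * k * (m * R)) * (2 * Real.exp (-(C * k * R : ℝ))) =
            2 * (Real.exp (4 * m * k * (m * R)) * Real.exp (-(C * k * R : ℝ))) by ring,
            ← Real.exp_add, hC]
          push_cast
          rw [show (4 * m * k * (m * R) + -((4 * (m : ℝ) ^ 2 + m) * k * R)) = -(k * (m * R)) by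
            ring]
          ring
        _ ≤ 2 * m * Real.exp (-Real.log n) := by
          gcongr
          calc Real.log n ≤ m * R := hlog
            _ ≤ k * (m * R) := le_mul_of_one_le_left hmR hk1
        _ = _ := by
          rw [Real.exp_neg, Real.exp_log hn0]; push_cast; ring
    calc _ = ENNReal.ofReal (coinMeasure.real {ω | ¬ GoodLevels d (levelOf m C n k ω) m k s}) :=
          (ofReal_measureReal (measure_ne_top _ _)).symm
      _ ≤ ENNReal.ofReal (((2 * m : ℕ) : ℝ) / n) := ENNReal.ofReal_le_ofReal hkey
      _ = _ := by rw [ENNReal.ofReal_div_of_pos hn0, ENNReal.ofReal_natCast, ENNReal.ofReal_natCast]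
  -- For `n = 1` the asserted bound is at least one.
  · have : n = 1 := le_antisymm hn2 hn
    refine prob_le_one.trans ?_
    rw [this, Nat.cast_one, div_one]
    exact_mod_cast (by omega : 1 ≤ 2 * m)

end

/-! ### Time and memory in terms of `n` and `k` -/

/-- The rounded root `R` is `1`, or `R ≤ 2 (R - 1)`, where `R - 1` is less than the exact root. -/
theorem ceilRoot_pow_five_le {δ : ℝ} (hδ : 0 < δ) {n : ℕ} (hn : 1 ≤ n) :
    (ceilRoot (5 * ⌈1 / δ⌉₊) n : ℝ) ^ 5 ≤ 32 * (n : ℝ) ^ δ := by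
  have hn1 : (1 : ℝ) ≤ n := by exact_mod_cast hn
  have ht0 : 0 < ⌈1 / δ⌉₊ := Nat.ceil_pos.2 (by positivity)
  have hδt : (⌈1 / δ⌉₊ : ℝ)⁻¹ ≤ δ := by
    rw [inv_le_comm₀ (by exact_mod_cast ht0) hδ, ← one_div]
    exact Nat.le_ceil _
  generalize ⌈1 / δ⌉₊ = t at *
  have h1 : (1 : ℝ) ≤ (n : ℝ) ^ δ := Real.one_le_rpow hn1 hδ.le
  obtain ⟨j, hj⟩ : ∃ j, ceilRoot (5 * t) n = j + 1 := ⟨_, rfl⟩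
  rw [hj]
  cases j with
  | zero => norm_num; linarith
  | succ j =>
    have h2 : (j + 1) ^ (5 * t) < n := lt_of_lt_ceilRoot (by omega)
    have h3 : ((j : ℝ) + 1) ^ 5 ≤ (n : ℝ) ^ δ := by
      calc ((j : ℝ) + 1) ^ 5 = ((((j : ℝ) + 1) ^ 5) ^ t) ^ (t : ℝ)⁻¹ :=
            (Real.pow_rpow_inv_natCast (by positivity) ht0.ne').symm
        _ ≤ (n : ℝ) ^ (t : ℝ)⁻¹ := by
            gcongr
            rw [← pow_mul]
            exact_mod_cast h2.le
        _ ≤ (n : ℝ) ^ δ := Real.rpow_le_rpow_of_exponent_le hn1 hδt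
    calc ((j + 1 + 1 : ℕ) : ℝ) ^ 5 ≤ (2 * ((j : ℝ) + 1)) ^ 5 := by
          gcongr
          push_cast
          linarith [Nat.cast_nonneg (α := ℝ) j]
      _ = 32 * ((j : ℝ) + 1) ^ 5 := by ring
      _ ≤ _ := by gcongr

theorem size_le_mul_ceilRoot {m : ℕ} (hm : m ≠ 0) (n : ℕ) : n.size ≤ m * ceilRoot m n := by
  rw [Nat.size_le]
  calc n ≤ ceilRoot m n ^ m := le_ceilRoot_pow hm n
    _ < (2 ^ ceilRoot m n) ^ m := Nat.pow_lt_pow_left Nat.lt_two_pow_self hm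
    _ = _ := by rw [← pow_mul, mul_comm]

theorem goodLevels_of_le {n : ℕ} (d : Fin n → Fin n → NNRat) (lam : Fin n → ℕ) {m k s : ℕ}
    (h : n ≤ s) : GoodLevels d lam m k s := fun _ _ _ _ _ =>
  ((Finset.card_le_univ _).trans (by simp)).trans h

/-- The length of numbers, in bits, that suffices for all numbers in a run of `algorithm m C`. -/
def wordLength (p m n : ℕ) : ℕ := (p + 5) * n.size + (m + 8)

theorem wordLength_succ_le (p m : ℕ) {n : ℕ} (hn : 1 ≤ n) :
    wordLength p m n + 1 ≤ (p + m + 14) * n.size := by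
  have h : 1 ≤ n.size := Nat.size_pos.2 hn
  have : m + 9 ≤ (m + 9) * n.size := Nat.le_mul_of_pos_right _ h
  unfold wordLength
  nlinarith

theorem pow_lt_two_pow_wordLength (p m n : ℕ) : n ^ p < 2 ^ wordLength p m n := by
  calc n ^ p ≤ (2 ^ n.size) ^ p := Nat.pow_le_pow_left n.lt_size_self.le _
    _ = 2 ^ (p * n.size) := by rw [← pow_mul, mul_comm]
    _ < _ := Nat.pow_lt_pow_right (by norm_num) (by unfold wordLength; nlinarith)

theorem pow_four_lt_two_pow_wordLength (p m : ℕ) {n : ℕ} (hn : 1 ≤ n) :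
    n ^ 4 + 8 < 2 ^ wordLength p m n := by
  have h1 : 1 ≤ n ^ 4 := Nat.one_le_pow _ _ hn
  calc n ^ 4 + 8 ≤ n ^ 4 * 2 ^ 4 := by omega
    _ ≤ (2 ^ n.size) ^ 4 * 2 ^ 4 :=
        Nat.mul_le_mul_right _ (Nat.pow_le_pow_left n.lt_size_self.le _)
    _ = 2 ^ (4 * n.size + 4) := by rw [pow_add, ← pow_mul, mul_comm n.size]
    _ < _ := Nat.pow_lt_pow_right (by norm_num) (by unfold wordLength; nlinarith)

theorem add_two_lt_two_pow_wordLength (p m n : ℕ) : m + 2 < 2 ^ wordLength p m n :=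
  Nat.lt_two_pow_self.trans_le (Nat.pow_le_pow_right two_pos (by unfold wordLength; omega))

theorem limits_polynomial {p m n M : ℕ} (hn : 1 ≤ n)
    (hM : (6 * m ^ 2 + 56) * (p + m + 14) ≤ M) :
    Limits n (wordLength p m n) (m * n) n (M * n ^ M) ((M * n ^ M : ℕ) : ℝ) := by
  have hM' : 784 ≤ M := le_trans (by nlinarith) hM
  refine ⟨hn, pow_four_lt_two_pow_wordLength p m hn, ?_, ?_⟩
  · exact Nat.mul_le_mul (by omega) (Nat.pow_le_pow_right hn (by omega))
  · refine Nat.cast_le.2 ?_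
    have hsize : n.size ≤ n := Nat.size_le.2 Nat.lt_two_pow_self
    have hn2 : n ≤ n ^ 2 := Nat.le_self_pow two_ne_zero n
    calc (6 * (m * n) ^ 2 + 16 * n + 40) * (wordLength p m n + 1)
        ≤ ((6 * m ^ 2 + 56) * n ^ 2) * ((p + m + 14) * n) :=
          Nat.mul_le_mul (by rw [mul_pow, add_mul, ← mul_assoc]; omega)
            ((wordLength_succ_le p m hn).trans (Nat.mul_le_mul_left _ hsize))
      _ = (6 * m ^ 2 + 56) * (p + m + 14) * n ^ 3 := by ring
      _ ≤ M * n ^ M := Nat.mul_le_mul hM (Nat.pow_le_pow_right hn (by omega))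

theorem limits_small {p m n k M C : ℕ} {δ : ℝ} (hδ : 0 < δ) (hm : m = 5 * ⌈1 / δ⌉₊) (hn : 1 ≤ n)
    (hk : 1 ≤ k) (hM : (1536 * C ^ 2 + 56) * (p + m + 14) * m * 32 ≤ M) (hM' : 100 ≤ M) :
    Limits n (wordLength p m n) (16 * C * k * ceilRoot m n ^ 2) k (M * n ^ M)
      ((M : ℝ) * (k : ℝ) ^ 2 * (n : ℝ) ^ δ) := by
  refine ⟨hn, pow_four_lt_two_pow_wordLength p m hn, ?_, ?_⟩
  · exact Nat.mul_le_mul (by omega) (Nat.pow_le_pow_right hn (by omega))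
  · have hm0 : m ≠ 0 := by
      have : 0 < ⌈1 / δ⌉₊ := Nat.ceil_pos.2 (by positivity)
      omega
    have hR5 := ceilRoot_pow_five_le hδ hn
    rw [← hm] at hR5
    have hsize := size_le_mul_ceilRoot hm0 n
    have hR := ceilRoot_pos m n
    generalize ceilRoot m n = R at *
    have hkR : 1 ≤ k ^ 2 * R ^ 4 := Nat.mul_pos (by positivity) (by positivity)
    have hkR' : k ≤ k ^ 2 * R ^ 4 := (Nat.le_self_pow two_ne_zero k).trans
      (Nat.le_mul_of_pos_right _ (by positivity))
    have hnat : (6 * (16 * C * k * R ^ 2) ^ 2 + 16 * k + 40) * (wordLength p m n + 1) ≤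
        (1536 * C ^ 2 + 56) * (p + m + 14) * m * k ^ 2 * R ^ 5 := by
      calc (6 * (16 * C * k * R ^ 2) ^ 2 + 16 * k + 40) * (wordLength p m n + 1)
          ≤ ((1536 * C ^ 2 + 56) * (k ^ 2 * R ^ 4)) * ((p + m + 14) * (m * R)) := by
            refine Nat.mul_le_mul ?_
              ((wordLength_succ_le p m hn).trans (Nat.mul_le_mul_left _ hsize))
            calc 6 * (16 * C * k * R ^ 2) ^ 2 + 16 * k + 40
                = 1536 * C ^ 2 * (k ^ 2 * R ^ 4) + 16 * k + 40 := by ring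
              _ ≤ _ := by rw [add_mul]; omega
        _ = _ := by ring
    calc (((6 * (16 * C * k * R ^ 2) ^ 2 + 16 * k + 40) * (wordLength p m n + 1) : ℕ) : ℝ)
        ≤ (((1536 * C ^ 2 + 56) * (p + m + 14) * m * k ^ 2 * R ^ 5 : ℕ) : ℝ) :=
          Nat.cast_le.2 hnat
      _ = (((1536 * C ^ 2 + 56) * (p + m + 14) * m : ℕ) : ℝ) * (k : ℝ) ^ 2 * (R : ℝ) ^ 5 := by
          push_cast; ring
      _ ≤ (((1536 * C ^ 2 + 56) * (p + m + 14) * m : ℕ) : ℝ) * (k : ℝ) ^ 2 *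
          (32 * (n : ℝ) ^ δ) := by gcongr
      _ = (((1536 * C ^ 2 + 56) * (p + m + 14) * m * 32 : ℕ) : ℝ) * (k : ℝ) ^ 2 *
          (n : ℝ) ^ δ := by push_cast; ring
      _ ≤ _ := by
          have : (((1536 * C ^ 2 + 56) * (p + m + 14) * m * 32 : ℕ) : ℝ) ≤ M := Nat.cast_le.2 hM
          gcongr

end MR

theorem theorem1 :
    ∃ (α : NNRat) (c : ℕ), ∀ δ : ℝ, 0 < δ →
      ∃ A : MR.Algorithm, A.length ≤ c * ⌈1 / δ⌉₊ ∧
        ∀ p : ℕ, ∃ M : ℕ, ∀ (n k : ℕ) (d : Fin n → Fin n → NNRat),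
          1 ≤ k → k ≤ n → MR.IsMetric d →
          (∀ x y, (d x y).num ≤ n ^ p ∧ (d x y).den ≤ n ^ p) →
          ∀ shuffle : ℕ → List MR.KV → List MR.KV, (∀ r l, (shuffle r l).Perm l) →
            (∀ ω : MR.Coins, ∃ out : List MR.KV,
              MR.RunsFrom (M * n ^ M) ((M * n ^ M : ℕ) : ℝ) shuffle ω [n, k] 0 A
                (MR.inputPairs d) out) ∧
            MR.coinMeasure {ω | ¬ ∃ (out : List MR.KV) (S : Finset (Fin n)),
              MR.RunsFrom (M * n ^ M) ((M : ℝ) * (k : ℝ) ^ 2 * (n : ℝ) ^ δ) shuffle ω [n, k] 0 A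
                (MR.inputPairs d) out ∧
              MR.Outputs out S ∧ MR.IsApprox d k α S} ≤ (M : ENNReal) / (n : ENNReal) := by
  refine ⟨4, 18, fun δ hδ => ?_⟩
  have ht : 0 < ⌈1 / δ⌉₊ := Nat.ceil_pos.2 (by positivity)
  obtain ⟨m, hm⟩ : ∃ m, m = 5 * ⌈1 / δ⌉₊ := ⟨_, rfl⟩
  obtain ⟨C, hC⟩ : ∃ C, C = 4 * m ^ 2 + m := ⟨_, rfl⟩
  have hm0 : m ≠ 0 := by omega
  have hC1 : 1 ≤ C := by omega
  refine ⟨MR.algorithm m C, by rw [MR.length_algorithm]; omega, fun p => ?_⟩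
  obtain ⟨M, hM⟩ : ∃ M, M = (6 * m ^ 2 + 56) * (p + m + 14) +
    (1536 * C ^ 2 + 56) * (p + m + 14) * m * 32 + 2 * m + 100 := ⟨_, rfl⟩
  refine ⟨M, fun n k d hk hkn hd hnum shuffle hsh => ?_⟩
  have hn : 1 ≤ n := hk.trans hkn
  have hdist : ∀ x y, (d x y).num < 2 ^ MR.wordLength p m n ∧
      (d x y).den < 2 ^ MR.wordLength p m n := fun x y =>
    ⟨(hnum x y).1.trans_lt (MR.pow_lt_two_pow_wordLength p m n),
      (hnum x y).2.trans_lt (MR.pow_lt_two_pow_wordLength p m n)⟩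
  have hmb := MR.add_two_lt_two_pow_wordLength p m n
  constructor
  · intro ω
    -- With `m n` as the bound on the samples, all levels are good.
    obtain ⟨out, -, h, -⟩ := MR.exists_run (MR.limits_polynomial (M := M) hn (by omega)) hk hkn hkn
      (Nat.mul_le_mul_left m hkn) hd hm0 hC1 hmb hdist hsh ω
      (MR.goodLevels_of_le _ _ (Nat.le_mul_of_pos_left n (by omega)))
    exact ⟨out, h⟩
  · obtain ⟨s, hs⟩ : ∃ s, s = 16 * C * k * MR.ceilRoot m n ^ 2 := ⟨_, rfl⟩
    have hms : m * k ≤ s := by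
      have hR : 1 ≤ MR.ceilRoot m n ^ 2 := Nat.one_le_pow _ _ (MR.ceilRoot_pos m n)
      calc m * k ≤ 16 * C * k := Nat.mul_le_mul_right _ (by omega)
        _ ≤ s := by rw [hs]; exact Nat.le_mul_of_pos_right _ hR
    have lim := MR.limits_small (p := p) (M := M) (C := C) hδ hm hn hk (by omega) (by omega)
    rw [← hs] at lim
    refine le_trans (measure_mono fun ω hω => ?_)
      ((MR.coinMeasure_not_goodLevels_le d hm0 hC hk hn hs).trans
        (ENNReal.div_le_div_right (Nat.cast_le.2 (by omega)) _))
    exact fun hgood => hω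
      (MR.exists_run lim hk hkn le_rfl hms hd hm0 hC1 hmb hdist hsh ω hgood)
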